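/- A square means the boundary of a non-degenerate square in $\mathbb{R}^2$ with sides parallel to the axes. Let $S\subset\mathbb{R}^2$ be non-empty and let $B\subset\mathbb{R}^2$ contain a square centred at every point of $S$. Then: (a) if $S$ and $B$ are bounded, $\overline{\dim}_B B\ge\max\left(1,\tfrac78\,\overline{\dim}_B S\right)$ and $\underline{\dim}_B B\ge\max\left(1,\tfrac78\,\underline{\dim}_B S\right)$, where $\overline{\dim}_B$ and $\underline{\dim}_B$ are the upper and lower box counting dimensions; (b) $\dim_P B\ge 1+\tfrac38\dim_P S$, where $\dim_P$ is the packing dimension. Conversely, for every $s\in[0,2]$: (a') there are compact sets $S,B\subset\mathbb{R}^2$, with $S\neq\emptyset$, such that $B$ contains a square centred at every point of $S$, the box counting dimensions of $S$ and $B$ exist, $\dim_B S=s$, and $\dim_B B=\max\left(1,\tfrac78 s\right)$; (b') there are compact sets $S,B\subset\mathbb{R}^2$, with $S\neq\emptyset$, such that $B$ contains a square centred at every point of $S$, $\dim_P S=s$, and $\dim_P B=1+\tfrac38 s$. -/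

import Mathlib

open scoped NNReal ENNReal Topology

noncomputable section

/-- The Euclidean plane. -/
abbrev Plane : Type := EuclideanSpace ℝ (Fin 2)

/-- The boundary of the axes-parallel square with centre `c` and side length `2 * r`. -/
def squareBoundary (c : Plane) (r : ℝ) : Set Plane :=
  {p | max |p 0 - c 0| |p 1 - c 1| = r}

/-- `B` contains the boundary of a (non-degenerate) axes-parallel square centred at every point
of `S`. -/
def ContainsSquares (S B : Set Plane) : Prop :=
  ∀ c ∈ S, ∃ r : ℝ, 0 < r ∧ squareBoundary c r ⊆ B

/-- `log N_δ(F) / (-log δ)`, where `N_δ(F)` is the least number of closed balls of radius `δ` that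
cover `F`. -/
def boxRatio {X : Type*} [PseudoMetricSpace X] (F : Set X) (δ : ℝ≥0) : EReal :=
  ENNReal.log ((Metric.externalCoveringNumber δ F : ℕ∞) : ℝ≥0∞) /
    ((-Real.log (δ : ℝ) : ℝ) : EReal)

/-- Lower box counting dimension (used for non-empty bounded sets). -/
def lowerBoxDim {X : Type*} [PseudoMetricSpace X] (F : Set X) : EReal :=
  Filter.liminf (boxRatio F) (𝓝[>] (0 : ℝ≥0))

/-- Upper box counting dimension (used for non-empty bounded sets). -/
def upperBoxDim {X : Type*} [PseudoMetricSpace X] (F : Set X) : EReal :=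
  Filter.limsup (boxRatio F) (𝓝[>] (0 : ℝ≥0))

/-- The box counting dimension of `F` exists and equals `d`. -/
def HasBoxDim {X : Type*} [PseudoMetricSpace X] (F : Set X) (d : ℝ) : Prop :=
  lowerBoxDim F = (d : EReal) ∧ upperBoxDim F = (d : EReal)

/-- A finite `δ`-packing of `F`: disjoint closed balls with centres in `F` and positive radii at
most `δ`. The pair `(x, r)` stands for the closed ball of centre `x` and radius `r`. -/
def IsBallPacking {X : Type*} [PseudoMetricSpace X] (F : Set X) (δ : ℝ) (t : Finset (X × ℝ)) :
    Prop :=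
  (∀ p ∈ t, p.1 ∈ F ∧ 0 < p.2 ∧ p.2 ≤ δ) ∧
    (t : Set (X × ℝ)).PairwiseDisjoint (fun p => Metric.closedBall p.1 p.2)

/-- `P^s_δ(F)`: the supremum of `∑ |B_i| ^ s` over the `δ`-packings `(B_i)` of `F`, with
`|B_i| = 2 r_i` the diameter. Since the terms are nonnegative, finite packings and countable
packings give the same supremum. -/
def packingPre {X : Type*} [PseudoMetricSpace X] (s : ℝ≥0) (δ : ℝ) (F : Set X) : ℝ≥0∞ :=
  ⨆ (t : Finset (X × ℝ)) (_ : IsBallPacking F δ t), ∑ p ∈ t, ENNReal.ofReal (2 * p.2) ^ (s : ℝ)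

/-- The `s`-dimensional packing premeasure `P^s_0(F) = lim_{δ → 0} P^s_δ(F)`; as `P^s_δ(F)` is
monotone in `δ`, the limit is the infimum over `δ > 0`. -/
def packingPremeasure {X : Type*} [PseudoMetricSpace X] (s : ℝ≥0) (F : Set X) : ℝ≥0∞ :=
  ⨅ (δ : ℝ) (_ : 0 < δ), packingPre s δ F

/-- The `s`-dimensional packing measure
`P^s(F) = inf {∑ P^s_0(F_i) : F ⊆ ⋃ F_i}`, over countable covers. -/
def packingMeasure {X : Type*} [PseudoMetricSpace X] (s : ℝ≥0) (F : Set X) : ℝ≥0∞ :=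
  ⨅ (G : ℕ → Set X) (_ : F ⊆ ⋃ i, G i), ∑' i, packingPremeasure s (G i)

/-- Packing dimension: `sup {s ≥ 0 : P^s(F) = ∞}`. -/
def packingDim {X : Type*} [PseudoMetricSpace X] (F : Set X) : ℝ≥0∞ :=
  ⨆ (s : ℝ≥0) (_ : packingMeasure s F = ∞), (s : ℝ≥0∞)

end

/-!
Lower bounds. Suppose that a finite set `V ⊆ ℤ × ℤ` contains the four vertices of a square centred
at each point of `S`. Each centre is the intersection of a line of slope `1` and a line of slope
`-1`, and on each of them it is the midpoint of two points of `V`. There are at most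
`|V| ^ (2 / 3)` lines of either slope with more than `|V| ^ (1 / 3)` points of `V`, so they meet in
at most `|V| ^ (4 / 3)` points; the other lines give at most `2 |V| ^ (4 / 3)` midpoints. Hence
`|S| ≤ 3 |V| ^ (4 / 3)` (`card_centres_le_of_vertices`). If the sides lie on lines that contain at
least `M` points of `B` each, then there are at most `|B| / M` such lines in either direction, and
the vertices lie in a product set, so `|S| ≤ 3 (|B| / M) ^ (8 / 3)` (`card_centres_le_of_lines`).

For the box counting dimensions this is applied at scale `δ` in cells of side `L` to squares of
radius about `L`, where `M = L` and also `|S| ≤ L ^ 2`; the two estimates combine to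
`|S| ≤ 3 |B| ^ (8 / 7)`, and a sum over cells and dyadic radii loses a logarithm only. For the
packing dimension, `B` is covered by an increasing sequence of sets `A i` with small covering
numbers, and `S` is the union over `i` of the sets of centres for which all four sides meet `A i` in
length at least `1 / (i + 1)`; for such a set `M` is of order `1 / δ`.

Sharpness. Write the coordinates `a`, `b` of a centre as digit expansions in slowly growing bases
and choose the digits of the radius `r` to be those of `a`, `-a`, `b`, `-b` according to the
position modulo `4`. Then each of `a - r`, `a + r`, `b - r`, `b + r` has vanishing digits at a
quarter of the positions (`exists_radius`), so that about `N ^ (3 / 4)` lines carry the sides of the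
squares around the `N ^ 2` pairs of expansions. The digits of the differences may be twice as large,
but as the bases `2 ^ k` grow, this changes covering numbers by subpolynomial factors only
(`digitCount_le`). With weights for which the set of centres has dimension `s`, the squares
give the packing dimension `1 + 3 s / 8`. For the box counting dimensions, a union of finite pieces
is used, which shrink to a point: the `K`-th piece is the set of expansions cut off at position `K`,
scaled to size about `δ ^ (1 - s / 2)` where `δ` is the distance between its neighbouring points.
-/

open scoped NNReal ENNReal Topology
open Filter Set

/-! ### Covers by closed balls and box counting dimensions -/

/-- `F` is covered by at most `n` closed balls of radius `δ`. The bound `n` is a real number, so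
that it can be given by a formula such as `C * δ ^ (-t)`. -/
def Covers {X : Type*} [PseudoMetricSpace X] (F : Set X) (δ n : ℝ) : Prop :=
  ∃ T : Finset X, (T.card : ℝ) ≤ n ∧ ∀ x ∈ F, ∃ y ∈ T, dist x y ≤ δ

section Covers

variable {X : Type*} [PseudoMetricSpace X] {F G : Set X} {δ δ' m n : ℝ}

lemma Covers.mono_card (h : Covers F δ m) (hmn : m ≤ n) : Covers F δ n := by
  obtain ⟨T, hT, hc⟩ := h
  exact ⟨T, hT.trans hmn, hc⟩

lemma Covers.mono_radius (h : Covers F δ n) (hδ : δ ≤ δ') : Covers F δ' n := by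
  obtain ⟨T, hT, hc⟩ := h
  refine ⟨T, hT, fun x hx => ?_⟩
  obtain ⟨y, hy, hxy⟩ := hc x hx
  exact ⟨y, hy, hxy.trans hδ⟩

lemma Covers.mono_set (h : Covers F δ n) (hG : G ⊆ F) : Covers G δ n := by
  obtain ⟨T, hT, hc⟩ := h
  exact ⟨T, hT, fun x hx => hc x (hG hx)⟩

lemma Covers.union (hF : Covers F δ m) (hG : Covers G δ n) : Covers (F ∪ G) δ (m + n) := by
  classical
  obtain ⟨T, hT, hc⟩ := hF
  obtain ⟨U, hU, hd⟩ := hG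
  refine ⟨T ∪ U, ?_, ?_⟩
  · have : ((T ∪ U).card : ℝ) ≤ T.card + U.card := by exact_mod_cast Finset.card_union_le T U
    linarith
  · rintro x (hx | hx)
    · obtain ⟨y, hy, h⟩ := hc x hx
      exact ⟨y, Finset.mem_union_left _ hy, h⟩
    · obtain ⟨y, hy, h⟩ := hd x hx
      exact ⟨y, Finset.mem_union_right _ hy, h⟩

lemma Covers.biUnion {ι : Type*} {F : ι → Set X} {n : ι → ℝ} (I : Finset ι)
    (h : ∀ i ∈ I, Covers (F i) δ (n i)) : Covers (⋃ i ∈ I, F i) δ (∑ i ∈ I, n i) := by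
  classical
  induction I using Finset.induction_on with
  | empty => exact ⟨∅, by simp, by simp⟩
  | insert a s ha ih =>
    rw [Finset.set_biUnion_insert, Finset.sum_insert ha]
    exact (h a (Finset.mem_insert_self _ _)).union
      (ih fun i hi => h i (Finset.mem_insert_of_mem hi))

lemma Covers.nonneg (h : Covers F δ n) : 0 ≤ n := by
  obtain ⟨T, hT, -⟩ := h
  exact (Nat.cast_nonneg _).trans hT

lemma Covers.one_le (h : Covers F δ n) (hF : F.Nonempty) : 1 ≤ n := by
  obtain ⟨T, hT, hc⟩ := h
  obtain ⟨x, hx⟩ := hF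
  obtain ⟨y, hy, -⟩ := hc x hx
  have : 1 ≤ T.card := Finset.card_pos.2 ⟨y, hy⟩
  exact le_trans (by exact_mod_cast this) hT

lemma covers_of_subset_closedBall {x : X} (h : F ⊆ Metric.closedBall x δ) : Covers F δ 1 :=
  ⟨{x}, by simp, fun y hy => ⟨x, by simp, h hy⟩⟩

lemma covers_iff {δ : ℝ≥0} (hn : 0 ≤ n) :
    Covers F δ n ↔ ((Metric.externalCoveringNumber δ F : ℕ∞) : ℝ≥0∞) ≤ ENNReal.ofReal n := by
  constructor
  · rintro ⟨T, hT, hc⟩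
    have h1 : Metric.externalCoveringNumber δ F ≤ (T : Set X).encard := by
      refine Metric.IsCover.externalCoveringNumber_le_encard fun x hx => ?_
      obtain ⟨y, hy, hxy⟩ := hc x hx
      refine ⟨y, hy, ?_⟩
      change edist x y ≤ δ
      rw [edist_dist, ENNReal.ofReal_le_iff_le_toReal (by simp)]
      simpa using hxy
    rw [Set.encard_coe_eq_coe_finsetCard] at h1
    calc ((Metric.externalCoveringNumber δ F : ℕ∞) : ℝ≥0∞) ≤ (((T.card : ℕ) : ℕ∞) : ℝ≥0∞) := by
          exact_mod_cast h1
      _ = ENNReal.ofReal (T.card : ℝ) := by simp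
      _ ≤ ENNReal.ofReal n := ENNReal.ofReal_le_ofReal hT
  · intro h
    have hfin : Metric.externalCoveringNumber δ F ≠ ⊤ := by
      intro htop
      rw [htop] at h
      simp at h
    have hlt : Metric.externalCoveringNumber δ F < Metric.externalCoveringNumber δ F + 1 :=
      (ENat.lt_add_one_iff hfin).2 le_rfl
    obtain ⟨C, hC⟩ := iInf_lt_iff.1 hlt
    obtain ⟨hC1, hC2⟩ := iInf_lt_iff.1 hC
    have hle := (ENat.lt_add_one_iff hfin).1 hC2
    have hCfin : C.Finite := Set.encard_ne_top_iff.1 (ne_top_of_le_ne_top hfin hle)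
    refine ⟨hCfin.toFinset, ?_, fun x hx => ?_⟩
    · rw [hCfin.encard_eq_coe_toFinset_card] at hle
      have h3 : (((hCfin.toFinset.card : ℕ) : ℕ∞) : ℝ≥0∞) ≤ ENNReal.ofReal n :=
        le_trans (by exact_mod_cast hle) h
      have h4 : ENNReal.ofReal (hCfin.toFinset.card : ℝ) ≤ ENNReal.ofReal n := by
        simpa using h3
      exact (ENNReal.ofReal_le_ofReal_iff hn).1 h4
    · obtain ⟨y, hy, hxy⟩ := hC1 hx
      refine ⟨y, by simpa using hy, ?_⟩
      change edist x y ≤ δ at hxy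
      rw [edist_dist, ENNReal.ofReal_le_iff_le_toReal (by simp)] at hxy
      simpa using hxy

lemma boxRatio_le_iff {δ : ℝ≥0} (h0 : 0 < δ) (h1 : δ < 1) (t : ℝ) :
    boxRatio F δ ≤ (t : EReal) ↔ Covers F δ ((δ : ℝ) ^ (-t)) := by
  have h0' : (0 : ℝ) < δ := by exact_mod_cast h0
  have hlog : Real.log δ < 0 := Real.log_neg h0' (by exact_mod_cast h1)
  have hpos : 0 < (δ : ℝ) ^ (-t) := Real.rpow_pos_of_pos h0' _
  rw [covers_iff hpos.le, boxRatio, EReal.div_le_iff_le_mul (by exact_mod_cast neg_pos.2 hlog)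
    (EReal.coe_ne_top _), ← EReal.coe_mul, ← ENNReal.log_le_log_iff,
    ENNReal.log_ofReal_of_pos hpos, Real.log_rpow h0']
  ring_nf

lemma eventually_pos_lt {ε : ℝ} (hε : 0 < ε) :
    ∀ᶠ δ : ℝ≥0 in 𝓝[>] (0 : ℝ≥0), 0 < δ ∧ (δ : ℝ) < ε := by
  have h1 : ∀ᶠ δ : ℝ≥0 in 𝓝[>] (0 : ℝ≥0), δ < ε.toNNReal :=
    mem_nhdsWithin_of_mem_nhds (Iio_mem_nhds (by simpa using hε))
  filter_upwards [h1, self_mem_nhdsWithin] with δ h2 h3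
  exact ⟨h3, by simpa using Real.lt_toNNReal_iff_coe_lt.1 h2⟩

lemma le_lowerBoxDim {d : ℝ}
    (h : ∀ t < d, ∃ ε > 0, ∀ δ : ℝ, 0 < δ → δ < ε → ¬ Covers F δ (δ ^ (-t))) :
    (d : EReal) ≤ lowerBoxDim F := by
  refine le_of_forall_lt_imp_le_of_dense fun c hc => ?_
  obtain ⟨t, ht1, ht2⟩ := EReal.lt_iff_exists_real_btwn.1 hc
  obtain ⟨ε, hε, h⟩ := h t (by exact_mod_cast ht2)
  refine le_liminf_of_le (by isBoundedDefault) ?_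
  filter_upwards [eventually_pos_lt hε, eventually_pos_lt one_pos] with δ h1 h2
  have := h δ (by exact_mod_cast h1.1) h1.2
  rw [← boxRatio_le_iff h1.1 (by exact_mod_cast h2.2)] at this
  exact ht1.le.trans (not_le.1 this).le

lemma upperBoxDim_le {d : ℝ}
    (h : ∀ t > d, ∃ ε > 0, ∀ δ : ℝ, 0 < δ → δ < ε → Covers F δ (δ ^ (-t))) :
    upperBoxDim F ≤ (d : EReal) := by
  refine le_of_forall_gt_imp_ge_of_dense fun c hc => ?_
  obtain ⟨t, ht1, ht2⟩ := EReal.lt_iff_exists_real_btwn.1 hc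
  obtain ⟨ε, hε, h⟩ := h t (by exact_mod_cast ht1)
  refine limsup_le_of_le (by isBoundedDefault) ?_
  filter_upwards [eventually_pos_lt hε, eventually_pos_lt one_pos] with δ h1 h2
  have := h δ (by exact_mod_cast h1.1) h1.2
  rw [← boxRatio_le_iff h1.1 (by exact_mod_cast h2.2)] at this
  exact this.trans ht2.le

lemma lowerBoxDim_le_upperBoxDim : lowerBoxDim F ≤ upperBoxDim F :=
  liminf_le_limsup

/-- A polynomial comparison of covering numbers with exponent `1 / a` gives the corresponding
comparison of both box counting dimensions with factor `a`. -/
lemma mul_boxDim_le {a : ℝ} (ha : 0 < a)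
    (h : ∀ t t' : ℝ, t < a * t' → ∃ ε > 0, ∀ δ : ℝ, 0 < δ → δ < ε →
      Covers G δ (δ ^ (-t)) → Covers F δ (δ ^ (-t'))) :
    (a : EReal) * upperBoxDim F ≤ upperBoxDim G ∧ (a : EReal) * lowerBoxDim F ≤ lowerBoxDim G := by
  have key : ∀ D E : EReal, (∀ t t' : ℝ, t < a * t' → E < t → D ≤ t') → (a : EReal) * D ≤ E := by
    intro D E hDE
    refine le_of_forall_gt_imp_ge_of_dense fun c hc => ?_
    obtain ⟨t, ht1, ht2⟩ := EReal.lt_iff_exists_real_btwn.1 hc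
    refine le_trans ?_ ht2.le
    have hD : D ≤ ((t / a : ℝ) : EReal) := by
      refine le_of_forall_gt_imp_ge_of_dense fun c hc => ?_
      obtain ⟨t', ht1', ht2'⟩ := EReal.lt_iff_exists_real_btwn.1 hc
      refine le_trans (hDE t t' ?_ ht1) ht2'.le
      have : t / a < t' := by exact_mod_cast ht1'
      rw [div_lt_iff₀ ha] at this
      linarith
    calc (a : EReal) * D ≤ (a : EReal) * ((t / a : ℝ) : EReal) :=
          mul_le_mul_of_nonneg_left hD (by exact_mod_cast ha.le)
      _ = t := by rw [← EReal.coe_mul, mul_div_cancel₀ _ ha.ne']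
  constructor
  · refine key _ _ fun t t' htt ht => ?_
    obtain ⟨ε, hε, h⟩ := h t t' htt
    refine limsup_le_of_le (by isBoundedDefault) ?_
    filter_upwards [eventually_pos_lt hε, eventually_pos_lt one_pos,
      eventually_lt_of_limsup_lt ht] with δ h1 h2 h3
    have h2' : δ < 1 := by exact_mod_cast h2.2
    rw [boxRatio_le_iff h1.1 h2']
    exact h δ (by exact_mod_cast h1.1) h1.2 ((boxRatio_le_iff h1.1 h2' _).1 h3.le)
  · refine key _ _ fun t t' htt ht => ?_
    obtain ⟨ε, hε, h⟩ := h t t' htt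
    refine liminf_le_of_frequently_le' ?_
    have hf := frequently_lt_of_liminf_lt (by isBoundedDefault) ht
    refine (hf.and_eventually ((eventually_pos_lt hε).and (eventually_pos_lt one_pos))).mono ?_
    rintro δ ⟨h3, h1, h2⟩
    have h2' : δ < 1 := by exact_mod_cast h2.2
    rw [boxRatio_le_iff h1.1 h2']
    exact h δ (by exact_mod_cast h1.1) h1.2 ((boxRatio_le_iff h1.1 h2' _).1 h3.le)

end Covers

/-! ### Packing dimension in terms of covering numbers -/

/-- Balls of a packing with radius at least `ρ` have centres in different members of any cover by
balls of radius `ρ`, as otherwise the midpoint of two centres would lie in both balls. -/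
lemma IsBallPacking.card_le {E : Type*} [SeminormedAddCommGroup E] [NormedSpace ℝ E] {F : Set E}
    {δ ρ n : ℝ} {t : Finset (E × ℝ)} (ht : IsBallPacking F δ t) (hF : Covers F ρ n)
    (hρ : ∀ p ∈ t, ρ ≤ p.2) : (t.card : ℝ) ≤ n := by
  obtain ⟨T, hT, hc⟩ := hF
  have hex : ∀ p : E × ℝ, ∃ y, p ∈ t → y ∈ T ∧ dist p.1 y ≤ ρ := by
    intro p
    by_cases hp : p ∈ t
    · obtain ⟨y, hy⟩ := hc p.1 (ht.1 p hp).1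
      exact ⟨y, fun _ => hy⟩
    · exact ⟨0, fun h => absurd h hp⟩
  choose f hf using hex
  refine le_trans ?_ hT
  have : t.card ≤ T.card := by
    refine Finset.card_le_card_of_injOn f (fun p hp => (hf p hp).1) ?_
    intro p hp q hq hpq
    by_contra hne
    have hd := ht.2 hp hq hne
    have hp2 := (hf p hp).2
    have hq2 := (hf q hq).2
    rw [hpq] at hp2
    have hdist : dist p.1 q.1 ≤ 2 * ρ := by
      have := dist_triangle_right p.1 q.1 (f q)
      linarith
    have h1 : midpoint ℝ p.1 q.1 ∈ Metric.closedBall p.1 p.2 := by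
      rw [Metric.mem_closedBall, dist_midpoint_left, Real.norm_ofNat]
      have := hρ p hp
      linarith
    have h2 : midpoint ℝ p.1 q.1 ∈ Metric.closedBall q.1 q.2 := by
      rw [Metric.mem_closedBall, dist_midpoint_right, Real.norm_ofNat]
      have := hρ q hq
      linarith
    exact Set.disjoint_left.1 hd h1 h2
  exact_mod_cast this

/-- A set of packing dimension less than `t` is a countable union of sets with covering numbers
`O(δ ^ (-t))`. -/
lemma exists_covers_of_packingDim_lt {X : Type*} [PseudoMetricSpace X] {F : Set X} {t : ℝ≥0}
    (h : packingDim F < t) : ∃ G : ℕ → Set X, F ⊆ ⋃ i, G i ∧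
      ∀ i, ∃ C ε : ℝ, 0 < ε ∧ ∀ δ, 0 < δ → δ < ε → Covers (G i) δ (C * δ ^ (-(t : ℝ))) := by
  classical
  have h1 : packingMeasure t F < ∞ := by
    by_contra hcon
    have : packingMeasure t F = ∞ := not_lt_top_iff.1 hcon
    exact absurd (le_iSup₂ (f := fun (s : ℝ≥0) (_ : packingMeasure s F = ∞) => (s : ℝ≥0∞)) t this)
      (not_le.2 h)
  obtain ⟨G, hG⟩ := iInf_lt_iff.1 h1
  obtain ⟨hFG, hsum⟩ := iInf_lt_iff.1 hG
  refine ⟨G, hFG, fun i => ?_⟩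
  have h2 : packingPremeasure t (G i) < ∞ := lt_of_le_of_lt (ENNReal.le_tsum i) hsum
  obtain ⟨δ₀, h3⟩ := iInf_lt_iff.1 h2
  obtain ⟨hδ₀, h4⟩ := iInf_lt_iff.1 h3
  refine ⟨(packingPre t δ₀ (G i)).toReal, δ₀, hδ₀, fun δ hδ hδδ => ?_⟩
  have hn : 0 ≤ (packingPre t δ₀ (G i)).toReal * δ ^ (-(t : ℝ)) := by positivity
  lift δ to ℝ≥0 using hδ.le
  rw [covers_iff hn]
  set n := ⌊(packingPre t δ₀ (G i)).toReal * (δ : ℝ) ^ (-(t : ℝ))⌋₊ with hndef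
  have h5 : Metric.packingNumber δ (G i) ≤ n := by
    refine iSup_le fun C => iSup₂_le fun hCG hC => ?_
    by_contra hcon
    have hle : ((n + 1 : ℕ) : ℕ∞) ≤ C.encard := by
      push_cast
      exact Order.add_one_le_of_lt (not_le.1 hcon)
    obtain ⟨D, hDC, hD⟩ := Set.exists_subset_encard_eq hle
    have hDfin : D.Finite := Set.finite_of_encard_eq_coe hD
    set T : Finset (X × ℝ) := hDfin.toFinset.image (fun x => (x, (δ : ℝ) / 2)) with hT
    have hTcard : T.card = n + 1 := by
      rw [hT, Finset.card_image_of_injective _ (fun x y hxy => (Prod.ext_iff.1 hxy).1)]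
      rw [hDfin.encard_eq_coe_toFinset_card] at hD
      exact_mod_cast hD
    have hpack : IsBallPacking (G i) δ₀ T := by
      constructor
      · intro p hp
        obtain ⟨x, hx, rfl⟩ := Finset.mem_image.1 hp
        exact ⟨hCG (hDC (by simpa using hx)), by simpa using hδ, by simp; linarith⟩
      · intro p hp q hq hpq
        obtain ⟨x, hx, rfl⟩ := Finset.mem_image.1 hp
        obtain ⟨y, hy, rfl⟩ := Finset.mem_image.1 hq
        have hxy : x ≠ y := fun h => hpq (by rw [h])
        have hs := hC (hDC (by simpa using hx)) (hDC (by simpa using hy)) hxy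
        refine Metric.closedBall_disjoint_closedBall ?_
        have hs' : (δ : ℝ) < dist x y := by
          simp only [edist_nndist] at hs
          exact_mod_cast hs
        simpa using hs'
    have hle2 : ∑ p ∈ T, ENNReal.ofReal (2 * p.2) ^ (t : ℝ) ≤ packingPre t δ₀ (G i) :=
      le_iSup₂ (f := fun (T : Finset (X × ℝ)) (_ : IsBallPacking (G i) δ₀ T) =>
        ∑ p ∈ T, ENNReal.ofReal (2 * p.2) ^ (t : ℝ)) T hpack
    have hsumeq : ∑ p ∈ T, ENNReal.ofReal (2 * p.2) ^ (t : ℝ)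
        = ENNReal.ofReal ((n + 1 : ℕ) * (δ : ℝ) ^ (t : ℝ)) := by
      rw [Finset.sum_congr rfl (g := fun _ => ENNReal.ofReal ((δ : ℝ) ^ (t : ℝ))),
        Finset.sum_const, hTcard, ENNReal.ofReal_mul (by positivity), nsmul_eq_mul,
        ENNReal.ofReal_natCast]
      intro p hp
      obtain ⟨x, hx, rfl⟩ := Finset.mem_image.1 hp
      simp only
      rw [mul_div_cancel₀ _ two_ne_zero, ENNReal.ofReal_rpow_of_pos hδ]
    rw [hsumeq, ENNReal.ofReal_le_iff_le_toReal h4.ne] at hle2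
    have hpow : 0 < (δ : ℝ) ^ (t : ℝ) := Real.rpow_pos_of_pos hδ _
    have h6 : ((n + 1 : ℕ) : ℝ) ≤ (packingPre t δ₀ (G i)).toReal * (δ : ℝ) ^ (-(t : ℝ)) := by
      rw [Real.rpow_neg hδ.le, ← div_eq_mul_inv, le_div_iff₀ hpow]
      exact hle2
    have h7 := Nat.lt_floor_add_one ((packingPre t δ₀ (G i)).toReal * (δ : ℝ) ^ (-(t : ℝ)))
    rw [← hndef] at h7
    push_cast at h6
    linarith
  have h8 : Metric.externalCoveringNumber δ (G i) ≤ n :=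
    (Metric.externalCoveringNumber_le_coveringNumber _ _).trans
      ((Metric.coveringNumber_le_packingNumber _ _).trans h5)
  calc ((Metric.externalCoveringNumber δ (G i) : ℕ∞) : ℝ≥0∞) ≤ ((n : ℕ∞) : ℝ≥0∞) := by
        exact_mod_cast h8
    _ = ENNReal.ofReal (n : ℝ) := by simp
    _ ≤ _ := ENNReal.ofReal_le_ofReal (Nat.floor_le hn)

section

variable {E : Type*} [SeminormedAddCommGroup E] [NormedSpace ℝ E] {F : Set E} {t : ℝ≥0}

lemma exists_packingPre_ne_top {u : ℝ≥0} (htu : t < u) {C ε : ℝ} (hε : 0 < ε)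
    (hF : ∀ δ, 0 < δ → δ < ε → Covers F δ (C * δ ^ (-(t : ℝ)))) :
    packingPre u ε F ≠ ∞ := by
  classical
  have htu' : (t : ℝ) < u := by exact_mod_cast htu
  set q : ℝ := (1 / 2 : ℝ) ^ ((u : ℝ) - t) with hq
  have hq1 : q < 1 := Real.rpow_lt_one (by norm_num) (by norm_num) (by linarith)
  have hq0 : 0 < q := by positivity
  set c : ℝ := C * (4 : ℝ) ^ (u : ℝ) * (ε / 2) ^ ((u : ℝ) - t) with hc
  have hbound : packingPre u ε F ≤ ∑' k : ℕ, ENNReal.ofReal c * ENNReal.ofReal q ^ k := by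
    refine iSup₂_le fun T hT => ?_
    have hk : ∀ p : E × ℝ, ∃ k : ℕ, p ∈ T →
        ε * (1 / 2) ^ (k + 1) < p.2 ∧ p.2 ≤ ε * (1 / 2) ^ k := by
      intro p
      by_cases hp : p ∈ T
      · obtain ⟨-, h1, h2⟩ := hT.1 p hp
        obtain ⟨k, hk1, hk2⟩ := exists_nat_pow_near_of_lt_one (x := p.2 / ε) (y := (1 / 2 : ℝ))
          (by positivity) (by rw [div_le_one hε]; exact h2) (by norm_num) (by norm_num)
        rw [lt_div_iff₀ hε] at hk1
        rw [div_le_iff₀ hε] at hk2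
        exact ⟨k, fun _ => ⟨by linarith, by linarith⟩⟩
      · exact ⟨0, fun h => absurd h hp⟩
    choose κ hκ using hk
    rw [← Finset.sum_fiberwise_of_maps_to (t := T.image κ)
      (fun x hx => Finset.mem_image_of_mem κ hx)]
    refine le_trans (Finset.sum_le_sum fun k _ => ?_) (ENNReal.sum_le_tsum _)
    set U := T.filter (fun p => κ p = k) with hU
    set ρ : ℝ := ε / 2 * (1 / 2) ^ k with hρ
    have hρ0 : 0 < ρ := by positivity
    have hρε : ρ < ε := by
      have : (1 / 2 : ℝ) ^ k ≤ 1 := pow_le_one₀ (by norm_num) (by norm_num)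
      nlinarith
    have hUp : ∀ p ∈ U, ρ ≤ p.2 ∧ 2 * p.2 ≤ 4 * ρ := by
      intro p hp
      obtain ⟨hp1, hp2⟩ := Finset.mem_filter.1 hp
      have := hκ p hp1
      rw [hp2, pow_succ] at this
      constructor <;> linarith
    have hUpack : IsBallPacking F ε U :=
      ⟨fun p hp => hT.1 p (Finset.mem_of_mem_filter _ hp),
        hT.2.subset (by rw [hU]; exact Finset.coe_subset.2 (Finset.filter_subset _ _))⟩
    have hcard := hUpack.card_le (hF ρ hρ0 hρε) fun p hp => (hUp p hp).1
    calc ∑ p ∈ U, ENNReal.ofReal (2 * p.2) ^ (u : ℝ)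
        ≤ ∑ p ∈ U, ENNReal.ofReal ((4 * ρ) ^ (u : ℝ)) := by
          refine Finset.sum_le_sum fun p hp => ?_
          rw [← ENNReal.ofReal_rpow_of_pos (by positivity)]
          exact ENNReal.rpow_le_rpow (ENNReal.ofReal_le_ofReal (hUp p hp).2) u.2
      _ = ENNReal.ofReal (U.card * (4 * ρ) ^ (u : ℝ)) := by
          rw [Finset.sum_const, nsmul_eq_mul, ENNReal.ofReal_mul (by positivity),
            ENNReal.ofReal_natCast]
      _ ≤ ENNReal.ofReal (C * ρ ^ (-(t : ℝ)) * (4 * ρ) ^ (u : ℝ)) := by gcongr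
      _ = ENNReal.ofReal (c * q ^ k) := by
          congr 1
          have h1 : q ^ k = ((1 / 2 : ℝ) ^ k) ^ ((u : ℝ) - t) := by
            rw [hq, ← Real.rpow_natCast, ← Real.rpow_natCast, ← Real.rpow_mul (by norm_num),
              ← Real.rpow_mul (by norm_num), mul_comm]
          rw [hc, h1, mul_assoc (C * _), ← Real.mul_rpow (by positivity) (by positivity), ← hρ,
            Real.mul_rpow (by norm_num) hρ0.le, sub_eq_add_neg, Real.rpow_add hρ0]
          ring
      _ = _ := by rw [ENNReal.ofReal_mul' (by positivity), ENNReal.ofReal_pow hq0.le]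
  refine ne_top_of_le_ne_top ?_ hbound
  rw [ENNReal.tsum_mul_left, ENNReal.tsum_geometric]
  refine ENNReal.mul_ne_top (by simp) (ENNReal.inv_ne_top.2 ?_)
  exact (tsub_pos_of_lt (by simpa using hq1)).ne'

lemma packingPremeasure_eq_zero {s : ℝ≥0} (hts : t < s) {C ε : ℝ} (hε : 0 < ε)
    (hF : ∀ δ, 0 < δ → δ < ε → Covers F δ (C * δ ^ (-(t : ℝ)))) :
    packingPremeasure s F = 0 := by
  obtain ⟨u, htu, hus⟩ := exists_between hts
  have hus' : (u : ℝ) < s := by exact_mod_cast hus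
  set M := packingPre u ε F with hM
  have hMtop : M ≠ ∞ := exists_packingPre_ne_top htu hε hF
  have hle : ∀ᶠ δ : ℝ in 𝓝[>] 0,
      packingPremeasure s F ≤ ENNReal.ofReal (2 * δ) ^ ((s : ℝ) - u) * M := by
    filter_upwards [Ioo_mem_nhdsGT hε] with δ hδ
    refine (iInf₂_le δ hδ.1).trans ?_
    refine iSup₂_le fun T hT => ?_
    have hTε : IsBallPacking F ε T :=
      ⟨fun p hp => ⟨(hT.1 p hp).1, (hT.1 p hp).2.1, (hT.1 p hp).2.2.trans hδ.2.le⟩, hT.2⟩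
    have h1 : ∑ p ∈ T, ENNReal.ofReal (2 * p.2) ^ (u : ℝ) ≤ M :=
      le_iSup₂ (f := fun (T : Finset (E × ℝ)) (_ : IsBallPacking F ε T) =>
        ∑ p ∈ T, ENNReal.ofReal (2 * p.2) ^ (u : ℝ)) T hTε
    refine le_trans ?_ (mul_le_mul_right h1 _)
    rw [Finset.mul_sum]
    refine Finset.sum_le_sum fun p hp => ?_
    obtain ⟨-, hp1, hp2⟩ := hT.1 p hp
    have h2 : ENNReal.ofReal (2 * p.2) ≠ 0 := by simpa using hp1
    calc ENNReal.ofReal (2 * p.2) ^ (s : ℝ)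
        = ENNReal.ofReal (2 * p.2) ^ ((s : ℝ) - u) * ENNReal.ofReal (2 * p.2) ^ (u : ℝ) := by
          rw [← ENNReal.rpow_add _ _ h2 ENNReal.ofReal_ne_top, sub_add_cancel]
      _ ≤ _ := by gcongr
  have hlim : Tendsto (fun δ : ℝ => ENNReal.ofReal (2 * δ) ^ ((s : ℝ) - u) * M) (𝓝[>] 0)
      (𝓝 (ENNReal.ofReal (2 * 0) ^ ((s : ℝ) - u) * M)) := by
    refine ENNReal.Tendsto.mul_const ?_ (Or.inr hMtop)
    refine Tendsto.mono_left ?_ nhdsWithin_le_nhds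
    refine Continuous.tendsto (f := fun δ : ℝ => ENNReal.ofReal (2 * δ) ^ ((s : ℝ) - u)) ?_ 0
    exact (ENNReal.continuous_rpow_const).comp (ENNReal.continuous_ofReal.comp (by fun_prop))
  have hz : ENNReal.ofReal (2 * 0) ^ ((s : ℝ) - u) * M = 0 := by
    rw [mul_zero, ENNReal.ofReal_zero, ENNReal.zero_rpow_of_pos (by linarith), zero_mul]
  rw [hz] at hlim
  exact le_antisymm (ge_of_tendsto hlim hle) bot_le

/-- A countable union of sets with covering numbers `O(δ ^ (-t))` has packing dimension at most
`t`. -/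
lemma packingDim_le {G : ℕ → Set E} (hFG : F ⊆ ⋃ i, G i)
    (hG : ∀ i, ∃ C ε : ℝ, 0 < ε ∧ ∀ δ, 0 < δ → δ < ε → Covers (G i) δ (C * δ ^ (-(t : ℝ)))) :
    packingDim F ≤ t := by
  refine iSup₂_le fun s hs => ?_
  by_contra hcon
  have hts : t < s := by exact_mod_cast not_le.1 hcon
  have h0 : packingMeasure s F ≤ ∑' i, packingPremeasure s (G i) := iInf₂_le G hFG
  have h1 : ∀ i, packingPremeasure s (G i) = 0 := by
    intro i
    obtain ⟨C, ε, hε, h⟩ := hG i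
    exact packingPremeasure_eq_zero hts hε h
  simp [h1, hs] at h0

end

/-! ### Squares in the integer grid -/

section Discrete

variable {S B V : Finset (ℤ × ℤ)}

lemma card_mul_le_of_fibers {M : ℝ} (φ : ℤ × ℤ → ℤ) (A : Finset ℤ)
    (h : ∀ u ∈ A, M ≤ ((V.filter (fun p => φ p = u)).card : ℝ)) :
    (A.card : ℝ) * M ≤ V.card := by
  calc (A.card : ℝ) * M = ∑ u ∈ A, M := by simp
    _ ≤ ∑ u ∈ A, ((V.filter (fun p => φ p = u)).card : ℝ) := Finset.sum_le_sum h
    _ ≤ V.card := by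
      have h1 := Finset.card_eq_sum_card_fiberwise (s := V.filter (fun p => φ p ∈ A)) (f := φ)
        (t := A) (fun p hp => (Finset.mem_filter.1 hp).2)
      have h2 : ∑ u ∈ A, (V.filter (fun p => φ p = u)).card
          = (V.filter (fun p => φ p ∈ A)).card := by
        rw [h1]
        refine Finset.sum_congr rfl fun u hu => ?_
        congr 1
        ext p
        simp only [Finset.mem_filter]
        constructor
        · rintro ⟨h3, h4⟩
          exact ⟨⟨h3, h4 ▸ hu⟩, h4⟩
        · rintro ⟨⟨h3, -⟩, h4⟩
          exact ⟨h3, h4⟩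
      have h3 := Finset.card_filter_le V (fun p => φ p ∈ A)
      rw [← h2] at h3
      exact_mod_cast h3

/-- Midpoints of pairs of points of `V` lying on a common level line of `φ` that contains at most
`t` points of `V`. -/
lemma card_midpoints_le {t : ℕ} (φ : ℤ × ℤ → ℤ)
    (h : ∀ c ∈ S, ∃ p ∈ V, ∃ q ∈ V, φ p = φ c ∧ φ q = φ c ∧ p + q = c + c)
    (ht : ∀ c ∈ S, (V.filter (fun p => φ p = φ c)).card ≤ t) :
    S.card ≤ V.card * t := by
  classical
  have hex : ∀ c : ℤ × ℤ, ∃ pq : (_ : ℤ × ℤ) × (ℤ × ℤ), c ∈ S →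
      pq.1 ∈ V ∧ pq.2 ∈ V ∧ φ pq.1 = φ c ∧ φ pq.2 = φ c ∧ pq.1 + pq.2 = c + c := by
    intro c
    by_cases hc : c ∈ S
    · obtain ⟨p, hp, q, hq, h⟩ := h c hc
      exact ⟨⟨p, q⟩, fun _ => ⟨hp, hq, h⟩⟩
    · exact ⟨⟨0, 0⟩, fun h => absurd h hc⟩
  choose f hf using hex
  set W := V.filter (fun p => (V.filter (fun q => φ q = φ p)).card ≤ t) with hW
  have hle : S.card ≤ (W.sigma (fun p => V.filter (fun q => φ q = φ p))).card := by
    refine Finset.card_le_card_of_injOn f (fun c hc => ?_) ?_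
    · obtain ⟨h1, h2, h3, h4, -⟩ := hf c hc
      simp only [Finset.mem_coe, Finset.mem_sigma, hW, Finset.mem_filter]
      refine ⟨⟨h1, ?_⟩, h2, h4.trans h3.symm⟩
      rw [h3]
      exact ht c hc
    · intro c hc d hd hcd
      have h1 := (hf c hc).2.2.2.2
      have h2 := (hf d hd).2.2.2.2
      rw [hcd, h2] at h1
      have e1 := congrArg Prod.fst h1
      have e2 := congrArg Prod.snd h1
      simp only [Prod.fst_add, Prod.snd_add] at e1 e2
      ext <;> omega
  refine hle.trans ?_
  rw [Finset.card_sigma]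
  calc ∑ p ∈ W, (V.filter (fun q => φ q = φ p)).card ≤ ∑ p ∈ W, t :=
        Finset.sum_le_sum fun p hp => (Finset.mem_filter.1 hp).2
    _ = W.card * t := by simp
    _ ≤ V.card * t := Nat.mul_le_mul_right _ (Finset.card_filter_le _ _)

/-- If `V` contains the four vertices of a square centred at each point of `S`, then
`|S| ≤ 3 |V| ^ (4 / 3)`. A centre lies on a line of slope `1` and a line of slope `-1`, each of
which contains two opposite vertices. Lines of either slope with more than `|V| ^ (1 / 3)` points
of `V` are few, so they have few intersection points, and the other lines have few midpoints. -/
lemma card_centres_le_of_vertices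
    (h : ∀ c ∈ S, ∃ r : ℤ, (c.1 - r, c.2 - r) ∈ V ∧ (c.1 + r, c.2 + r) ∈ V ∧
      (c.1 - r, c.2 + r) ∈ V ∧ (c.1 + r, c.2 - r) ∈ V) :
    (S.card : ℝ) ≤ 3 * (V.card : ℝ) ^ (4 / 3 : ℝ) := by
  classical
  rcases Nat.eq_zero_or_pos V.card with hV0 | hVpos
  · have : S = ∅ := by
      rw [Finset.eq_empty_iff_forall_notMem]
      intro c hc
      obtain ⟨r, hr, -⟩ := h c hc
      rw [Finset.card_eq_zero.1 hV0] at hr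
      simp at hr
    simp [this, hV0]
  set n : ℝ := (V.card : ℝ) with hn
  have hn0 : 0 < n := by rw [hn]; exact_mod_cast hVpos
  set t : ℕ := ⌊n ^ (1 / 3 : ℝ)⌋₊ with ht
  have ht1 : (t : ℝ) ≤ n ^ (1 / 3 : ℝ) := Nat.floor_le (by positivity)
  have ht2 : n ^ (1 / 3 : ℝ) ≤ t + 1 := (Nat.lt_floor_add_one _).le
  have poor : ∀ φ : ℤ × ℤ → ℤ,
      (∀ c ∈ S, ∃ p ∈ V, ∃ q ∈ V, φ p = φ c ∧ φ q = φ c ∧ p + q = c + c) →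
      ((S.filter (fun c => (V.filter (fun p => φ p = φ c)).card ≤ t)).card : ℝ)
        ≤ n ^ (4 / 3 : ℝ) := by
    intro φ hφ
    have h1 := card_midpoints_le (V := V) (t := t) φ
      (S := S.filter (fun c => (V.filter (fun p => φ p = φ c)).card ≤ t))
      (fun c hc => hφ c (Finset.mem_filter.1 hc).1) (fun c hc => (Finset.mem_filter.1 hc).2)
    calc _ ≤ n * (t : ℝ) := by rw [hn]; exact_mod_cast h1
      _ ≤ n * n ^ (1 / 3 : ℝ) := by gcongr
      _ = n ^ (4 / 3 : ℝ) := by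
        rw [← Real.rpow_one_add' hn0.le (by norm_num)]; norm_num
  have rich : ∀ φ : ℤ × ℤ → ℤ,
      (((V.image φ).filter (fun u => t < (V.filter (fun p => φ p = u)).card)).card : ℝ)
        ≤ n ^ (2 / 3 : ℝ) := by
    intro φ
    have h1 := card_mul_le_of_fibers (V := V) (M := n ^ (1 / 3 : ℝ)) φ
      ((V.image φ).filter (fun u => t < (V.filter (fun p => φ p = u)).card)) (by
        intro u hu
        refine ht2.trans ?_
        exact_mod_cast (Finset.mem_filter.1 hu).2)
    rw [← hn, ← le_div_iff₀ (by positivity)] at h1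
    refine h1.trans (le_of_eq ?_)
    nth_rewrite 1 [← Real.rpow_one n]
    rw [← Real.rpow_sub hn0]
    norm_num
  set φ₁ : ℤ × ℤ → ℤ := fun p => p.1 - p.2 with hφ₁
  set φ₂ : ℤ × ℤ → ℤ := fun p => p.1 + p.2 with hφ₂
  have hd₁ : ∀ c ∈ S, ∃ p ∈ V, ∃ q ∈ V, φ₁ p = φ₁ c ∧ φ₁ q = φ₁ c ∧ p + q = c + c := by
    intro c hc
    obtain ⟨r, h1, h2, -, -⟩ := h c hc
    refine ⟨_, h1, _, h2, by simp [hφ₁], by simp [hφ₁], ?_⟩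
    ext <;> simp
  have hd₂ : ∀ c ∈ S, ∃ p ∈ V, ∃ q ∈ V, φ₂ p = φ₂ c ∧ φ₂ q = φ₂ c ∧ p + q = c + c := by
    intro c hc
    obtain ⟨r, -, -, h1, h2⟩ := h c hc
    refine ⟨_, h1, _, h2, by simp [hφ₂], by simp [hφ₂], ?_⟩
    ext <;> simp
  set S₁ := S.filter (fun c => (V.filter (fun p => φ₁ p = φ₁ c)).card ≤ t) with hS₁
  set S₂ := S.filter (fun c => (V.filter (fun p => φ₂ p = φ₂ c)).card ≤ t) with hS₂
  set A₁ := (V.image φ₁).filter (fun u => t < (V.filter (fun p => φ₁ p = u)).card) with hA₁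
  set A₂ := (V.image φ₂).filter (fun u => t < (V.filter (fun p => φ₂ p = u)).card) with hA₂
  have h3 : (S \ (S₁ ∪ S₂)).card ≤ (A₁ ×ˢ A₂).card := by
    refine Finset.card_le_card_of_injOn (fun c => (φ₁ c, φ₂ c)) (fun c hc => ?_) ?_
    · obtain ⟨hcS, hc'⟩ := Finset.mem_sdiff.1 hc
      rw [Finset.mem_union, not_or] at hc'
      simp only [hS₁, hS₂, Finset.mem_filter, not_and, not_le] at hc'
      obtain ⟨p, hp, -, -, hpc, -⟩ := hd₁ c hcS
      obtain ⟨q, hq, -, -, hqc, -⟩ := hd₂ c hcS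
      exact Finset.mem_coe.2 (Finset.mem_product.2
        ⟨Finset.mem_filter.2 ⟨Finset.mem_image.2 ⟨p, hp, hpc⟩, hc'.1 hcS⟩,
          Finset.mem_filter.2 ⟨Finset.mem_image.2 ⟨q, hq, hqc⟩, hc'.2 hcS⟩⟩)
    · intro c _ d _ hcd
      have e1 := congrArg Prod.fst hcd
      have e2 := congrArg Prod.snd hcd
      simp only [hφ₁, hφ₂] at e1 e2
      ext <;> omega
  have h4 : S.card ≤ (S \ (S₁ ∪ S₂)).card + (S₁.card + S₂.card) := by
    have hsub : S ⊆ (S \ (S₁ ∪ S₂)) ∪ (S₁ ∪ S₂) := by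
      rw [Finset.sdiff_union_self_eq_union]
      exact Finset.subset_union_left
    refine (Finset.card_le_card hsub).trans ((Finset.card_union_le _ _).trans ?_)
    gcongr
    exact Finset.card_union_le _ _
  have h5 : ((S \ (S₁ ∪ S₂)).card : ℝ) ≤ n ^ (4 / 3 : ℝ) := by
    calc ((S \ (S₁ ∪ S₂)).card : ℝ) ≤ (A₁.card : ℝ) * A₂.card := by
          rw [Finset.card_product] at h3
          exact_mod_cast h3
      _ ≤ n ^ (2 / 3 : ℝ) * n ^ (2 / 3 : ℝ) := by
          gcongr
          · exact rich φ₁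
          · exact rich φ₂
      _ = n ^ (4 / 3 : ℝ) := by
          rw [← Real.rpow_add hn0]; norm_num
  have h6 := poor φ₁ hd₁
  have h7 := poor φ₂ hd₂
  have h8 : (S.card : ℝ) ≤ (S \ (S₁ ∪ S₂)).card + (S₁.card + S₂.card) := by exact_mod_cast h4
  rw [← hS₁] at h6
  rw [← hS₂] at h7
  linarith

/-- If the four lines carrying the sides of a square centred at each point of `S` contain at least
`M` points of `B` each, then `|S| ≤ 3 (|B| / M) ^ (8 / 3)`: at most `|B| / M` lines in either
direction occur, and their intersections contain the vertices of the squares. -/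
lemma card_centres_le_of_lines {M : ℝ} (hM : 0 < M)
    (h : ∀ c ∈ S, ∃ r : ℤ, ∀ i ∈ ({-r, r} : Finset ℤ),
      M ≤ ((B.filter (fun p => p.1 = c.1 + i)).card : ℝ) ∧
      M ≤ ((B.filter (fun p => p.2 = c.2 + i)).card : ℝ)) :
    (S.card : ℝ) ≤ 3 * ((B.card : ℝ) / M) ^ (8 / 3 : ℝ) := by
  classical
  set X := (B.image Prod.fst).filter
    (fun x => M ≤ ((B.filter (fun p => p.1 = x)).card : ℝ)) with hX
  set Y := (B.image Prod.snd).filter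
    (fun y => M ≤ ((B.filter (fun p => p.2 = y)).card : ℝ)) with hY
  have hXc : (X.card : ℝ) ≤ B.card / M := by
    rw [le_div_iff₀ hM]
    exact card_mul_le_of_fibers Prod.fst X fun u hu => (Finset.mem_filter.1 hu).2
  have hYc : (Y.card : ℝ) ≤ B.card / M := by
    rw [le_div_iff₀ hM]
    exact card_mul_le_of_fibers Prod.snd Y fun u hu => (Finset.mem_filter.1 hu).2
  have hmem : ∀ (f : ℤ × ℤ → ℤ) (x : ℤ), M ≤ ((B.filter (fun p => f p = x)).card : ℝ) →
      x ∈ (B.image f).filter (fun x => M ≤ ((B.filter (fun p => f p = x)).card : ℝ)) := by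
    intro f x hx
    have : 0 < (B.filter (fun p => f p = x)).card := by exact_mod_cast hM.trans_le hx
    obtain ⟨p, hp⟩ := Finset.card_pos.1 this
    obtain ⟨hp1, hp2⟩ := Finset.mem_filter.1 hp
    exact Finset.mem_filter.2 ⟨Finset.mem_image.2 ⟨p, hp1, hp2⟩, hx⟩
  have h1 := card_centres_le_of_vertices (S := S) (V := X ×ˢ Y) (by
    intro c hc
    obtain ⟨r, hr⟩ := h c hc
    obtain ⟨h1, h2⟩ := hr (-r) (by simp)
    obtain ⟨h3, h4⟩ := hr r (by simp)
    rw [← sub_eq_add_neg] at h1 h2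
    have a1 := hmem Prod.fst _ h1
    have a2 := hmem Prod.snd _ h2
    have a3 := hmem Prod.fst _ h3
    have a4 := hmem Prod.snd _ h4
    exact ⟨r, Finset.mk_mem_product a1 a2, Finset.mk_mem_product a3 a4,
      Finset.mk_mem_product a1 a4, Finset.mk_mem_product a3 a2⟩)
  refine h1.trans ?_
  have h2 : ((X ×ˢ Y).card : ℝ) ≤ ((B.card : ℝ) / M) ^ (2 : ℝ) := by
    rw [Finset.card_product, Real.rpow_two, sq]
    push_cast
    gcongr
  calc 3 * ((X ×ˢ Y).card : ℝ) ^ (4 / 3 : ℝ)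
      ≤ 3 * (((B.card : ℝ) / M) ^ (2 : ℝ)) ^ (4 / 3 : ℝ) := by gcongr
    _ = 3 * ((B.card : ℝ) / M) ^ (8 / 3 : ℝ) := by
      rw [← Real.rpow_mul (by positivity)]; norm_num

/-- Squares whose radii are comparable to `L`: the estimate for lines is applied in each cell of
side `L`, where the sides of a square contain full segments of length `L`. -/
lemma card_centres_le_of_radius_mem_Ico {L : ℕ} (hL : 0 < L)
    (h : ∀ c ∈ S, ∃ r : ℤ, (L : ℤ) ≤ r ∧ r < 2 * L ∧
      ∀ p : ℤ × ℤ, max |p.1 - c.1| |p.2 - c.2| = r → p ∈ B) :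
    (S.card : ℝ) ≤ 75 * (B.card : ℝ) ^ (8 / 7 : ℝ) := by
  classical
  have hLZ : (0 : ℤ) < L := by exact_mod_cast hL
  have hLR : (0 : ℝ) < L := by exact_mod_cast hL
  set cell : ℤ × ℤ → ℤ × ℤ := fun p => (p.1 / L, p.2 / L) with hcell
  set near : ℤ × ℤ → ℤ × ℤ → Prop :=
    fun q p => |(cell p).1 - q.1| ≤ 2 ∧ |(cell p).2 - q.2| ≤ 2 with hnear
  have hfloor : ∀ a q : ℤ, a / L = q ↔ q * L ≤ a ∧ a < (q + 1) * L := by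
    intro a q
    constructor
    · rintro rfl
      exact ⟨Int.ediv_mul_le _ hLZ.ne', Int.lt_ediv_add_one_mul_self a hLZ⟩
    · rintro ⟨h1, h2⟩
      exact le_antisymm (Int.lt_add_one_iff.1 (Int.ediv_lt_of_lt_mul hLZ h2))
        (Int.le_ediv_of_mul_le hLZ h1)
  have hnear1 : ∀ a q x : ℤ, a / L = q → |x - a| < 2 * L → |x / L - q| ≤ 2 := by
    intro a q x ha hx
    obtain ⟨h1, h2⟩ := (hfloor a q).1 ha
    obtain ⟨h3, h4⟩ := abs_lt.1 hx
    have h5 : x / L < q + 3 := Int.ediv_lt_of_lt_mul hLZ (by linarith)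
    have h6 : q - 2 ≤ x / L := Int.le_ediv_of_mul_le hLZ (by linarith)
    rw [abs_le]
    constructor <;> omega
  have hcellcard : ∀ q : ℤ × ℤ, ((S.filter (fun c => cell c = q)).card : ℝ)
      ≤ 3 * ((B.filter (near q)).card : ℝ) ^ (8 / 7 : ℝ) := by
    intro q
    set N := (S.filter (fun c => cell c = q)).card with hN
    set b : ℝ := ((B.filter (near q)).card : ℝ) with hb
    have hb0 : 0 ≤ b := by positivity
    have h1 : (N : ℝ) ≤ 3 * (b / L) ^ (8 / 3 : ℝ) := by
      refine card_centres_le_of_lines hLR fun c hc => ?_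
      obtain ⟨hcS, hcq⟩ := Finset.mem_filter.1 hc
      obtain ⟨r, hr1, hr2, hr⟩ := h c hcS
      have hq1 : c.1 / L = q.1 := congrArg Prod.fst hcq
      have hq2 : c.2 / L = q.2 := congrArg Prod.snd hcq
      obtain ⟨a1, a2⟩ := (hfloor _ _).1 hq1
      obtain ⟨b1, b2⟩ := (hfloor _ _).1 hq2
      refine ⟨r, fun i hi => ?_⟩
      have hi' : |i| = r := by
        rcases Finset.mem_insert.1 hi with rfl | hi
        · rw [abs_neg, abs_of_pos (by omega)]
        · rw [Finset.mem_singleton.1 hi, abs_of_pos (by omega)]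
      constructor
      · have : L ≤ ((B.filter (near q)).filter (fun p => p.1 = c.1 + i)).card := by
          calc L = (Finset.range L).card := by simp
            _ ≤ _ := by
              refine Finset.card_le_card_of_injOn (fun j => (c.1 + i, q.2 * L + (j : ℤ)))
                (fun j hj => ?_) ?_
              · have hj' : (j : ℤ) < L := by exact_mod_cast Finset.mem_range.1 hj
                have hy : |q.2 * L + (j : ℤ) - c.2| < L := by
                  rw [abs_lt]
                  constructor <;> linarith
                simp only [Finset.mem_coe, Finset.mem_filter]
                refine ⟨⟨hr _ ?_, hnear1 _ _ _ hq1 ?_, hnear1 _ _ _ hq2 ?_⟩, trivial⟩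
                · simp only [add_sub_cancel_left, hi']
                  exact max_eq_left (by omega)
                · simp only [add_sub_cancel_left, hi']
                  exact hr2
                · linarith
              · intro j _ k _ hjk
                have := congrArg Prod.snd hjk
                simp only at this
                omega
        exact_mod_cast this
      · have : L ≤ ((B.filter (near q)).filter (fun p => p.2 = c.2 + i)).card := by
          calc L = (Finset.range L).card := by simp
            _ ≤ _ := by
              refine Finset.card_le_card_of_injOn (fun j => (q.1 * L + (j : ℤ), c.2 + i))
                (fun j hj => ?_) ?_
              · have hj' : (j : ℤ) < L := by exact_mod_cast Finset.mem_range.1 hj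
                have hy : |q.1 * L + (j : ℤ) - c.1| < L := by
                  rw [abs_lt]
                  constructor <;> linarith
                simp only [Finset.mem_coe, Finset.mem_filter]
                refine ⟨⟨hr _ ?_, hnear1 _ _ _ hq1 ?_, hnear1 _ _ _ hq2 ?_⟩, trivial⟩
                · simp only [add_sub_cancel_left, hi']
                  exact max_eq_right (by omega)
                · linarith
                · simp only [add_sub_cancel_left, hi']
                  exact hr2
              · intro j _ k _ hjk
                have := congrArg Prod.fst hjk
                simp only at this
                omega
        exact_mod_cast this
    have h2 : (N : ℝ) ≤ (L : ℝ) ^ (2 : ℝ) := by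
      have : N ≤ (Finset.Ico (q.1 * L) ((q.1 + 1) * L) ×ˢ
          Finset.Ico (q.2 * L) ((q.2 + 1) * L)).card := by
        refine Finset.card_le_card fun c hc => ?_
        have hcq := (Finset.mem_filter.1 hc).2
        have h1 := (hfloor _ _).1 (congrArg Prod.fst hcq)
        have h2 := (hfloor _ _).1 (congrArg Prod.snd hcq)
        exact Finset.mem_product.2 ⟨Finset.mem_Ico.2 h1, Finset.mem_Ico.2 h2⟩
      rw [Finset.card_product, Int.card_Ico, Int.card_Ico] at this
      have e : ∀ z : ℤ, ((z + 1) * (L : ℤ) - z * L).toNat = L := by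
        intro z
        rw [add_mul, one_mul, add_sub_cancel_left, Int.toNat_natCast]
      rw [e, e] at this
      rw [Real.rpow_two, sq]
      exact_mod_cast this
    -- interpolate between the two bounds with weights `3 / 7` and `4 / 7`, which cancels `L`
    calc (N : ℝ) = (N : ℝ) ^ (3 / 7 : ℝ) * (N : ℝ) ^ (4 / 7 : ℝ) := by
          rw [← Real.rpow_add' (Nat.cast_nonneg _) (by norm_num)]; norm_num
      _ ≤ (3 * (b / L) ^ (8 / 3 : ℝ)) ^ (3 / 7 : ℝ) * ((L : ℝ) ^ (2 : ℝ)) ^ (4 / 7 : ℝ) := by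
          gcongr
      _ = (3 : ℝ) ^ (3 / 7 : ℝ) * b ^ (8 / 7 : ℝ) := by
          rw [Real.mul_rpow (by norm_num) (by positivity), ← Real.rpow_mul (by positivity),
            ← Real.rpow_mul hLR.le, Real.div_rpow hb0 hLR.le]
          norm_num
          rw [mul_assoc, div_mul_cancel₀ _ (by positivity)]
      _ ≤ 3 * b ^ (8 / 7 : ℝ) := by
          gcongr
          calc (3 : ℝ) ^ (3 / 7 : ℝ) ≤ (3 : ℝ) ^ (1 : ℝ) :=
                Real.rpow_le_rpow_of_exponent_le (by norm_num) (by norm_num)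
            _ = 3 := Real.rpow_one _
  set Q := S.image cell with hQ
  have hsum : ∑ q ∈ Q, (B.filter (near q)).card ≤ 25 * B.card := by
    have h1 := Finset.sum_card_bipartiteAbove_eq_sum_card_bipartiteBelow (s := Q) (t := B) near
    simp only [Finset.bipartiteAbove, Finset.bipartiteBelow] at h1
    rw [h1]
    calc ∑ p ∈ B, (Q.filter (fun q => near q p)).card ≤ ∑ p ∈ B, 25 := by
          refine Finset.sum_le_sum fun p _ => ?_
          calc (Q.filter (fun q => near q p)).card
              ≤ (Finset.Icc ((cell p).1 - 2) ((cell p).1 + 2) ×ˢ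
                  Finset.Icc ((cell p).2 - 2) ((cell p).2 + 2)).card := by
                refine Finset.card_le_card fun q hq => ?_
                obtain ⟨h1, h2⟩ := (Finset.mem_filter.1 hq).2
                rw [abs_le] at h1 h2
                refine Finset.mem_product.2 ⟨Finset.mem_Icc.2 ?_, Finset.mem_Icc.2 ?_⟩
                · constructor <;> linarith
                · constructor <;> linarith
            _ = 25 := by
                rw [Finset.card_product, Int.card_Icc, Int.card_Icc]
                have e : ∀ z : ℤ, (z + 2 + 1 - (z - 2)).toNat = 5 := by
                  intro z
                  have : z + 2 + 1 - (z - 2) = 5 := by ring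
                  rw [this]; rfl
                rw [e, e]
      _ = 25 * B.card := by simp [mul_comm]
  set n : ℝ := (B.card : ℝ) with hn
  have hn0 : 0 ≤ n := by positivity
  calc (S.card : ℝ) = ∑ q ∈ Q, ((S.filter (fun c => cell c = q)).card : ℝ) := by
        rw [Finset.card_eq_sum_card_fiberwise (f := cell) (t := Q)
          (fun c hc => Finset.mem_image_of_mem _ hc)]
        push_cast
        rfl
    _ ≤ ∑ q ∈ Q, 3 * (n ^ (1 / 7 : ℝ) * ((B.filter (near q)).card : ℝ)) := by
        refine Finset.sum_le_sum fun q _ => (hcellcard q).trans ?_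
        have hle : ((B.filter (near q)).card : ℝ) ≤ n := by
          rw [hn]
          exact_mod_cast Finset.card_filter_le _ _
        rw [show (8 / 7 : ℝ) = 1 / 7 + 1 by norm_num,
          Real.rpow_add_one' (by positivity) (by norm_num)]
        gcongr
    _ = 3 * (n ^ (1 / 7 : ℝ) * ∑ q ∈ Q, ((B.filter (near q)).card : ℝ)) := by
        rw [← Finset.mul_sum, ← Finset.mul_sum]
    _ ≤ 3 * (n ^ (1 / 7 : ℝ) * (25 * n)) := by
        gcongr
        rw [hn]
        exact_mod_cast hsum
    _ = 75 * n ^ (8 / 7 : ℝ) := by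
        rw [show (8 / 7 : ℝ) = 1 / 7 + 1 by norm_num, Real.rpow_add_one' hn0 (by norm_num)]
        ring

/-- Dyadic decomposition by radius. -/
lemma card_centres_le_of_squares {K : ℕ}
    (h : ∀ c ∈ S, ∃ r : ℕ, r < 2 ^ K ∧
      ∀ p : ℤ × ℤ, max |p.1 - c.1| |p.2 - c.2| = r → p ∈ B) :
    (S.card : ℝ) ≤ 75 * (K + 1) * (B.card : ℝ) ^ (8 / 7 : ℝ) := by
  classical
  have hex : ∀ c : ℤ × ℤ, ∃ r : ℕ, c ∈ S → r < 2 ^ K ∧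
      ∀ p : ℤ × ℤ, max |p.1 - c.1| |p.2 - c.2| = r → p ∈ B := by
    intro c
    by_cases hc : c ∈ S
    · obtain ⟨r, hr⟩ := h c hc
      exact ⟨r, fun _ => hr⟩
    · exact ⟨0, fun h => absurd h hc⟩
  choose r hr using hex
  have hlevel : ∀ k ∈ Finset.range (K + 1), ((S.filter (fun c => (r c).size = k)).card : ℝ)
      ≤ 75 * (B.card : ℝ) ^ (8 / 7 : ℝ) := by
    intro k _
    rcases k with _ | k
    · have h1 : (S.filter (fun c => (r c).size = 0)).card ≤ B.card := by
        refine Finset.card_le_card fun c hc => ?_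
        obtain ⟨hcS, hc0⟩ := Finset.mem_filter.1 hc
        refine (hr c hcS).2 c ?_
        rw [Nat.size_eq_zero.1 hc0]
        simp
      rcases Nat.eq_zero_or_pos B.card with h0 | hpos
      · rw [h0] at h1
        rw [Nat.le_zero.1 h1]
        simp only [Nat.cast_zero]
        positivity
      · have h2 : (1 : ℝ) ≤ B.card := by exact_mod_cast hpos
        calc ((S.filter (fun c => (r c).size = 0)).card : ℝ) ≤ B.card := by exact_mod_cast h1
          _ = (B.card : ℝ) ^ (1 : ℝ) := (Real.rpow_one _).symm
          _ ≤ (B.card : ℝ) ^ (8 / 7 : ℝ) :=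
            Real.rpow_le_rpow_of_exponent_le h2 (by norm_num)
          _ ≤ 75 * (B.card : ℝ) ^ (8 / 7 : ℝ) :=
            le_mul_of_one_le_left (by positivity) (by norm_num)
    · refine card_centres_le_of_radius_mem_Ico (L := 2 ^ k) (by positivity) fun c hc => ?_
      obtain ⟨hcS, hck⟩ := Finset.mem_filter.1 hc
      have h1 : 2 ^ k ≤ r c := Nat.lt_size.1 (by omega)
      have h2 : r c < 2 ^ (k + 1) := Nat.size_le.1 hck.le
      rw [pow_succ] at h2
      refine ⟨r c, by exact_mod_cast h1, ?_, (hr c hcS).2⟩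
      have : r c < 2 * 2 ^ k := by omega
      exact_mod_cast this
  calc (S.card : ℝ) = ∑ k ∈ Finset.range (K + 1),
        ((S.filter (fun c => (r c).size = k)).card : ℝ) := by
        rw [Finset.card_eq_sum_card_fiberwise (f := fun c => (r c).size)
          (t := Finset.range (K + 1)) (fun c hc => by
            have := Nat.size_le.2 (hr c hc).1
            simp only [Finset.coe_range, Set.mem_Iio]
            omega)]
        push_cast
        rfl
    _ ≤ ∑ k ∈ Finset.range (K + 1), 75 * (B.card : ℝ) ^ (8 / 7 : ℝ) := Finset.sum_le_sum hlevel
    _ = 75 * (K + 1) * (B.card : ℝ) ^ (8 / 7 : ℝ) := by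
        rw [Finset.sum_const, Finset.card_range, nsmul_eq_mul]
        push_cast
        ring

end Discrete

/-! ### Discretisation in the plane -/

lemma abs_sub_le_dist (x y : Plane) (i : Fin 2) : |x i - y i| ≤ dist x y := by
  rw [dist_eq_norm]
  exact PiLp.norm_apply_le (x - y) i

lemma dist_le_abs_add_abs (x y : Plane) : dist x y ≤ |x 0 - y 0| + |x 1 - y 1| := by
  rw [EuclideanSpace.dist_eq, Fin.sum_univ_two, Real.dist_eq, Real.dist_eq]
  refine Real.sqrt_le_iff.2 ⟨by positivity, ?_⟩
  nlinarith [abs_nonneg (x 0 - y 0), abs_nonneg (x 1 - y 1)]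

/-- The index of the cell of the grid of mesh `δ` that contains `p`. -/
noncomputable def gridPoint (δ : ℝ) (p : Plane) : ℤ × ℤ := (⌊p 0 / δ⌋, ⌊p 1 / δ⌋)

lemma covers_of_gridPoint {S : Set Plane} {δ n : ℝ} (hδ : 0 < δ)
    (h : ∀ T : Finset (ℤ × ℤ), (T : Set (ℤ × ℤ)) ⊆ gridPoint δ '' S → (T.card : ℝ) ≤ n) :
    Covers S δ n := by
  classical
  have hfin : (gridPoint δ '' S).Finite := by
    by_contra hinf
    obtain ⟨T, hT, hcard⟩ := Set.Infinite.exists_subset_card_eq hinf (⌊n⌋₊ + 1)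
    have h1 := h T hT
    rw [hcard] at h1
    have := Nat.lt_floor_add_one n
    push_cast at h1
    linarith
  refine ⟨hfin.toFinset.image
    (fun z => (!₂[((z.1 : ℝ) + 1 / 2) * δ, ((z.2 : ℝ) + 1 / 2) * δ] : Plane)), ?_, fun p hp => ?_⟩
  · refine le_trans ?_ (h hfin.toFinset (by simp))
    exact_mod_cast Finset.card_image_le
  · refine ⟨_, Finset.mem_image_of_mem _ (by simpa using ⟨p, hp, rfl⟩ :
      gridPoint δ p ∈ hfin.toFinset), ?_⟩
    refine (dist_le_abs_add_abs _ _).trans ?_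
    have key : ∀ x : ℝ, |x - ((⌊x / δ⌋ : ℝ) + 1 / 2) * δ| ≤ δ / 2 := by
      intro x
      have h1 := Int.floor_le (x / δ)
      have h2 := Int.lt_floor_add_one (x / δ)
      rw [le_div_iff₀ hδ] at h1
      rw [div_lt_iff₀ hδ] at h2
      rw [abs_le]
      constructor <;> linarith
    have h0 := key (p 0)
    have h1 := key (p 1)
    simp only [gridPoint, Matrix.cons_val_zero, Matrix.cons_val_one]
    linarith

/-- A cover at scale `δ` bounds the number of grid cells that meet `B` or are adjacent to a cell
that meets `B`. -/
lemma exists_gridPoint_nhds_of_covers {B : Set Plane} {δ n : ℝ} (hδ : 0 < δ) (h : Covers B δ n) :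
    ∃ T : Finset (ℤ × ℤ), (T.card : ℝ) ≤ 25 * n ∧ ∀ p ∈ B, ∀ z : ℤ × ℤ,
      |z.1 - (gridPoint δ p).1| ≤ 1 → |z.2 - (gridPoint δ p).2| ≤ 1 → z ∈ T := by
  classical
  obtain ⟨U, hU, hc⟩ := h
  refine ⟨U.biUnion (fun y => Finset.Icc ((gridPoint δ y).1 - 2) ((gridPoint δ y).1 + 2) ×ˢ
    Finset.Icc ((gridPoint δ y).2 - 2) ((gridPoint δ y).2 + 2)), ?_, ?_⟩
  · have h1 := Finset.card_biUnion_le_card_mul U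
      (fun y => Finset.Icc ((gridPoint δ y).1 - 2) ((gridPoint δ y).1 + 2) ×ˢ
        Finset.Icc ((gridPoint δ y).2 - 2) ((gridPoint δ y).2 + 2)) 25 (by
        intro y _
        rw [Finset.card_product, Int.card_Icc, Int.card_Icc]
        have e : ∀ z : ℤ, (z + 2 + 1 - (z - 2)).toNat = 5 := by
          intro z
          have : z + 2 + 1 - (z - 2) = 5 := by ring
          rw [this]; rfl
        rw [e, e])
    calc _ ≤ (U.card : ℝ) * 25 := by exact_mod_cast h1
      _ ≤ 25 * n := by linarith
  · intro p hp z hz1 hz2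
    obtain ⟨y, hy, hpy⟩ := hc p hp
    have key : ∀ i : Fin 2, |⌊p i / δ⌋ - ⌊y i / δ⌋| ≤ 1 := by
      intro i
      have h1 := (abs_sub_le_dist p y i).trans hpy
      have h2 : |p i / δ - y i / δ| ≤ 1 := by
        rw [← sub_div, abs_div, abs_of_pos hδ, div_le_one hδ]
        exact h1
      rw [abs_le] at h2
      rw [abs_le]
      constructor
      · have : ⌊y i / δ⌋ ≤ ⌊p i / δ + 1⌋ := Int.floor_le_floor (by linarith)
        rw [Int.floor_add_one] at this
        omega
      · have : ⌊p i / δ⌋ ≤ ⌊y i / δ + 1⌋ := Int.floor_le_floor (by linarith)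
        rw [Int.floor_add_one] at this
        omega
    have h0 := key 0
    have h1 := key 1
    simp only [gridPoint] at hz1 hz2
    rw [abs_le] at h0 h1 hz1 hz2
    refine Finset.mem_biUnion.2 ⟨y, hy, Finset.mem_product.2
      ⟨Finset.mem_Icc.2 ?_, Finset.mem_Icc.2 ?_⟩⟩ <;> simp only [gridPoint] <;>
      constructor <;> omega

lemma abs_floor_add_floor_sub_le (x y : ℝ) : |⌊x⌋ + ⌊y⌋ - ⌊x + y⌋| ≤ 1 := by
  have h1 := Int.le_floor_add x y
  have h2 := Int.le_floor_add_floor x y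
  rw [abs_le]
  constructor <;> omega

lemma abs_floor_sub_floor_sub_le (x y : ℝ) : |⌊x⌋ - ⌊y⌋ - ⌊x - y⌋| ≤ 1 := by
  have h1 := Int.le_floor_add (x - y) y
  have h2 := Int.le_floor_add_floor (x - y) y
  rw [sub_add_cancel] at h1 h2
  rw [abs_le]
  constructor <;> omega

/-- For `e = ± r`, the grid index of `a + e` is within `1` of the index of `a` shifted by
`± ⌊r / δ⌋`; rounding the radius itself makes the rounded sides exactly symmetric. -/
lemma abs_floor_add_neg_or_pos_sub_le (a r δ : ℝ) :
    |⌊a / δ⌋ + -⌊r / δ⌋ - ⌊(a + -r) / δ⌋| ≤ 1 ∧ |⌊a / δ⌋ + ⌊r / δ⌋ - ⌊(a + r) / δ⌋| ≤ 1 := by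
  refine ⟨?_, ?_⟩
  · rw [← sub_eq_add_neg, ← sub_eq_add_neg, sub_div]
    exact abs_floor_sub_floor_sub_le _ _
  · rw [add_div]
    exact abs_floor_add_floor_sub_le _ _

lemma exists_mem_squareBoundary_gridPoint_near {c : Plane} {r δ : ℝ} (hδ : 0 < δ) (hr : 0 < r)
    {p : ℤ × ℤ}
    (hp : max |p.1 - (gridPoint δ c).1| |p.2 - (gridPoint δ c).2| = ⌊r / δ⌋) :
    ∃ P ∈ squareBoundary c r, |p.1 - (gridPoint δ P).1| ≤ 1 ∧ |p.2 - (gridPoint δ P).2| ≤ 1 := by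
  have hfl : 0 ≤ ⌊r / δ⌋ := Int.floor_nonneg.2 (by positivity)
  have side : ∀ a : ℝ, ∀ z : ℤ, |z - ⌊a / δ⌋| = ⌊r / δ⌋ →
      ∃ e : ℝ, |e| = r ∧ |z - ⌊(a + e) / δ⌋| ≤ 1 := by
    intro a z hz
    obtain ⟨h1, h2⟩ := abs_floor_add_neg_or_pos_sub_le a r δ
    rcases (abs_eq hfl).1 hz with h | h
    · refine ⟨r, abs_of_pos hr, ?_⟩
      rwa [show z = ⌊a / δ⌋ + ⌊r / δ⌋ by omega]
    · refine ⟨-r, by rw [abs_neg, abs_of_pos hr], ?_⟩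
      rwa [show z = ⌊a / δ⌋ + -⌊r / δ⌋ by omega]
  have free : ∀ a : ℝ, ∀ z : ℤ, |z - ⌊a / δ⌋| ≤ ⌊r / δ⌋ →
      ∃ e : ℝ, |e| ≤ r ∧ |z - ⌊(a + e) / δ⌋| ≤ 1 := by
    intro a z hz
    refine ⟨((z - ⌊a / δ⌋ : ℤ) : ℝ) * δ, ?_, ?_⟩
    · rw [abs_mul, abs_of_pos hδ, ← le_div_iff₀ hδ]
      have h1 : ((|z - ⌊a / δ⌋| : ℤ) : ℝ) ≤ (⌊r / δ⌋ : ℝ) := by exact_mod_cast hz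
      rw [Int.cast_abs] at h1
      exact h1.trans (Int.floor_le _)
    · rw [add_div, mul_div_cancel_right₀ _ hδ.ne', Int.floor_add_intCast]
      simp
  rcases le_total |p.1 - (gridPoint δ c).1| |p.2 - (gridPoint δ c).2| with hle | hle
  · rw [max_eq_right hle] at hp
    rw [hp] at hle
    obtain ⟨e, he, h1⟩ := free _ _ hle
    obtain ⟨f, hf, h2⟩ := side _ _ hp
    exact ⟨!₂[c 0 + e, c 1 + f], by simp [squareBoundary, he, hf], by simpa [gridPoint] using h1,
      by simpa [gridPoint] using h2⟩
  · rw [max_eq_left hle] at hp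
    rw [hp] at hle
    obtain ⟨e, he, h1⟩ := free _ _ hle
    obtain ⟨f, hf, h2⟩ := side _ _ hp
    exact ⟨!₂[c 0 + f, c 1 + e], by simp [squareBoundary, he, hf], by simpa [gridPoint] using h2,
      by simpa [gridPoint] using h1⟩

lemma radius_le_of_squareBoundary_subset {B : Set Plane} {D : ℝ} (hB : ∀ p ∈ B, |p 0| ≤ D)
    {c : Plane} {r : ℝ} (hr : 0 < r) (h : squareBoundary c r ⊆ B) : r ≤ D := by
  have h1 := hB _ (h (by simp [squareBoundary, abs_of_pos hr, hr.le] :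
    (!₂[c 0 + r, c 1] : Plane) ∈ squareBoundary c r))
  have h2 := hB _ (h (by simp [squareBoundary, abs_of_pos hr, hr.le] :
    (!₂[c 0 - r, c 1] : Plane) ∈ squareBoundary c r))
  simp only [Matrix.cons_val_zero] at h1 h2
  rw [abs_le] at h1 h2
  linarith

/-! ### Lower bounds for box counting dimensions -/

lemma ContainsSquares.covers {S B : Set Plane} (h : ContainsSquares S B) {D δ n : ℝ} (hδ : 0 < δ)
    (hδD : δ ≤ D) (hB : ∀ p ∈ B, |p 0| ≤ D) (hn : Covers B δ n) :
    Covers S δ (75 * (Real.logb 2 (D / δ) + 3) * (25 * n) ^ (8 / 7 : ℝ)) := by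
  classical
  obtain ⟨T, hT, hTB⟩ := exists_gridPoint_nhds_of_covers hδ hn
  have hD : 1 ≤ D / δ := (one_le_div hδ).2 hδD
  have hlog : 0 ≤ Real.logb 2 (D / δ) := Real.logb_nonneg (by norm_num) hD
  set K : ℕ := ⌈Real.logb 2 (D / δ)⌉₊ + 1 with hK
  have hK1 : (K : ℝ) ≤ Real.logb 2 (D / δ) + 2 := by
    have := Nat.ceil_lt_add_one hlog
    rw [hK]
    push_cast
    linarith
  have hK2 : D / δ < 2 ^ K := by
    have h1 : Real.logb 2 (D / δ) < K := by
      have := Nat.le_ceil (Real.logb 2 (D / δ))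
      rw [hK]
      push_cast
      linarith
    rw [← Real.rpow_natCast]
    exact (Real.logb_lt_iff_lt_rpow (by norm_num) (by linarith)).1 h1
  refine covers_of_gridPoint hδ fun U hU => ?_
  have h1 := card_centres_le_of_squares (S := U) (B := T) (K := K) (by
    intro z hz
    obtain ⟨c, hc, rfl⟩ := hU hz
    obtain ⟨r, hr, hrB⟩ := h c hc
    have hrδ : 0 ≤ r / δ := by positivity
    refine ⟨⌊r / δ⌋₊, ?_, fun p hp => ?_⟩
    · have h2 : r / δ ≤ D / δ := by
        gcongr
        exact radius_le_of_squareBoundary_subset hB hr hrB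
      have h3 : ((⌊r / δ⌋₊ : ℕ) : ℝ) < 2 ^ K := (Nat.floor_le hrδ).trans_lt (h2.trans_lt hK2)
      exact_mod_cast h3
    · rw [Int.natCast_floor_eq_floor hrδ] at hp
      obtain ⟨P, hP, h2, h3⟩ := exists_mem_squareBoundary_gridPoint_near hδ hr hp
      exact hTB P (hrB hP) p h2 h3)
  refine h1.trans ?_
  gcongr 75 * ?_ * ?_ ^ (8 / 7 : ℝ)
  linarith

lemma exists_log_mul_rpow_lt {a C : ℝ} (ha : 0 < a) (A : ℝ) {η : ℝ} (hη : 0 < η) :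
    ∃ ε > 0, ∀ δ : ℝ, 0 < δ → δ < ε → (A + C * Real.log δ) * δ ^ a < η := by
  have h1 : Tendsto (fun δ : ℝ => A * δ ^ a + C * (Real.log δ * δ ^ a)) (𝓝[>] 0)
      (𝓝 (A * 0 + C * 0)) := by
    refine Tendsto.add (Tendsto.const_mul _ ?_)
      (Tendsto.const_mul _ (tendsto_log_mul_rpow_nhdsGT_zero ha))
    have := (Real.continuousAt_rpow_const 0 a (Or.inr ha.le)).tendsto
    rw [Real.zero_rpow ha.ne'] at this
    exact this.mono_left nhdsWithin_le_nhds
  simp only [mul_zero, add_zero] at h1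
  have h2 := h1.eventually (gt_mem_nhds hη)
  obtain ⟨ε, hε, h3⟩ := mem_nhdsGT_iff_exists_Ioo_subset.1 h2
  refine ⟨ε, hε, fun δ h4 h5 => ?_⟩
  have : A * δ ^ a + C * (Real.log δ * δ ^ a) < η := h3 ⟨h4, h5⟩
  linarith

lemma exists_mul_rpow_neg_lt {t t' : ℝ} (htt : t < t') (C : ℝ) :
    ∃ ε > 0, ∀ δ : ℝ, 0 < δ → δ < ε → C * δ ^ (-t) < δ ^ (-t') := by
  obtain ⟨ε, hε, h⟩ := exists_log_mul_rpow_lt (C := 0) (sub_pos.2 htt) C one_pos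
  refine ⟨ε, hε, fun δ h1 h2 => ?_⟩
  have h3 := h δ h1 h2
  rw [zero_mul, add_zero] at h3
  have h4 : 0 < δ ^ (-t') := Real.rpow_pos_of_pos h1 _
  have h5 : δ ^ (-t) = δ ^ (t' - t) * δ ^ (-t') := by rw [← Real.rpow_add h1]; ring_nf
  rw [h5, ← mul_assoc]
  exact mul_lt_of_lt_one_left h4 h3

lemma ContainsSquares.mul_boxDim_le {S B : Set Plane} (h : ContainsSquares S B)
    (hB : Bornology.IsBounded B) :
    ((7 / 8 : ℝ) : EReal) * upperBoxDim S ≤ upperBoxDim B ∧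
      ((7 / 8 : ℝ) : EReal) * lowerBoxDim S ≤ lowerBoxDim B := by
  obtain ⟨D, hD, hBD⟩ : ∃ D : ℝ, 0 < D ∧ ∀ p ∈ B, |p 0| ≤ D := by
    obtain ⟨D, hD, hBD⟩ := hB.exists_pos_norm_le
    exact ⟨D, hD, fun p hp => (PiLp.norm_apply_le p 0).trans (hBD p hp)⟩
  refine _root_.mul_boxDim_le (by norm_num) fun t t' htt => ?_
  set c : ℝ := 75 * (25 : ℝ) ^ (8 / 7 : ℝ) with hc
  obtain ⟨ε, hε, h1⟩ := exists_log_mul_rpow_lt (a := t' - 8 / 7 * t) (C := -(c / Real.log 2))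
    (by linarith) (c * (Real.log D / Real.log 2 + 3)) one_pos
  refine ⟨min ε D, lt_min hε hD, fun δ hδ hδε hcov => ?_⟩
  have h2 := h.covers hδ (hδε.le.trans (min_le_right _ _)) hBD hcov
  refine h2.mono_card ?_
  have h3 := h1 δ hδ (hδε.trans_le (min_le_left _ _))
  have h4 : 0 < δ ^ (-t') := Real.rpow_pos_of_pos hδ _
  have h5 : (25 * δ ^ (-t)) ^ (8 / 7 : ℝ)
      = (25 : ℝ) ^ (8 / 7 : ℝ) * (δ ^ (t' - 8 / 7 * t) * δ ^ (-t')) := by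
    rw [Real.mul_rpow (by norm_num) (by positivity), ← Real.rpow_mul hδ.le, ← Real.rpow_add hδ]
    ring_nf
  have h6 : Real.logb 2 (D / δ) = Real.log D / Real.log 2 - Real.log δ / Real.log 2 := by
    rw [Real.logb, Real.log_div hD.ne' hδ.ne', sub_div]
  rw [h5, h6]
  calc 75 * (Real.log D / Real.log 2 - Real.log δ / Real.log 2 + 3) *
        ((25 : ℝ) ^ (8 / 7 : ℝ) * (δ ^ (t' - 8 / 7 * t) * δ ^ (-t')))
      = (c * (Real.log D / Real.log 2 + 3) + -(c / Real.log 2) * Real.log δ)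
          * δ ^ (t' - 8 / 7 * t) * δ ^ (-t') := by rw [hc]; ring
    _ ≤ 1 * δ ^ (-t') := by gcongr
    _ = δ ^ (-t') := one_mul _

lemma volume_le_card_mul {E : Set ℝ} {T : Finset ℤ} {δ : ℝ} (hδ : 0 < δ)
    (h : ∀ y ∈ E, ⌊y / δ⌋ ∈ T) : MeasureTheory.volume E ≤ ENNReal.ofReal (T.card * δ) := by
  have hsub : E ⊆ ⋃ k ∈ T, Set.Icc ((k : ℝ) * δ) ((k + 1) * δ) := by
    intro y hy
    refine Set.mem_biUnion (h y hy) ⟨?_, ?_⟩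
    · rw [← le_div_iff₀ hδ]
      exact Int.floor_le _
    · rw [← div_le_iff₀ hδ]
      exact (Int.lt_floor_add_one _).le
  calc MeasureTheory.volume E
      ≤ MeasureTheory.volume (⋃ k ∈ T, Set.Icc ((k : ℝ) * δ) ((k + 1) * δ)) :=
        MeasureTheory.measure_mono hsub
    _ ≤ ∑ k ∈ T, MeasureTheory.volume (Set.Icc ((k : ℝ) * δ) ((k + 1) * δ)) :=
        MeasureTheory.measure_biUnion_finset_le _ _
    _ = ∑ k ∈ T, ENNReal.ofReal δ := by
        refine Finset.sum_congr rfl fun k _ => ?_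
        rw [Real.volume_Icc]
        congr 1
        ring
    _ = ENNReal.ofReal (T.card * δ) := by
        rw [Finset.sum_const, nsmul_eq_mul, ENNReal.ofReal_mul (by positivity),
          ENNReal.ofReal_natCast]

lemma ContainsSquares.one_le_lowerBoxDim {S B : Set Plane} (h : ContainsSquares S B)
    (hS : S.Nonempty) : 1 ≤ lowerBoxDim B := by
  classical
  obtain ⟨c, hc⟩ := hS
  obtain ⟨r, hr, hrB⟩ := h c hc
  refine le_lowerBoxDim (d := 1) fun t ht => ?_
  obtain ⟨ε, hε, h1⟩ := exists_mul_rpow_neg_lt ht (25 / (2 * r))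
  refine ⟨ε, hε, fun δ hδ hδε hcov => ?_⟩
  obtain ⟨T, hT, hTB⟩ := exists_gridPoint_nhds_of_covers hδ hcov
  have h2 := volume_le_card_mul (E := Set.Icc (c 1 - r) (c 1 + r)) (T := T.image Prod.snd) hδ (by
    intro y hy
    have hy' : |y - c 1| ≤ r := by
      rw [abs_le]
      constructor <;> linarith [hy.1, hy.2]
    have hP : (!₂[c 0 + r, y] : Plane) ∈ B := hrB (by
      simp [squareBoundary, abs_of_pos hr, hy'])
    exact Finset.mem_image.2 ⟨_, hTB _ hP (gridPoint δ !₂[c 0 + r, y]) (by simp) (by simp),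
      by simp [gridPoint]⟩)
  rw [Real.volume_Icc, ENNReal.ofReal_le_ofReal_iff (by positivity)] at h2
  have h3 : ((T.image Prod.snd).card : ℝ) ≤ 25 * δ ^ (-t) :=
    le_trans (by exact_mod_cast Finset.card_image_le) hT
  have h4 := h1 δ hδ hδε
  rw [Real.rpow_neg_one, ← one_div, lt_div_iff₀ hδ] at h4
  have h5 : 2 * r ≤ 25 * δ ^ (-t) * δ := by
    calc 2 * r = c 1 + r - (c 1 - r) := by ring
      _ ≤ _ := h2
      _ ≤ _ := by gcongr
  have h6 : 25 / (2 * r) * δ ^ (-t) * δ = (25 * δ ^ (-t) * δ) / (2 * r) := by ring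
  rw [h6, div_lt_one (by positivity)] at h4
  linarith

/-! ### Lower bound for the packing dimension -/

/-- If the four lines carrying the sides of a square centred at each point of `S` meet `A` in
length at least `μ` each, then covering numbers of `S` are bounded in terms of those of `A`. -/
lemma covers_centres_of_volume {S A : Set Plane} {μ δ n : ℝ} (hδ : 0 < δ) (hμ : 0 < μ)
    (h : ∀ c ∈ S, ∃ r : ℝ, ∀ e ∈ ({-r, r} : Set ℝ),
      ENNReal.ofReal μ ≤ MeasureTheory.volume {y : ℝ | (!₂[c 0 + e, y] : Plane) ∈ A} ∧
      ENNReal.ofReal μ ≤ MeasureTheory.volume {x : ℝ | (!₂[x, c 1 + e] : Plane) ∈ A})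
    (hA : Covers A δ n) : Covers S δ (3 * (25 * n * δ / μ) ^ (8 / 3 : ℝ)) := by
  classical
  obtain ⟨T, hT, hTA⟩ := exists_gridPoint_nhds_of_covers hδ hA
  have col : ∀ (a e : ℝ) (z : ℤ), |z - ⌊(a + e) / δ⌋| ≤ 1 →
      ENNReal.ofReal μ ≤ MeasureTheory.volume {y : ℝ | (!₂[a + e, y] : Plane) ∈ A} →
      μ / δ ≤ ((T.filter (fun p => p.1 = z)).card : ℝ) := by
    intro a e z hz hvol
    have h1 := volume_le_card_mul (E := {y : ℝ | (!₂[a + e, y] : Plane) ∈ A})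
      (T := (T.filter (fun p => p.1 = z)).image Prod.snd) hδ (by
        intro y hy
        refine Finset.mem_image.2 ⟨(z, ⌊y / δ⌋), Finset.mem_filter.2 ⟨hTA _ hy _ ?_ ?_, rfl⟩, rfl⟩
        · simpa [gridPoint] using hz
        · simp [gridPoint])
    have h2 := hvol.trans h1
    rw [ENNReal.ofReal_le_ofReal_iff (by positivity), ← div_le_iff₀ hδ] at h2
    exact h2.trans (by exact_mod_cast Finset.card_image_le)
  have row : ∀ (a e : ℝ) (z : ℤ), |z - ⌊(a + e) / δ⌋| ≤ 1 →
      ENNReal.ofReal μ ≤ MeasureTheory.volume {x : ℝ | (!₂[x, a + e] : Plane) ∈ A} →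
      μ / δ ≤ ((T.filter (fun p => p.2 = z)).card : ℝ) := by
    intro a e z hz hvol
    have h1 := volume_le_card_mul (E := {x : ℝ | (!₂[x, a + e] : Plane) ∈ A})
      (T := (T.filter (fun p => p.2 = z)).image Prod.fst) hδ (by
        intro y hy
        refine Finset.mem_image.2 ⟨(⌊y / δ⌋, z), Finset.mem_filter.2 ⟨hTA _ hy _ ?_ ?_, rfl⟩, rfl⟩
        · simp [gridPoint]
        · simpa [gridPoint] using hz)
    have h2 := hvol.trans h1
    rw [ENNReal.ofReal_le_ofReal_iff (by positivity), ← div_le_iff₀ hδ] at h2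
    exact h2.trans (by exact_mod_cast Finset.card_image_le)
  refine covers_of_gridPoint hδ fun U hU => ?_
  have h1 := card_centres_le_of_lines (S := U) (B := T) (M := μ / δ) (by positivity) (by
    intro z hz
    obtain ⟨c, hc, rfl⟩ := hU hz
    obtain ⟨r, hr⟩ := h c hc
    refine ⟨⌊r / δ⌋, fun i hi => ?_⟩
    obtain ⟨a1, a2⟩ := abs_floor_add_neg_or_pos_sub_le (c 0) r δ
    obtain ⟨b1, b2⟩ := abs_floor_add_neg_or_pos_sub_le (c 1) r δ
    rcases Finset.mem_insert.1 hi with rfl | hi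
    · obtain ⟨h1, h2⟩ := hr (-r) (by simp)
      exact ⟨col _ _ _ a1 h1, row _ _ _ b1 h2⟩
    · rw [Finset.mem_singleton.1 hi]
      obtain ⟨h1, h2⟩ := hr r (by simp)
      exact ⟨col _ _ _ a2 h1, row _ _ _ b2 h2⟩)
  refine h1.trans ?_
  gcongr 3 * ?_ ^ (8 / 3 : ℝ)
  rw [div_div_eq_mul_div]
  gcongr

lemma ContainsSquares.packingDim_le {S B : Set Plane} (h : ContainsSquares S B)
    (hS : S.Nonempty) : 1 + 3 / 8 * packingDim S ≤ packingDim B := by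
  refine le_of_forall_gt_imp_ge_of_dense fun c hc => ?_
  obtain ⟨t, ht1, ht2⟩ := ENNReal.lt_iff_exists_nnreal_btwn.1 hc
  refine le_trans ?_ ht2.le
  obtain ⟨G, hBG, hG⟩ := exists_covers_of_packingDim_lt ht1
  choose C ε hε hCov using hG
  set A : ℕ → Set Plane := fun i => ⋃ j ∈ Finset.range (i + 1), G j with hA
  have hAmono : Monotone A := by
    intro i j hij
    refine Set.biUnion_subset_biUnion_left fun k hk => ?_
    simp only [Finset.mem_coe, Finset.mem_range] at hk ⊢
    omega
  have hBA : B ⊆ ⋃ i, A i := by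
    intro p hp
    obtain ⟨i, hi⟩ := Set.mem_iUnion.1 (hBG hp)
    exact Set.mem_iUnion.2 ⟨i, Set.mem_biUnion (Finset.mem_range.2 (Nat.lt_succ_self i)) hi⟩
  have hAcov : ∀ i, ∃ C' ε' : ℝ, 0 ≤ C' ∧ 0 < ε' ∧
      ∀ δ, 0 < δ → δ < ε' → Covers (A i) δ (C' * δ ^ (-(t : ℝ))) := by
    intro i
    have hne : (Finset.range (i + 1)).Nonempty := ⟨0, by simp⟩
    have hpos : 0 < (Finset.range (i + 1)).inf' hne ε :=
      (Finset.lt_inf'_iff hne).2 fun j _ => hε j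
    refine ⟨|∑ j ∈ Finset.range (i + 1), C j|, _, abs_nonneg _, hpos, fun δ h1 h2 => ?_⟩
    have h3 := Covers.biUnion (Finset.range (i + 1)) (fun j hj =>
      hCov j δ h1 (h2.trans_le (Finset.inf'_le _ hj)))
    rw [← Finset.sum_mul] at h3
    refine h3.mono_card ?_
    gcongr
    exact le_abs_self _
  set P : ℕ → Set Plane := fun i => {c | c ∈ S ∧ ∃ r : ℝ, ∀ e ∈ ({-r, r} : Set ℝ),
      ENNReal.ofReal (1 / ((i : ℝ) + 1)) ≤
        MeasureTheory.volume {y : ℝ | (!₂[c 0 + e, y] : Plane) ∈ A i} ∧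
      ENNReal.ofReal (1 / ((i : ℝ) + 1)) ≤
        MeasureTheory.volume {x : ℝ | (!₂[x, c 1 + e] : Plane) ∈ A i}} with hP
  have hSP : S ⊆ ⋃ i, P i := by
    intro c hc
    obtain ⟨r, hr, hrB⟩ := h c hc
    -- along each side of the square, the lengths of the slices of `A i` increase to at least `2r`
    have key : ∀ (f : ℝ → Plane) (a : ℝ), (∀ y, |y - a| ≤ r → f y ∈ B) →
        ∀ᶠ i : ℕ in atTop, ENNReal.ofReal (1 / ((i : ℝ) + 1)) ≤
          MeasureTheory.volume {y : ℝ | f y ∈ A i} := by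
      intro f a hf
      have h1 : Tendsto (fun i : ℕ => MeasureTheory.volume {y : ℝ | f y ∈ A i}) atTop
          (𝓝 (MeasureTheory.volume (⋃ i, {y : ℝ | f y ∈ A i}))) :=
        MeasureTheory.tendsto_measure_iUnion_atTop fun i j hij y hy => hAmono hij hy
      have h2 : ENNReal.ofReal r < MeasureTheory.volume (⋃ i, {y : ℝ | f y ∈ A i}) := by
        calc ENNReal.ofReal r < ENNReal.ofReal (a + r - (a - r)) := by
              rw [ENNReal.ofReal_lt_ofReal_iff] <;> linarith
          _ = MeasureTheory.volume (Set.Icc (a - r) (a + r)) := Real.volume_Icc.symm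
          _ ≤ _ := by
            refine MeasureTheory.measure_mono fun y hy => ?_
            have := hBA (hf y (by rw [abs_le]; constructor <;> linarith [hy.1, hy.2]))
            simpa using this
      have h3 : Tendsto (fun i : ℕ => ENNReal.ofReal (1 / ((i : ℝ) + 1))) atTop
          (𝓝 (ENNReal.ofReal 0)) :=
        ENNReal.tendsto_ofReal tendsto_one_div_add_atTop_nhds_zero_nat
      filter_upwards [h1.eventually (lt_mem_nhds h2), h3.eventually (gt_mem_nhds
        (by simpa using hr : ENNReal.ofReal 0 < ENNReal.ofReal r))] with i h4 h5
      exact h5.le.trans h4.le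
    have k1 := key (fun y => !₂[c 0 + -r, y]) (c 1) fun y hy =>
      hrB (by simp [squareBoundary, hy, abs_of_pos hr])
    have k2 := key (fun y => !₂[c 0 + r, y]) (c 1) fun y hy =>
      hrB (by simp [squareBoundary, hy, abs_of_pos hr])
    have k3 := key (fun y => !₂[y, c 1 + -r]) (c 0) fun y hy =>
      hrB (by simp [squareBoundary, hy, abs_of_pos hr])
    have k4 := key (fun y => !₂[y, c 1 + r]) (c 0) fun y hy =>
      hrB (by simp [squareBoundary, hy, abs_of_pos hr])
    obtain ⟨i, i1, i2, i3, i4⟩ := (k1.and (k2.and (k3.and k4))).exists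
    refine Set.mem_iUnion.2 ⟨i, hc, r, fun e he => ?_⟩
    rcases he with rfl | rfl
    · exact ⟨i1, i3⟩
    · exact ⟨i2, i4⟩
  have hPcov : ∀ i, ∃ C' ε' : ℝ, 0 < ε' ∧ ∀ δ, 0 < δ → δ < ε' →
      Covers (P i) δ (C' * δ ^ (-(8 / 3 * ((t : ℝ) - 1)))) := by
    intro i
    obtain ⟨C', ε', hC', hε', h1⟩ := hAcov i
    refine ⟨3 * (25 * C' * (i + 1)) ^ (8 / 3 : ℝ), ε', hε', fun δ h2 h3 => ?_⟩
    have h4 := covers_centres_of_volume (S := P i) h2 (μ := 1 / ((i : ℝ) + 1)) (by positivity)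
      (fun c hc => hc.2) (h1 δ h2 h3)
    refine h4.mono_card (le_of_eq ?_)
    have h5 : 25 * (C' * δ ^ (-(t : ℝ))) * δ / (1 / ((i : ℝ) + 1))
        = (25 * C' * (i + 1)) * δ ^ (-((t : ℝ) - 1)) := by
      rw [neg_sub, Real.rpow_sub h2, Real.rpow_neg h2.le, Real.rpow_one]
      field_simp
    rw [h5, Real.mul_rpow (by positivity) (by positivity), ← Real.rpow_mul h2.le]
    ring_nf
  have ht : 1 ≤ t := by
    by_contra hcon
    have hlt : (t : ℝ) < 1 := by exact_mod_cast not_le.1 hcon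
    obtain ⟨c, hc⟩ := hS
    obtain ⟨i, hi⟩ := Set.mem_iUnion.1 (hSP hc)
    obtain ⟨C', ε', hε', h1⟩ := hPcov i
    obtain ⟨ε'', hε'', h2⟩ := exists_mul_rpow_neg_lt
      (show 8 / 3 * ((t : ℝ) - 1) < 0 by linarith) C'
    have hm : 0 < min ε' ε'' := lt_min hε' hε''
    have h3 := (h1 (min ε' ε'' / 2) (by positivity)
      ((half_lt_self hm).trans_le (min_le_left _ _))).one_le ⟨c, hi⟩
    have h4 := h2 (min ε' ε'' / 2) (by positivity)
      ((half_lt_self hm).trans_le (min_le_right _ _))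
    rw [neg_zero, Real.rpow_zero] at h4
    linarith
  have hfin : packingDim S ≤ ((8 / 3 * (t - 1) : ℝ≥0) : ℝ≥0∞) := by
    refine _root_.packingDim_le hSP fun i => ?_
    rw [NNReal.coe_mul, NNReal.coe_sub ht]
    exact hPcov i
  calc 1 + 3 / 8 * packingDim S ≤ 1 + 3 / 8 * ((8 / 3 * (t - 1) : ℝ≥0) : ℝ≥0∞) := by gcongr
    _ = ((1 + 3 / 8 * (8 / 3 * (t - 1)) : ℝ≥0) : ℝ≥0∞) := by
      push_cast
      rw [ENNReal.coe_div (by norm_num)]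
      norm_num
    _ = t := by
      congr 1
      have : (3 / 8 : ℝ≥0) * (8 / 3 * (t - 1)) = t - 1 := by
        rw [← mul_assoc]
        norm_num
      rw [this, add_tsub_cancel_of_le ht]

/-! ### Digit expansions with sparse digits -/

/-- The sums `∑ d k * η k` whose digits satisfy `d k ∈ D k`. -/
def digitSums (η : ℕ → ℝ) (D : ℕ → Finset ℤ) : Set ℝ :=
  (fun d : ℕ → ℤ => ∑' k, (d k : ℝ) * η k) '' Set.pi Set.univ (fun k => (D k : Set ℤ))

/-- All digits in base `2 ^ k` at position `k`. -/
noncomputable def fullDigits (k : ℕ) : Finset ℤ := Finset.Ico 0 (2 ^ k)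

/-- Signed digits of absolute value at most `2 ^ (k + 1)` at position `k`, which have to vanish at
the positions congruent to `j` modulo `4`. -/
noncomputable def gapDigits (j k : ℕ) : Finset ℤ :=
  if k % 4 = j then {0} else Finset.Icc (-2 ^ (k + 1)) (2 ^ (k + 1))

lemma abs_le_of_mem_fullDigits {k : ℕ} {d : ℤ} (h : d ∈ fullDigits k) : |d| ≤ 2 ^ k := by
  obtain ⟨h1, h2⟩ := Finset.mem_Ico.1 h
  rw [abs_of_nonneg h1]
  exact h2.le

lemma abs_le_of_mem_gapDigits {j k : ℕ} {d : ℤ} (h : d ∈ gapDigits j k) : |d| ≤ 2 ^ (k + 1) := by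
  unfold gapDigits at h
  split_ifs at h
  · rw [Finset.mem_singleton.1 h, abs_zero]
    positivity
  · exact abs_le.2 (Finset.mem_Icc.1 h)

section DigitSums

/-! The weights `η` below satisfy `2 ^ (k + 1) * η (k + 1) ≤ η k`: expansions with all digits in
base `2 ^ k` at position `k` are then separated up to their last position. -/

variable {η : ℕ → ℝ}

lemma weight_le_pow (hη0 : ∀ k, 0 ≤ η k) (hη : ∀ k, 2 ^ (k + 1) * η (k + 1) ≤ η k) (L n : ℕ) :
    η (L + n) ≤ η L / 2 ^ n := by
  induction n with
  | zero => simp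
  | succ n ih =>
    have h1 := hη (L + n)
    have h2 : (2 : ℝ) ≤ 2 ^ (L + n + 1) := by
      calc (2 : ℝ) = 2 ^ 1 := (pow_one _).symm
        _ ≤ 2 ^ (L + n + 1) := pow_le_pow_right₀ (by norm_num) (by omega)
    have h3 : 2 * η (L + n + 1) ≤ η (L + n) :=
      (mul_le_mul_of_nonneg_right h2 (hη0 _)).trans h1
    rw [pow_succ, ← div_div, ← add_assoc, le_div_iff₀ two_pos]
    linarith

lemma abs_digit_mul_le (hη0 : ∀ k, 0 ≤ η k) (hη : ∀ k, 2 ^ (k + 1) * η (k + 1) ≤ η k)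
    {e : ℕ → ℤ} (he : ∀ k, |e k| ≤ 2 ^ (k + 1)) (L n : ℕ) :
    |(e (n + (L + 1)) : ℝ) * η (n + (L + 1))| ≤ 4 * η L / 2 / 2 ^ n := by
  have h1 : |(e (n + (L + 1)) : ℝ)| ≤ 2 * 2 ^ (L + n + 1) := by
    have := he (n + (L + 1))
    rw [show n + (L + 1) + 1 = L + n + 1 + 1 by ring, pow_succ, mul_comm] at this
    exact_mod_cast this
  rw [abs_mul, abs_of_nonneg (hη0 _)]
  calc |(e (n + (L + 1)) : ℝ)| * η (n + (L + 1)) ≤ 2 * 2 ^ (L + n + 1) * η (n + (L + 1)) :=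
        mul_le_mul_of_nonneg_right h1 (hη0 _)
    _ = 2 * (2 ^ (L + n + 1) * η (L + n + 1)) := by
        rw [show n + (L + 1) = L + n + 1 by ring]; ring
    _ ≤ 2 * η (L + n) := by gcongr; exact hη _
    _ ≤ 2 * (η L / 2 ^ n) := by gcongr; exact weight_le_pow hη0 hη L n
    _ = 4 * η L / 2 / 2 ^ n := by ring

lemma summable_digits (hη0 : ∀ k, 0 ≤ η k) (hη : ∀ k, 2 ^ (k + 1) * η (k + 1) ≤ η k)
    {e : ℕ → ℤ} (he : ∀ k, |e k| ≤ 2 ^ (k + 1)) : Summable (fun k => (e k : ℝ) * η k) := by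
  rw [← summable_nat_add_iff (0 + 1)]
  exact Summable.of_norm_bounded (summable_geometric_two' (4 * η 0))
    fun n => abs_digit_mul_le hη0 hη he 0 n

lemma abs_tsum_tail_le (hη0 : ∀ k, 0 ≤ η k) (hη : ∀ k, 2 ^ (k + 1) * η (k + 1) ≤ η k)
    {e : ℕ → ℤ} (he : ∀ k, |e k| ≤ 2 ^ (k + 1)) {L : ℕ} (h0 : ∀ k ≤ L, e k = 0) :
    |∑' k, (e k : ℝ) * η k| ≤ 4 * η L := by
  rw [← (summable_digits hη0 hη he).sum_add_tsum_nat_add (L + 1),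
    Finset.sum_eq_zero (fun k hk => by
      rw [h0 k (Nat.lt_succ_iff.1 (Finset.mem_range.1 hk))]; simp), zero_add]
  rw [← Real.norm_eq_abs]
  exact tsum_of_norm_bounded (hasSum_geometric_two' (4 * η L))
    fun n => abs_digit_mul_le hη0 hη he L n

lemma abs_tsum_le (hη0 : ∀ k, 0 ≤ η k) (hη : ∀ k, 2 ^ (k + 1) * η (k + 1) ≤ η k)
    {e : ℕ → ℤ} (he : ∀ k, |e k| ≤ 2 ^ (k + 1)) : |∑' k, (e k : ℝ) * η k| ≤ 6 * η 0 := by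
  have hs := summable_digits hη0 hη he
  have htail : |∑' n, (e (n + (0 + 1)) : ℝ) * η (n + (0 + 1))| ≤ 4 * η 0 := by
    rw [← Real.norm_eq_abs]
    exact tsum_of_norm_bounded (hasSum_geometric_two' (4 * η 0))
      fun n => abs_digit_mul_le hη0 hη he 0 n
  rw [← hs.sum_add_tsum_nat_add (0 + 1)]
  have h1 : |(e 0 : ℝ) * η 0| ≤ 2 * η 0 := by
    rw [abs_mul, abs_of_nonneg (hη0 0)]
    have := he 0
    have h2 : |(e 0 : ℝ)| ≤ 2 := by exact_mod_cast this
    exact mul_le_mul_of_nonneg_right h2 (hη0 0)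
  refine (abs_add_le _ _).trans ?_
  simp only [zero_add, Finset.range_one, Finset.sum_singleton] at htail ⊢
  linarith

lemma tsum_digits_sub (hη0 : ∀ k, 0 ≤ η k) (hη : ∀ k, 2 ^ (k + 1) * η (k + 1) ≤ η k)
    {d e : ℕ → ℤ} (hd : ∀ k, |d k| ≤ 2 ^ (k + 1)) (he : ∀ k, |e k| ≤ 2 ^ (k + 1)) :
    ∑' k, (d k : ℝ) * η k - ∑' k, (e k : ℝ) * η k = ∑' k, ((d k - e k : ℤ) : ℝ) * η k := by
  rw [← (summable_digits hη0 hη hd).tsum_sub (summable_digits hη0 hη he)]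
  refine tsum_congr fun k => ?_
  push_cast
  ring

lemma isCompact_digitSums (hη0 : ∀ k, 0 ≤ η k) (hη : ∀ k, 2 ^ (k + 1) * η (k + 1) ≤ η k)
    {D : ℕ → Finset ℤ} (hD : ∀ k, ∀ d ∈ D k, |d| ≤ 2 ^ (k + 1)) :
    IsCompact (digitSums η D) := by
  refine IsCompact.image_of_continuousOn
    (isCompact_univ_pi fun k => (D k).finite_toSet.isCompact) ?_
  have hsum : Summable (fun k => ((2 ^ (k + 1) : ℤ) : ℝ) * η k) :=
    summable_digits hη0 hη (e := fun k => 2 ^ (k + 1)) fun k => by rw [abs_of_pos (by positivity)]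
  refine continuousOn_tsum (fun k => ?_) hsum fun k d hd => ?_
  · refine Continuous.continuousOn ?_
    exact (continuous_of_discreteTopology.comp (continuous_apply k)).mul continuous_const
  · rw [Real.norm_eq_abs, abs_mul, abs_of_nonneg (hη0 k)]
    refine mul_le_mul_of_nonneg_right ?_ (hη0 k)
    have := hD k (d k) (hd k (Set.mem_univ k))
    exact_mod_cast this

/-- Cutting expansions off after position `L` gives a cover. -/
lemma covers_digitSums (hη0 : ∀ k, 0 ≤ η k) (hη : ∀ k, 2 ^ (k + 1) * η (k + 1) ≤ η k)
    {D : ℕ → Finset ℤ} (hD : ∀ k, ∀ d ∈ D k, |d| ≤ 2 ^ (k + 1)) (L : ℕ) :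
    Covers (digitSums η D) (4 * η L) (∏ k ∈ Finset.range (L + 1), ((D k).card : ℝ)) := by
  classical
  refine ⟨(Fintype.piFinset (fun k : Fin (L + 1) => D k)).image
    (fun d => ∑ k : Fin (L + 1), (d k : ℝ) * η k), ?_, ?_⟩
  · refine le_trans (Nat.cast_le.2 Finset.card_image_le) ?_
    rw [Fintype.card_piFinset, Fin.prod_univ_eq_prod_range (fun k => (D k).card) (L + 1)]
    push_cast
    rfl
  · rintro x ⟨d, hd, rfl⟩
    have hd' : ∀ k, d k ∈ D k := fun k => hd k (Set.mem_univ k)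
    refine ⟨_, Finset.mem_image_of_mem _ (Fintype.mem_piFinset.2 fun k => hd' k), ?_⟩
    have hb : ∀ k, |d k| ≤ 2 ^ (k + 1) := fun k => hD k _ (hd' k)
    beta_reduce
    rw [dist_eq_norm, Fin.sum_univ_eq_sum_range (fun k => (d k : ℝ) * η k) (L + 1),
      ← (summable_digits hη0 hη hb).sum_add_tsum_nat_add (L + 1), add_sub_cancel_left]
    exact tsum_of_norm_bounded (hasSum_geometric_two' (4 * η L))
      fun n => abs_digit_mul_le hη0 hη hb L n

/-- Expansions which differ at some position up to `L` have partial sums at distance at least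
`η L`. -/
lemma weight_le_abs_sum (hη0 : ∀ k, 0 ≤ η k) (hη : ∀ k, 2 ^ (k + 1) * η (k + 1) ≤ η k)
    {e : ℕ → ℤ} (he : ∀ k, |e k| ≤ 2 ^ k - 1) (L : ℕ) (h : ∃ k ≤ L, e k ≠ 0) :
    η L ≤ |∑ k ∈ Finset.range (L + 1), (e k : ℝ) * η k| := by
  induction L with
  | zero =>
    obtain ⟨k, hk, hne⟩ := h
    have := he k
    rw [Nat.le_zero.1 hk] at this hne
    rw [pow_zero, sub_self] at this
    exact absurd (abs_nonpos_iff.1 this) hne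
  | succ L ih =>
    rw [Finset.sum_range_succ]
    by_cases hL : ∃ k ≤ L, e k ≠ 0
    · have h1 := ih hL
      have h2 : |(e (L + 1) : ℝ) * η (L + 1)| ≤ (2 ^ (L + 1) - 1) * η (L + 1) := by
        rw [abs_mul, abs_of_nonneg (hη0 _)]
        refine mul_le_mul_of_nonneg_right ?_ (hη0 _)
        exact_mod_cast he (L + 1)
      have h3 := hη L
      have h4 := abs_sub_abs_le_abs_sub
        (∑ k ∈ Finset.range (L + 1), (e k : ℝ) * η k) (-((e (L + 1) : ℝ) * η (L + 1)))
      rw [abs_neg, sub_neg_eq_add] at h4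
      linarith
    · push Not at hL
      obtain ⟨k, hk, hne⟩ := h
      have hkL : k = L + 1 := by
        by_contra hcon
        exact hne (hL k (by omega))
      rw [hkL] at hne
      rw [Finset.sum_eq_zero (fun k hk => by
        rw [hL k (Nat.lt_succ_iff.1 (Finset.mem_range.1 hk))]; simp), zero_add, abs_mul,
        abs_of_nonneg (hη0 _)]
      have : (1 : ℝ) ≤ |(e (L + 1) : ℝ)| := by exact_mod_cast Int.one_le_abs hne
      exact le_mul_of_one_le_left (hη0 _) this

/-! ### The sides of the squares -/

/-- The digits of `r` are chosen so that each of `a - r`, `a + r`, `b - r`, `b + r` has vanishing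
digits in one residue class of positions modulo `4`. -/
lemma exists_radius (hη0 : ∀ k, 0 ≤ η k) (hη : ∀ k, 2 ^ (k + 1) * η (k + 1) ≤ η k) {a b : ℝ}
    (ha : a ∈ digitSums η fullDigits) (hb : b ∈ digitSums η fullDigits) :
    ∃ r : ℝ, |r| ≤ 6 * η 0 ∧ a - r ∈ digitSums η (gapDigits 0) ∧
      a + r ∈ digitSums η (gapDigits 1) ∧ b - r ∈ digitSums η (gapDigits 2) ∧
      b + r ∈ digitSums η (gapDigits 3) := by
  obtain ⟨d, hd, rfl⟩ := ha
  obtain ⟨e, he, rfl⟩ := hb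
  have hd' : ∀ k, |d k| ≤ 2 ^ k := fun k => abs_le_of_mem_fullDigits (hd k (Set.mem_univ k))
  have he' : ∀ k, |e k| ≤ 2 ^ k := fun k => abs_le_of_mem_fullDigits (he k (Set.mem_univ k))
  set f : ℕ → ℤ := fun k => if k % 4 = 0 then d k else if k % 4 = 1 then - d k else
    if k % 4 = 2 then e k else - e k with hf
  have hf' : ∀ k, |f k| ≤ 2 ^ k := by
    intro k
    simp only [hf]
    split_ifs
    · exact hd' k
    · rw [abs_neg]; exact hd' k
    · exact he' k
    · rw [abs_neg]; exact he' k
  have hpow : ∀ k : ℕ, (2 : ℤ) ^ k ≤ 2 ^ (k + 1) := fun k =>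
    pow_le_pow_right₀ (by norm_num) (Nat.le_succ k)
  have sd := summable_digits hη0 hη fun k => (hd' k).trans (hpow k)
  have se := summable_digits hη0 hη fun k => (he' k).trans (hpow k)
  have sf := summable_digits hη0 hη fun k => (hf' k).trans (hpow k)
  have mem : ∀ (j : ℕ) (g : ℕ → ℤ), (∀ k, |g k| ≤ 2 ^ k) → ∀ ε : ℤ, |ε| = 1 →
      (∀ k, k % 4 = j → g k + ε * f k = 0) → ∀ k, g k + ε * f k ∈ gapDigits j k := by
    intro j g hg ε hε h0 k
    unfold gapDigits
    split_ifs with hk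
    · exact Finset.mem_singleton.2 (h0 k hk)
    · rw [Finset.mem_Icc, ← abs_le]
      refine (abs_add_le _ _).trans ?_
      rw [abs_mul, hε, one_mul, pow_succ]
      linarith [hg k, hf' k]
  refine ⟨∑' k, (f k : ℝ) * η k, abs_tsum_le hη0 hη fun k => (hf' k).trans (hpow k),
    ⟨fun k => d k + -1 * f k, fun k _ => mem 0 d hd' (-1) (by simp) ?_ k, ?_⟩,
    ⟨fun k => d k + 1 * f k, fun k _ => mem 1 d hd' 1 (by simp) ?_ k, ?_⟩,
    ⟨fun k => e k + -1 * f k, fun k _ => mem 2 e he' (-1) (by simp) ?_ k, ?_⟩,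
    ⟨fun k => e k + 1 * f k, fun k _ => mem 3 e he' 1 (by simp) ?_ k, ?_⟩⟩
  · intro k hk; simp [hf, hk]
  · beta_reduce
    rw [← sd.tsum_sub sf]
    exact tsum_congr fun k => by push_cast; ring
  · intro k hk; simp [hf, hk]
  · beta_reduce
    rw [← sd.tsum_add sf]
    exact tsum_congr fun k => by push_cast; ring
  · intro k hk; simp [hf, hk]
  · beta_reduce
    rw [← se.tsum_sub sf]
    exact tsum_congr fun k => by push_cast; ring
  · intro k hk; simp [hf, hk]
  · beta_reduce
    rw [← se.tsum_add sf]
    exact tsum_congr fun k => by push_cast; ring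

end DigitSums

/-- The points of the box `[-D, D] ^ 2` which have a coordinate in `Y`. -/
def crossSet (Y : Set ℝ) (D : ℝ) : Set Plane :=
  {p | (p 0 ∈ Y ∨ p 1 ∈ Y) ∧ |p 0| ≤ D ∧ |p 1| ≤ D}

/-- The coordinates of the sides of the constructed squares: sums with sparse digits, shifted by
`± 7 * η 0` so that the radii of the squares become positive. -/
def sideSet (η : ℕ → ℝ) : Set ℝ :=
  ⋃ j ∈ Finset.range 4, ((fun x => x + -(7 * η 0)) '' digitSums η (gapDigits j) ∪
    (fun x => x + 7 * η 0) '' digitSums η (gapDigits j))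

/-- The constructed set of centres: pairs of sums with arbitrary digits. -/
def centreSet (η : ℕ → ℝ) : Set Plane :=
  {p | p 0 ∈ digitSums η fullDigits ∧ p 1 ∈ digitSums η fullDigits}

/-- The constructed set of squares. -/
def squaresSet (η : ℕ → ℝ) : Set Plane := crossSet (sideSet η) (20 * η 0)

lemma isCompact_of_isClosed_of_abs_le {F : Set Plane} (hF : IsClosed F) {D : ℝ}
    (h : ∀ p ∈ F, |p 0| ≤ D ∧ |p 1| ≤ D) : IsCompact F := by
  refine Metric.isCompact_of_isClosed_isBounded hF ?_
  refine (Metric.isBounded_closedBall (x := (0 : Plane)) (r := D + D)).subset fun p hp => ?_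
  rw [Metric.mem_closedBall]
  refine (dist_le_abs_add_abs p 0).trans ?_
  have := h p hp
  simp only [PiLp.zero_apply, sub_zero]
  linarith

lemma continuous_coord (i : Fin 2) : Continuous (fun p : Plane => p i) :=
  (EuclideanSpace.proj (𝕜 := ℝ) i).continuous

lemma isCompact_crossSet {Y : Set ℝ} (hY : IsClosed Y) (D : ℝ) : IsCompact (crossSet Y D) := by
  refine isCompact_of_isClosed_of_abs_le (D := D) ?_ fun p hp => hp.2
  refine IsClosed.inter ((hY.preimage (continuous_coord 0)).union
    (hY.preimage (continuous_coord 1))) (IsClosed.inter ?_ ?_)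
  · exact isClosed_le (continuous_coord 0).abs continuous_const
  · exact isClosed_le (continuous_coord 1).abs continuous_const

lemma squareBoundary_subset_crossSet {Y : Set ℝ} {D r : ℝ} {c : Plane} (hr : 0 < r)
    (h0 : c 0 - r ∈ Y) (h1 : c 0 + r ∈ Y) (h2 : c 1 - r ∈ Y) (h3 : c 1 + r ∈ Y)
    (hD0 : |c 0| + r ≤ D) (hD1 : |c 1| + r ≤ D) : squareBoundary c r ⊆ crossSet Y D := by
  intro p hp
  have hp' : max |p 0 - c 0| |p 1 - c 1| = r := hp
  have b0 : |p 0 - c 0| ≤ r := hp' ▸ le_max_left _ _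
  have b1 : |p 1 - c 1| ≤ r := hp' ▸ le_max_right _ _
  have side : ∀ x a : ℝ, |x - a| = r → a - r ∈ Y → a + r ∈ Y → x ∈ Y := by
    intro x a hx h1 h2
    rcases (abs_eq hr.le).1 hx with h | h
    · rwa [show x = a + r by linarith]
    · rwa [show x = a - r by linarith]
  refine ⟨?_, ?_, ?_⟩
  · rcases max_choice |p 0 - c 0| |p 1 - c 1| with h | h
    · exact Or.inl (side _ _ (h ▸ hp') h0 h1)
    · exact Or.inr (side _ _ (h ▸ hp') h2 h3)
  · have := abs_add_le (p 0 - c 0) (c 0)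
    rw [sub_add_cancel] at this
    linarith
  · have := abs_add_le (p 1 - c 1) (c 1)
    rw [sub_add_cancel] at this
    linarith

lemma covers_Icc {D δ : ℝ} (hδ : 0 < δ) (hD : δ ≤ D) :
    Covers (Set.Icc (-D) D) δ (2 * (D / δ)) := by
  classical
  have h1 : 1 ≤ D / δ := (one_le_div hδ).2 hD
  refine ⟨(Finset.range ⌈D / δ⌉₊).image (fun i : ℕ => -D + (2 * (i : ℝ) + 1) * δ), ?_, ?_⟩
  · refine le_trans (Nat.cast_le.2 Finset.card_image_le) ?_
    rw [Finset.card_range]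
    have := Nat.ceil_lt_add_one (zero_le_one.trans h1)
    linarith
  · intro x hx
    have hx0 : 0 ≤ (x + D) / (2 * δ) := div_nonneg (by linarith [hx.1]) (by linarith)
    have hle : (x + D) / (2 * δ) ≤ D / δ := by
      rw [div_le_div_iff₀ (by linarith) hδ]
      nlinarith [hx.2]
    rcases hle.eq_or_lt with heq | hlt
    · -- the right end point is covered by the last interval
      obtain ⟨i, hi⟩ : ∃ i, ⌈D / δ⌉₊ = i + 1 :=
        Nat.exists_eq_succ_of_ne_zero (by
          have := Nat.ceil_pos.2 (zero_lt_one.trans_le h1)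
          omega)
      refine ⟨_, Finset.mem_image_of_mem _ (Finset.mem_range.2 (by omega : i < ⌈D / δ⌉₊)), ?_⟩
      have h2 := Nat.le_ceil (D / δ)
      have h3 := Nat.ceil_lt_add_one (zero_le_one.trans h1)
      rw [hi] at h2 h3
      push_cast at h2 h3
      rw [← heq] at h2 h3
      rw [div_le_iff₀ (by linarith)] at h2
      have h4 : (i : ℝ) < (x + D) / (2 * δ) := by linarith
      rw [lt_div_iff₀ (by linarith)] at h4
      rw [Real.dist_eq, abs_le]
      constructor <;> linarith
    · refine ⟨_, Finset.mem_image_of_mem _ (Finset.mem_range.2 (?_ :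
        ⌊(x + D) / (2 * δ)⌋₊ < ⌈D / δ⌉₊)), ?_⟩
      · rw [Nat.lt_ceil]
        exact (Nat.floor_le hx0).trans_lt hlt
      · have h2 := Nat.floor_le hx0
        have h3 := Nat.lt_floor_add_one ((x + D) / (2 * δ))
        rw [le_div_iff₀ (by linarith)] at h2
        rw [div_lt_iff₀ (by linarith)] at h3
        rw [Real.dist_eq, abs_le]
        constructor <;> linarith

lemma Covers.prod {Y Z : Set ℝ} {δ m n : ℝ} (hY : Covers Y δ m) (hZ : Covers Z δ n) :
    Covers {p : Plane | p 0 ∈ Y ∧ p 1 ∈ Z} (2 * δ) (m * n) := by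
  classical
  have hm := hY.nonneg
  obtain ⟨T, hT, hc⟩ := hY
  obtain ⟨U, hU, hd⟩ := hZ
  refine ⟨(T ×ˢ U).image (fun q => (!₂[q.1, q.2] : Plane)), ?_, ?_⟩
  · refine le_trans (Nat.cast_le.2 Finset.card_image_le) ?_
    rw [Finset.card_product]
    push_cast
    exact mul_le_mul hT hU (Nat.cast_nonneg _) hm
  · rintro p ⟨h0, h1⟩
    obtain ⟨y, hy, hpy⟩ := hc _ h0
    obtain ⟨z, hz, hpz⟩ := hd _ h1
    refine ⟨_, Finset.mem_image_of_mem _ (Finset.mk_mem_product hy hz), ?_⟩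
    refine (dist_le_abs_add_abs _ _).trans ?_
    rw [Real.dist_eq] at hpy hpz
    simp only [Matrix.cons_val_zero, Matrix.cons_val_one]
    linarith

lemma Covers.crossSet {Y : Set ℝ} {D δ m : ℝ} (hδ : 0 < δ) (hD : δ ≤ D) (hY : Covers Y δ m) :
    Covers (crossSet Y D) (2 * δ) (4 * (D / δ) * m) := by
  have h1 := (hY.prod (covers_Icc hδ hD)).union ((covers_Icc hδ hD).prod hY)
  refine (h1.mono_set ?_).mono_card (le_of_eq (by ring))
  rintro p ⟨hp | hp, hp0, hp1⟩
  · exact Or.inl ⟨hp, abs_le.1 hp1⟩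
  · exact Or.inr ⟨abs_le.1 hp0, hp⟩

lemma Covers.image_add {Y : Set ℝ} {δ m : ℝ} (hY : Covers Y δ m) (a : ℝ) :
    Covers ((fun x => x + a) '' Y) δ m := by
  classical
  obtain ⟨T, hT, hc⟩ := hY
  refine ⟨T.image (fun x => x + a), le_trans (Nat.cast_le.2 Finset.card_image_le) hT, ?_⟩
  rintro x ⟨y, hy, rfl⟩
  obtain ⟨z, hz, hyz⟩ := hc y hy
  exact ⟨_, Finset.mem_image_of_mem _ hz, by simpa using hyz⟩

/-- A bound for the number of expansions cut off after position `M + 1`, with `γ = 1 / 2` for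
arbitrary digits and `γ = 3 / 8` for digits that vanish on a residue class modulo `4`. -/
noncomputable def digitCount (γ : ℝ) (M : ℕ) : ℝ :=
  8 * 2 ^ (γ * ((M : ℝ) + 2) ^ 2 + 5 * ((M : ℝ) + 2))

section Sets

variable {η : ℕ → ℝ}

lemma isCompact_sideSet (hη0 : ∀ k, 0 ≤ η k) (hη : ∀ k, 2 ^ (k + 1) * η (k + 1) ≤ η k) :
    IsCompact (sideSet η) := by
  refine (Finset.range 4).isCompact_biUnion fun j _ => ?_
  have := isCompact_digitSums hη0 hη (D := gapDigits j) fun k d hd => abs_le_of_mem_gapDigits hd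
  exact (this.image (by fun_prop)).union (this.image (by fun_prop))

lemma isCompact_squaresSet (hη0 : ∀ k, 0 ≤ η k) (hη : ∀ k, 2 ^ (k + 1) * η (k + 1) ≤ η k) :
    IsCompact (squaresSet η) :=
  isCompact_crossSet (isCompact_sideSet hη0 hη).isClosed _

lemma abs_le_of_mem_fullDigits' {k : ℕ} {d : ℤ} (h : d ∈ fullDigits k) : |d| ≤ 2 ^ (k + 1) :=
  (abs_le_of_mem_fullDigits h).trans (pow_le_pow_right₀ (by norm_num) (Nat.le_succ k))

lemma abs_le_of_mem_digitSums (hη0 : ∀ k, 0 ≤ η k) (hη : ∀ k, 2 ^ (k + 1) * η (k + 1) ≤ η k)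
    {x : ℝ} (hx : x ∈ digitSums η fullDigits) : |x| ≤ 6 * η 0 := by
  obtain ⟨d, hd, rfl⟩ := hx
  exact abs_tsum_le hη0 hη fun k => abs_le_of_mem_fullDigits' (hd k (Set.mem_univ k))

lemma isCompact_centreSet (hη0 : ∀ k, 0 ≤ η k) (hη : ∀ k, 2 ^ (k + 1) * η (k + 1) ≤ η k) :
    IsCompact (centreSet η) := by
  have hC := isCompact_digitSums hη0 hη (D := fullDigits) fun k d hd => abs_le_of_mem_fullDigits' hd
  refine isCompact_of_isClosed_of_abs_le (D := 6 * η 0) ?_ fun p hp =>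
    ⟨abs_le_of_mem_digitSums hη0 hη hp.1, abs_le_of_mem_digitSums hη0 hη hp.2⟩
  exact (hC.isClosed.preimage (continuous_coord 0)).inter
    (hC.isClosed.preimage (continuous_coord 1))

lemma zero_mem_centreSet : (0 : Plane) ∈ centreSet η := by
  have : (0 : ℝ) ∈ digitSums η fullDigits :=
    ⟨fun _ => 0, fun k _ => Finset.mem_coe.2 (Finset.mem_Ico.2 ⟨le_rfl, by positivity⟩), by simp⟩
  exact ⟨this, this⟩

lemma containsSquares_squaresSet (hη0 : ∀ k, 0 ≤ η k)
    (hη : ∀ k, 2 ^ (k + 1) * η (k + 1) ≤ η k) (hpos : 0 < η 0) :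
    ContainsSquares (centreSet η) (squaresSet η) := by
  intro c hc
  obtain ⟨r, hr, h0, h1, h2, h3⟩ := exists_radius hη0 hη hc.1 hc.2
  have hr' := abs_le.1 hr
  have m0 := abs_le_of_mem_digitSums hη0 hη hc.1
  have m1 := abs_le_of_mem_digitSums hη0 hη hc.2
  have hneg : ∀ x j, j < 4 → x - r ∈ digitSums η (gapDigits j) → x - (7 * η 0 + r) ∈ sideSet η :=
    fun x j hj hx => Set.mem_biUnion (Finset.mem_coe.2 (Finset.mem_range.2 hj))
      (Or.inl ⟨_, hx, by ring⟩)
  have hadd : ∀ x j, j < 4 → x + r ∈ digitSums η (gapDigits j) → x + (7 * η 0 + r) ∈ sideSet η :=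
    fun x j hj hx => Set.mem_biUnion (Finset.mem_coe.2 (Finset.mem_range.2 hj))
      (Or.inr ⟨_, hx, by ring⟩)
  refine ⟨7 * η 0 + r, by linarith, squareBoundary_subset_crossSet (by linarith)
    (hneg _ 0 (by norm_num) h0) (hadd _ 1 (by norm_num) h1) (hneg _ 2 (by norm_num) h2)
    (hadd _ 3 (by norm_num) h3) (by linarith) (by linarith)⟩

lemma covers_fullDigits (hη0 : ∀ k, 0 ≤ η k) (hη : ∀ k, 2 ^ (k + 1) * η (k + 1) ≤ η k) (M : ℕ) :
    Covers (digitSums η fullDigits) (4 * η (M + 1)) (digitCount (1 / 2) M) := by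
  refine (covers_digitSums hη0 hη (fun k d hd => abs_le_of_mem_fullDigits' hd) (M + 1)).mono_card ?_
  have h1 : ∀ n : ℕ, ∏ k ∈ Finset.range n, ((fullDigits k).card : ℝ)
      ≤ 2 ^ (1 / 2 * (n : ℝ) ^ 2) := by
    intro n
    induction n with
    | zero => simp
    | succ n ih =>
      rw [Finset.prod_range_succ]
      have h2 : ((fullDigits n).card : ℝ) = 2 ^ (n : ℝ) := by
        rw [fullDigits, Int.card_Ico, sub_zero, Real.rpow_natCast]
        norm_cast
      rw [h2]
      calc _ ≤ (2 : ℝ) ^ (1 / 2 * (n : ℝ) ^ 2) * 2 ^ (n : ℝ) := by gcongr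
        _ = (2 : ℝ) ^ (1 / 2 * (n : ℝ) ^ 2 + n) := by rw [← Real.rpow_add two_pos]
        _ ≤ _ := by
          refine Real.rpow_le_rpow_of_exponent_le one_le_two ?_
          push_cast
          linarith
  refine (h1 (M + 1 + 1)).trans ?_
  rw [digitCount]
  have h3 : (2 : ℝ) ^ (1 / 2 * ((M + 1 + 1 : ℕ) : ℝ) ^ 2)
      ≤ 2 ^ (1 / 2 * ((M : ℝ) + 2) ^ 2 + 5 * ((M : ℝ) + 2)) := by
    refine Real.rpow_le_rpow_of_exponent_le one_le_two ?_
    push_cast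
    linarith [(Nat.cast_nonneg M : (0 : ℝ) ≤ M)]
  have h4 : 0 < (2 : ℝ) ^ (1 / 2 * ((M : ℝ) + 2) ^ 2 + 5 * ((M : ℝ) + 2)) := by positivity
  linarith

lemma sum_gap_exponents_le (j n : ℕ) (hj : j < 4) :
    8 * ∑ k ∈ Finset.range n, (if k % 4 = j then 0 else k + 3) ≤ 3 * n ^ 2 + 40 * n := by
  induction n using Nat.strong_induction_on with
  | _ n ih =>
    rcases Nat.lt_or_ge n 4 with hn | hn
    · interval_cases n <;> interval_cases j <;> simp [Finset.sum_range_succ]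
    · obtain ⟨m, rfl⟩ := Nat.exists_eq_add_of_le' hn
      have h1 := ih m (by omega)
      rw [Finset.sum_range_succ, Finset.sum_range_succ, Finset.sum_range_succ,
        Finset.sum_range_succ]
      -- one of any four consecutive positions is dropped
      have h2 : (if m % 4 = j then 0 else m + 3) + (if (m + 1) % 4 = j then 0 else m + 1 + 3)
          + (if (m + 2) % 4 = j then 0 else m + 2 + 3) + (if (m + 3) % 4 = j then 0 else m + 3 + 3)
          ≤ 3 * m + 15 := by
        split_ifs <;> omega
      have h3 : 3 * (m + 4) ^ 2 + 40 * (m + 4) = 3 * m ^ 2 + 40 * m + (24 * m + 208) := by ring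
      rw [h3]
      linarith

lemma covers_gapDigits (hη0 : ∀ k, 0 ≤ η k) (hη : ∀ k, 2 ^ (k + 1) * η (k + 1) ≤ η k) {j : ℕ}
    (hj : j < 4) (M : ℕ) : Covers (digitSums η (gapDigits j)) (4 * η (M + 1))
      (2 ^ (3 / 8 * ((M : ℝ) + 2) ^ 2 + 5 * ((M : ℝ) + 2))) := by
  refine (covers_digitSums hη0 hη (fun k d hd => abs_le_of_mem_gapDigits hd) (M + 1)).mono_card ?_
  have h1 : ∀ k, (gapDigits j k).card ≤ 2 ^ (if k % 4 = j then 0 else k + 3) := by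
    intro k
    unfold gapDigits
    split_ifs
    · simp
    · rw [Int.card_Icc]
      have h2 : ((2 : ℤ) ^ (k + 1) + 1 - -2 ^ (k + 1)).toNat = 2 * 2 ^ (k + 1) + 1 := by
        have : (2 : ℤ) ^ (k + 1) + 1 - -2 ^ (k + 1) = ((2 * 2 ^ (k + 1) + 1 : ℕ) : ℤ) := by
          push_cast
          ring
        rw [this, Int.toNat_natCast]
      rw [h2, show k + 3 = k + 1 + 2 by ring, pow_add 2 (k + 1) 2]
      have : 1 ≤ 2 ^ (k + 1) := Nat.one_le_two_pow
      omega
  have h2 : ∏ k ∈ Finset.range (M + 1 + 1), (gapDigits j k).card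
      ≤ 2 ^ (∑ k ∈ Finset.range (M + 1 + 1), (if k % 4 = j then 0 else k + 3)) := by
    rw [← Finset.prod_pow_eq_pow_sum]
    exact Finset.prod_le_prod' fun k _ => h1 k
  have h3 := sum_gap_exponents_le j (M + 1 + 1) hj
  calc ∏ k ∈ Finset.range (M + 1 + 1), ((gapDigits j k).card : ℝ)
      ≤ 2 ^ (∑ k ∈ Finset.range (M + 1 + 1), (if k % 4 = j then 0 else k + 3)) := by
        exact_mod_cast h2
    _ = (2 : ℝ) ^ ((∑ k ∈ Finset.range (M + 1 + 1), (if k % 4 = j then 0 else k + 3) : ℕ) : ℝ) :=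
        (Real.rpow_natCast _ _).symm
    _ ≤ _ := by
        refine Real.rpow_le_rpow_of_exponent_le one_le_two ?_
        have h4 : (8 : ℝ) * ((∑ k ∈ Finset.range (M + 1 + 1),
            (if k % 4 = j then 0 else k + 3) : ℕ) : ℝ)
            ≤ 3 * ((M + 1 + 1 : ℕ) : ℝ) ^ 2 + 40 * ((M + 1 + 1 : ℕ) : ℝ) := by exact_mod_cast h3
        have h5 : ((M + 1 + 1 : ℕ) : ℝ) = (M : ℝ) + 2 := by push_cast; ring
        rw [h5] at h4
        linarith

lemma covers_sideSet (hη0 : ∀ k, 0 ≤ η k) (hη : ∀ k, 2 ^ (k + 1) * η (k + 1) ≤ η k) (M : ℕ) :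
    Covers (sideSet η) (4 * η (M + 1)) (digitCount (3 / 8) M) := by
  refine (Covers.biUnion (Finset.range 4) fun j hj =>
    ((covers_gapDigits hη0 hη (Finset.mem_range.1 hj) M).image_add (-(7 * η 0))).union
      ((covers_gapDigits hη0 hη (Finset.mem_range.1 hj) M).image_add (7 * η 0))).mono_card ?_
  rw [Finset.sum_const, Finset.card_range, nsmul_eq_mul, digitCount]
  push_cast
  linarith

end Sets

/-! ### Covering numbers of the digit sets -/

lemma digitCount_le {γ v : ℝ} (h : γ < v) :
    ∃ A > 0, ∀ M : ℕ, digitCount γ M ≤ A * 2 ^ (v * ((M : ℝ) * (M + 1))) := by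
  set c : ℝ := 4 * γ + 5 - v with hc
  set B : ℝ := 4 * γ + 10 + c ^ 2 / (4 * (v - γ)) with hB
  refine ⟨8 * 2 ^ B, by positivity, fun M => ?_⟩
  rw [digitCount, mul_assoc, ← Real.rpow_add two_pos]
  refine mul_le_mul_of_nonneg_left (Real.rpow_le_rpow_of_exponent_le one_le_two ?_) (by norm_num)
  -- complete the square in `M`
  have h1 : 0 < v - γ := sub_pos.2 h
  have h2 : 0 ≤ (v - γ) * ((M : ℝ) - c / (2 * (v - γ))) ^ 2 := by positivity
  have h3 : (v - γ) * ((M : ℝ) - c / (2 * (v - γ))) ^ 2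
      = (v - γ) * M ^ 2 - c * M + c ^ 2 / (4 * (v - γ)) := by
    field_simp
    ring
  rw [h3, hc] at h2
  rw [hB, hc]
  linarith

/-- The weights `2 ^ (-k (k + 1) / σ)`: the number of full expansions up to position `k` is the
power `-σ / 2` of the weight. -/
noncomputable def weight (σ : ℝ) (k : ℕ) : ℝ := 2 ^ (-((k : ℝ) * (k + 1) / σ))

lemma weight_pos (σ : ℝ) (k : ℕ) : 0 < weight σ k := by unfold weight; positivity

lemma weight_zero (σ : ℝ) : weight σ 0 = 1 := by simp [weight]

lemma two_pow_mul_weight_le {σ : ℝ} (hσ : 0 < σ) (hσ2 : σ ≤ 2) (k : ℕ) :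
    2 ^ (k + 1) * weight σ (k + 1) ≤ weight σ k := by
  unfold weight
  rw [← Real.rpow_natCast, ← Real.rpow_add two_pos]
  refine Real.rpow_le_rpow_of_exponent_le one_le_two ?_
  have h1 : ((k + 1 : ℕ) : ℝ) ≤ 2 * (k + 1) / σ := by
    rw [le_div_iff₀ hσ]
    push_cast
    nlinarith [(Nat.cast_nonneg k : (0 : ℝ) ≤ k)]
  have h2 : ((k + 1 : ℕ) : ℝ) * (((k + 1 : ℕ) : ℝ) + 1) / σ
      = (k : ℝ) * (k + 1) / σ + 2 * (k + 1) / σ := by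
    push_cast
    ring
  rw [h2]
  linarith

lemma two_rpow_mul_self_ge {v : ℝ} (hv : 0 < v) (k : ℕ) :
    ((2 : ℝ) ^ v) ^ k ≤ 2 ^ (v * ((k : ℝ) * (k + 1))) := by
  rw [← Real.rpow_natCast, ← Real.rpow_mul two_pos.le]
  refine Real.rpow_le_rpow_of_exponent_le one_le_two ?_
  have : (k : ℝ) ≤ k * (k + 1) := by nlinarith [(Nat.cast_nonneg k : (0 : ℝ) ≤ k)]
  gcongr

lemma exists_weight_lt {σ ε : ℝ} (hσ : 0 < σ) (hε : 0 < ε) : ∃ k, weight σ k < ε := by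
  obtain ⟨k, hk⟩ := pow_unbounded_of_one_lt (1 / ε)
    (Real.one_lt_rpow one_lt_two (inv_pos.2 hσ) : (1 : ℝ) < 2 ^ σ⁻¹)
  refine ⟨k, ?_⟩
  have h1 := hk.trans_le (two_rpow_mul_self_ge (inv_pos.2 hσ) k)
  rw [weight, Real.rpow_neg two_pos.le, ← one_div, one_div_lt (by positivity) hε]
  rwa [show (k : ℝ) * (k + 1) / σ = σ⁻¹ * (k * (k + 1)) by ring]

/-- From covers at the scales of the weights to covers at all scales. -/
lemma exists_covers_of_digitCount {γ σ u : ℝ} (hσ : 0 < σ) (hu : γ * σ < u) (hu0 : 0 < u) :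
    ∃ A > 0, (∀ M : ℕ, digitCount γ M ≤ A * 2 ^ (u / σ * ((M : ℝ) * (M + 1)))) ∧
      ∀ (Z : Set ℝ) (ρ : ℝ) (η : ℕ → ℝ), 0 < ρ → (∀ k, η k ≤ ρ * weight σ k) →
        (∀ M, Covers Z (4 * η (M + 1)) (digitCount γ M)) →
        ∀ δ, 0 < δ → δ ≤ ρ → Covers Z δ (A * (ρ / δ) ^ u) := by
  obtain ⟨A, hA, hAM⟩ := digitCount_le ((lt_div_iff₀ hσ).2 hu)
  have h4 : (1 : ℝ) ≤ 4 ^ u := Real.one_le_rpow (by norm_num) hu0.le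
  refine ⟨A * 4 ^ u, by positivity, fun M => (hAM M).trans ?_, ?_⟩
  · gcongr
    exact le_mul_of_one_le_right hA.le h4
  · intro Z ρ η hρ hη hZ δ hδ hδρ
    have hex : ∃ k, 4 * ρ * weight σ k ≤ δ := by
      obtain ⟨k, hk⟩ := exists_weight_lt hσ (show 0 < δ / (4 * ρ) by positivity)
      rw [lt_div_iff₀ (by positivity)] at hk
      exact ⟨k, by linarith⟩
    classical
    have hfind := Nat.find_spec hex
    obtain ⟨M, hM⟩ : ∃ M, Nat.find hex = M + 1 := by
      refine Nat.exists_eq_succ_of_ne_zero fun h0 => ?_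
      rw [h0, weight_zero] at hfind
      linarith
    have hlt : δ < 4 * ρ * weight σ M := not_le.1 (Nat.find_min hex (by omega))
    rw [hM] at hfind
    refine ((hZ M).mono_radius ?_).mono_card ((hAM M).trans ?_)
    · linarith [hη (M + 1)]
    · rw [mul_assoc A]
      gcongr
      rw [← Real.mul_rpow (by norm_num) (by positivity)]
      have h5 : (2 : ℝ) ^ (u / σ * ((M : ℝ) * (M + 1))) = ((weight σ M)⁻¹) ^ u := by
        rw [weight, ← Real.rpow_neg two_pos.le, ← Real.rpow_mul two_pos.le]
        congr 1
        ring
      rw [h5]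
      refine Real.rpow_le_rpow (inv_pos.2 (weight_pos _ _)).le ?_ hu0.le
      rw [← mul_div_assoc, le_div_iff₀ hδ, inv_mul_le_iff₀ (weight_pos _ _)]
      linarith

/-! ### Lower bounds for covering numbers of the sets of centres -/

lemma Covers.card_le_of_separated {X ι : Type*} [PseudoMetricSpace X] {F : Set X} {δ n : ℝ}
    (h : Covers F δ n) (U : Finset ι) (f : ι → X) (hf : ∀ i ∈ U, f i ∈ F)
    (hsep : ∀ i ∈ U, ∀ j ∈ U, i ≠ j → 2 * δ < dist (f i) (f j)) : (U.card : ℝ) ≤ n := by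
  obtain ⟨T, hT, hc⟩ := h
  refine le_trans (Nat.cast_le.2 ?_) hT
  rcases U.eq_empty_or_nonempty with rfl | ⟨i₀, -⟩
  · simp
  have : Nonempty X := ⟨f i₀⟩
  choose! g hg using fun (i : ι) (hi : i ∈ U) => hc (f i) (hf i hi)
  refine Finset.card_le_card_of_injOn g (fun i hi => (hg i hi).1) fun i hi j hj hij => ?_
  by_contra hne
  have h1 := hsep i hi j hj hne
  have h2 := (hg i hi).2
  have h3 := (hg j hj).2
  rw [← hij] at h3
  linarith [dist_triangle_right (f i) (f j) (g i)]

lemma Covers.closure {X : Type*} [PseudoMetricSpace X] {F : Set X} {δ n : ℝ}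
    (h : Covers F δ n) : Covers (closure F) δ n := by
  obtain ⟨T, hT, hc⟩ := h
  refine ⟨T, hT, fun x hx => ?_⟩
  have hcl : IsClosed (⋃ y ∈ T, Metric.closedBall y δ) :=
    T.finite_toSet.isClosed_biUnion fun y _ => Metric.isClosed_closedBall
  have hsub : F ⊆ ⋃ y ∈ T, Metric.closedBall y δ := fun x hx => by
    obtain ⟨y, hy, hxy⟩ := hc x hx
    exact Set.mem_biUnion (Finset.mem_coe.2 hy) hxy
  obtain ⟨y, hy, hxy⟩ := Set.mem_iUnion₂.1 (closure_minimal hsub hcl hx)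
  exact ⟨y, hy, hxy⟩

section

variable {η : ℕ → ℝ}

/-- The digits of a cylinder: the first `M` digits are prescribed. -/
noncomputable def cylinderDigits (a : ℕ → ℤ) (M k : ℕ) : Finset ℤ :=
  if k < M then {a k} else fullDigits k

lemma two_rpow_le_prod_card_cylinderDigits (a : ℕ → ℤ) (M n : ℕ) :
    (2 : ℝ) ^ (((n : ℝ) * (n - 1) - M * (M - 1)) / 2)
      ≤ ∏ k ∈ Finset.range n, ((cylinderDigits a M k).card : ℝ) := by
  have hcard : ∀ k, 1 ≤ (cylinderDigits a M k).card := by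
    intro k
    unfold cylinderDigits
    split_ifs
    · simp
    · rw [fullDigits, Int.card_Ico, sub_zero]
      exact Int.toNat_le_toNat (n := 1) (one_le_pow₀ (by norm_num))
  have hprod : ∀ n, (1 : ℝ) ≤ ∏ k ∈ Finset.range n, ((cylinderDigits a M k).card : ℝ) := fun n =>
    Finset.one_le_prod fun k _ => by exact_mod_cast hcard k
  induction n with
  | zero =>
    refine le_trans (Real.rpow_le_one_of_one_le_of_nonpos one_le_two ?_) (hprod 0)
    rcases Nat.eq_zero_or_pos M with rfl | hM
    · simp
    · have h1 : (1 : ℝ) ≤ M := by exact_mod_cast hM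
      simp only [Nat.cast_zero]
      nlinarith
  | succ n ih =>
    by_cases hn : n < M
    · refine le_trans (Real.rpow_le_one_of_one_le_of_nonpos one_le_two ?_) (hprod _)
      have h1 : (n : ℝ) + 1 ≤ M := by exact_mod_cast hn
      push_cast
      nlinarith [(Nat.cast_nonneg n : (0 : ℝ) ≤ n)]
    · rw [Finset.prod_range_succ]
      have h2 : ((cylinderDigits a M n).card : ℝ) = 2 ^ (n : ℝ) := by
        rw [cylinderDigits, if_neg hn, fullDigits, Int.card_Ico, sub_zero, Real.rpow_natCast]
        norm_cast
      rw [h2]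
      calc (2 : ℝ) ^ ((((n + 1 : ℕ) : ℝ) * (((n + 1 : ℕ) : ℝ) - 1) - M * (M - 1)) / 2)
          = (2 : ℝ) ^ (((n : ℝ) * (n - 1) - M * (M - 1)) / 2) * 2 ^ (n : ℝ) := by
            rw [← Real.rpow_add two_pos]
            congr 1
            push_cast
            ring
        _ ≤ _ := by gcongr

/-- A set which contains all the points whose digits start with prescribed ones has large covering
numbers. -/
lemma two_rpow_le_of_covers_cylinder (hη0 : ∀ k, 0 ≤ η k)
    (hη : ∀ k, 2 ^ (k + 1) * η (k + 1) ≤ η k) {a b : ℕ → ℤ} (ha : ∀ k, a k ∈ fullDigits k)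
    (hb : ∀ k, b k ∈ fullDigits k) {M L : ℕ} {F : Set Plane} {δ n : ℝ}
    (hF : ∀ d e : ℕ → ℤ, (∀ k, d k ∈ fullDigits k) → (∀ k, e k ∈ fullDigits k) →
      (∀ k < M, d k = a k ∧ e k = b k) →
      (!₂[∑' k, (d k : ℝ) * η k, ∑' k, (e k : ℝ) * η k] : Plane) ∈ F)
    (hcov : Covers F δ n) (hδ : 2 * δ < η L) :
    (2 : ℝ) ^ ((L : ℝ) * (L + 1) - M * (M - 1)) ≤ n := by
  classical
  set fill : (ℕ → ℤ) → (Fin (L + 1) → ℤ) → ℕ → ℤ :=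
    fun a x k => if h : k < L + 1 then x ⟨k, h⟩ else a k with hfill
  set U : (ℕ → ℤ) → Finset (Fin (L + 1) → ℤ) :=
    fun a => Fintype.piFinset (fun k : Fin (L + 1) => cylinderDigits a M k) with hU
  have hcyl : ∀ (a : ℕ → ℤ) k, a k ∈ fullDigits k → ∀ z ∈ cylinderDigits a M k,
      z ∈ fullDigits k ∧ (k < M → z = a k) := by
    intro a k hk z hz
    unfold cylinderDigits at hz
    split_ifs at hz with h
    · rw [Finset.mem_singleton.1 hz]
      exact ⟨hk, fun _ => rfl⟩
    · exact ⟨hz, fun h' => absurd h' h⟩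
  have hmem : ∀ a : ℕ → ℤ, (∀ k, a k ∈ fullDigits k) → ∀ x ∈ U a, ∀ k,
      fill a x k ∈ fullDigits k ∧ (k < M → fill a x k = a k) := by
    intro a ha x hx k
    simp only [hfill]
    split_ifs with h
    · exact hcyl a k (ha k) _ (Fintype.mem_piFinset.1 hx ⟨k, h⟩)
    · exact ⟨ha k, fun _ => rfl⟩
  have hsep : ∀ a : ℕ → ℤ, (∀ k, a k ∈ fullDigits k) → ∀ x ∈ U a, ∀ y ∈ U a, x ≠ y →
      2 * δ < |∑' k, (fill a x k : ℝ) * η k - ∑' k, (fill a y k : ℝ) * η k| := by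
    intro a ha x hx y hy hxy
    rw [tsum_digits_sub hη0 hη (fun k => abs_le_of_mem_fullDigits' (hmem a ha x hx k).1)
      (fun k => abs_le_of_mem_fullDigits' (hmem a ha y hy k).1)]
    rw [tsum_eq_sum (s := Finset.range (L + 1)) (fun k hk => by
      rw [Finset.mem_range] at hk
      simp only [hfill, dif_neg hk]
      simp)]
    refine hδ.trans_le (weight_le_abs_sum hη0 hη (fun k => ?_) L ?_)
    · obtain ⟨h1, h2⟩ := Finset.mem_Ico.1 (hmem a ha x hx k).1
      obtain ⟨h3, h4⟩ := Finset.mem_Ico.1 (hmem a ha y hy k).1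
      rw [abs_le]
      constructor <;> linarith
    · obtain ⟨k, hk⟩ := Function.ne_iff.1 hxy
      refine ⟨k, Nat.lt_succ_iff.1 k.2, ?_⟩
      simp only [hfill, dif_pos k.2]
      exact sub_ne_zero.2 hk
  have hcard := hcov.card_le_of_separated (U a ×ˢ U b)
    (fun q => !₂[∑' k, (fill a q.1 k : ℝ) * η k, ∑' k, (fill b q.2 k : ℝ) * η k]) (by
      intro q hq
      obtain ⟨h1, h2⟩ := Finset.mem_product.1 hq
      exact hF _ _ (fun k => (hmem a ha _ h1 k).1) (fun k => (hmem b hb _ h2 k).1)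
        fun k hk => ⟨(hmem a ha _ h1 k).2 hk, (hmem b hb _ h2 k).2 hk⟩) (by
      intro q hq q' hq' hne
      obtain ⟨h1, h2⟩ := Finset.mem_product.1 hq
      obtain ⟨h1', h2'⟩ := Finset.mem_product.1 hq'
      by_cases h : q.1 = q'.1
      · have h' : q.2 ≠ q'.2 := fun h3 => hne (Prod.ext h h3)
        exact (hsep b hb _ h2 _ h2' h').trans_le (abs_sub_le_dist
          (!₂[∑' k, (fill a q.1 k : ℝ) * η k, ∑' k, (fill b q.2 k : ℝ) * η k] : Plane)
          !₂[∑' k, (fill a q'.1 k : ℝ) * η k, ∑' k, (fill b q'.2 k : ℝ) * η k] 1)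
      · exact (hsep a ha _ h1 _ h1' h).trans_le (abs_sub_le_dist
          (!₂[∑' k, (fill a q.1 k : ℝ) * η k, ∑' k, (fill b q.2 k : ℝ) * η k] : Plane)
          !₂[∑' k, (fill a q'.1 k : ℝ) * η k, ∑' k, (fill b q'.2 k : ℝ) * η k] 0))
  refine le_trans ?_ hcard
  have hUcard : ∀ a : ℕ → ℤ,
      (2 : ℝ) ^ (((L : ℝ) * (L + 1) - M * (M - 1)) / 2) ≤ ((U a).card : ℝ) := by
    intro a
    have h1 := two_rpow_le_prod_card_cylinderDigits a M (L + 1)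
    rw [hU, Fintype.card_piFinset,
      Fin.prod_univ_eq_prod_range (fun k => (cylinderDigits a M k).card) (L + 1)]
    push_cast at h1 ⊢
    rwa [add_sub_cancel_right, mul_comm ((L : ℝ) + 1)] at h1
  rw [Finset.card_product]
  push_cast
  calc (2 : ℝ) ^ ((L : ℝ) * (L + 1) - M * (M - 1))
      = (2 : ℝ) ^ (((L : ℝ) * (L + 1) - M * (M - 1)) / 2)
        * (2 : ℝ) ^ (((L : ℝ) * (L + 1) - M * (M - 1)) / 2) := by
        rw [← Real.rpow_add two_pos, add_halves]
    _ ≤ _ := mul_le_mul (hUcard a) (hUcard b) (by positivity) (by positivity)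

end

/-! ### Sharpness for the packing dimension -/

lemma le_packingDim_centreSet {s : ℝ} (hs : 0 < s) (hs2 : s ≤ 2) :
    ENNReal.ofReal s ≤ packingDim (centreSet (weight s)) := by
  by_contra hcon
  obtain ⟨t, ht1, ht2⟩ := ENNReal.lt_iff_exists_nnreal_btwn.1 (not_le.1 hcon)
  have hts : (t : ℝ) < s := by
    rw [← ENNReal.ofReal_coe_nnreal, ENNReal.ofReal_lt_ofReal_iff hs] at ht2
    exact ht2
  obtain ⟨G, hSG, hG⟩ := exists_covers_of_packingDim_lt ht1
  have hη0 : ∀ k, 0 ≤ weight s k := fun k => (weight_pos s k).le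
  have hη := two_pow_mul_weight_le hs hs2
  -- by Baire's theorem the closure of one of the sets `G i` contains a relatively open portion
  have hcpt : CompactSpace (centreSet (weight s)) :=
    isCompact_iff_compactSpace.1 (isCompact_centreSet hη0 hη)
  have hne : Nonempty (centreSet (weight s)) := ⟨⟨0, zero_mem_centreSet⟩⟩
  obtain ⟨i, p, hp⟩ := nonempty_interior_of_iUnion_of_closed
    (f := fun i => {x : centreSet (weight s) | (x : Plane) ∈ closure (G i)})
    (fun i => isClosed_closure.preimage continuous_subtype_val) (by
      rw [Set.eq_univ_iff_forall]
      intro x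
      obtain ⟨i, hi⟩ := Set.mem_iUnion.1 (hSG x.2)
      exact Set.mem_iUnion.2 ⟨i, subset_closure hi⟩)
  obtain ⟨r, hr, hball⟩ := Metric.mem_nhds_iff.1 (mem_interior_iff_mem_nhds.1 hp)
  obtain ⟨⟨a, ha, hap⟩, ⟨b, hb, hbp⟩⟩ := p.2
  have ha' : ∀ k, a k ∈ fullDigits k := fun k => ha k (Set.mem_univ k)
  have hb' : ∀ k, b k ∈ fullDigits k := fun k => hb k (Set.mem_univ k)
  obtain ⟨L₀, hL₀⟩ := exists_weight_lt hs (show 0 < r / 8 by positivity)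
  have htail : ∀ d a : ℕ → ℤ, (∀ k, d k ∈ fullDigits k) → (∀ k, a k ∈ fullDigits k) →
      (∀ k < L₀ + 1, d k = a k) →
      |∑' k, (d k : ℝ) * weight s k - ∑' k, (a k : ℝ) * weight s k| ≤ 4 * weight s L₀ := by
    intro d a hd ha h
    rw [tsum_digits_sub hη0 hη (fun k => abs_le_of_mem_fullDigits' (hd k))
      (fun k => abs_le_of_mem_fullDigits' (ha k))]
    refine abs_tsum_tail_le hη0 hη (fun k => ?_) fun k hk => sub_eq_zero.2 (h k (by omega))
    obtain ⟨h1, h2⟩ := Finset.mem_Ico.1 (hd k)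
    obtain ⟨h3, h4⟩ := Finset.mem_Ico.1 (ha k)
    have : (2 : ℤ) ^ k ≤ 2 ^ (k + 1) := pow_le_pow_right₀ (by norm_num) (Nat.le_succ k)
    rw [abs_le]
    constructor <;> linarith
  have hcyl : ∀ d e : ℕ → ℤ, (∀ k, d k ∈ fullDigits k) → (∀ k, e k ∈ fullDigits k) →
      (∀ k < L₀ + 1, d k = a k ∧ e k = b k) →
      (!₂[∑' k, (d k : ℝ) * weight s k, ∑' k, (e k : ℝ) * weight s k] : Plane)
        ∈ closure (G i) := by
    intro d e hd he h
    have hmem : (!₂[∑' k, (d k : ℝ) * weight s k, ∑' k, (e k : ℝ) * weight s k] : Plane)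
        ∈ centreSet (weight s) :=
      ⟨⟨d, fun k _ => hd k, rfl⟩, ⟨e, fun k _ => he k, rfl⟩⟩
    have := @hball ⟨_, hmem⟩ (by
      rw [Metric.mem_ball, Subtype.dist_eq]
      refine (dist_le_abs_add_abs _ _).trans_lt ?_
      rw [← hap, ← hbp]
      have h1 := htail d a hd ha' fun k hk => (h k hk).1
      have h2 := htail e b he hb' fun k hk => (h k hk).2
      simp only [Matrix.cons_val_zero, Matrix.cons_val_one]
      linarith)
    exact this
  obtain ⟨C, ε, hε, hcov⟩ := hG i
  -- the number of cylinders of generation `L` in this portion is too large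
  set v : ℝ := 1 - t / s with hv
  have hv0 : 0 < v := sub_pos.2 ((div_lt_one hs).2 hts)
  obtain ⟨L₁, hL₁⟩ := exists_weight_lt hs hε
  obtain ⟨L₂, hL₂⟩ := pow_unbounded_of_one_lt
    (C * 3 ^ (t : ℝ) * 2 ^ (((L₀ + 1 : ℕ) : ℝ) * (((L₀ + 1 : ℕ) : ℝ) - 1)))
    (Real.one_lt_rpow one_lt_two hv0)
  set L := L₁ + L₂ with hL
  have hwL : weight s L ≤ weight s L₁ :=
    (weight_le_pow hη0 hη L₁ L₂).trans (div_le_self (hη0 _) (one_le_pow₀ one_le_two))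
  have hw := weight_pos s L
  have h1 := two_rpow_le_of_covers_cylinder (L := L) hη0 hη ha' hb' hcyl
    ((hcov (weight s L / 3) (by positivity) (by linarith)).closure) (by linarith)
  have h2 : (weight s L / 3) ^ (-(t : ℝ)) = 3 ^ (t : ℝ) * 2 ^ (t / s * ((L : ℝ) * (L + 1))) := by
    rw [Real.div_rpow hw.le (by norm_num), weight, ← Real.rpow_mul two_pos.le,
      Real.rpow_neg (by norm_num : (0 : ℝ) ≤ 3), div_inv_eq_mul, mul_comm]
    congr 2
    ring
  have h3 : (2 : ℝ) ^ ((L : ℝ) * (L + 1))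
      = 2 ^ (v * ((L : ℝ) * (L + 1))) * 2 ^ (t / s * ((L : ℝ) * (L + 1))) := by
    rw [← Real.rpow_add two_pos, hv]
    ring_nf
  rw [Real.rpow_sub two_pos, div_le_iff₀ (by positivity), h2, h3] at h1
  have h4 : (2 : ℝ) ^ (v * ((L : ℝ) * (L + 1)))
      ≤ C * 3 ^ (t : ℝ) * 2 ^ (((L₀ + 1 : ℕ) : ℝ) * (((L₀ + 1 : ℕ) : ℝ) - 1)) := by
    refine le_of_mul_le_mul_right ?_
      (show (0 : ℝ) < 2 ^ (t / s * ((L : ℝ) * (L + 1))) by positivity)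
    linarith
  have h5 : ((2 : ℝ) ^ v) ^ L₂ ≤ ((2 : ℝ) ^ v) ^ L :=
    pow_le_pow_right₀ (Real.one_le_rpow one_le_two hv0.le) (by omega)
  linarith [two_rpow_mul_self_ge hv0 L]

lemma packingDim_le_ofReal {E : Type*} [SeminormedAddCommGroup E] [NormedSpace ℝ E] {F : Set E}
    {d : ℝ} (hd : 0 ≤ d) (h : ∀ t > d, ∃ C ε : ℝ, 0 < ε ∧ ∀ δ, 0 < δ → δ < ε →
      Covers F δ (C * δ ^ (-t))) : packingDim F ≤ ENNReal.ofReal d := by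
  refine le_of_forall_gt_imp_ge_of_dense fun c hc => ?_
  obtain ⟨t, ht1, ht2⟩ := ENNReal.lt_iff_exists_nnreal_btwn.1 hc
  refine le_trans ?_ ht2.le
  have hdt : d < t := by
    rw [← ENNReal.ofReal_coe_nnreal, ENNReal.ofReal_lt_ofReal_iff_of_nonneg hd] at ht1
    exact ht1
  exact packingDim_le (G := fun _ => F) (Set.subset_iUnion (fun _ : ℕ => F) 0) fun _ => h t hdt

lemma packingDim_centreSet_le {s : ℝ} (hs : 0 < s) (hs2 : s ≤ 2) :
    packingDim (centreSet (weight s)) ≤ ENNReal.ofReal s := by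
  refine packingDim_le_ofReal hs.le fun t ht => ?_
  have hη0 : ∀ k, 0 ≤ weight s k := fun k => (weight_pos s k).le
  obtain ⟨A, hA, -, hcov⟩ := exists_covers_of_digitCount (γ := 1 / 2) (u := t / 2) hs
    (by linarith) (by linarith)
  refine ⟨A * A * 2 ^ t, 1, one_pos, fun δ hδ hδ1 => ?_⟩
  have h1 := hcov _ 1 (weight s) one_pos (fun k => by rw [one_mul])
    (covers_fullDigits hη0 (two_pow_mul_weight_le hs hs2)) (δ / 2) (by positivity) (by linarith)
  have h2 := (h1.prod h1).mono_radius (show 2 * (δ / 2) ≤ δ by linarith)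
  refine Covers.mono_card (F := centreSet (weight s)) h2 (le_of_eq ?_)
  rw [one_div_div, Real.div_rpow two_pos.le hδ.le, Real.rpow_neg hδ.le]
  have e1 : (2 : ℝ) ^ t = 2 ^ (t / 2) * 2 ^ (t / 2) := by
    rw [← Real.rpow_add two_pos, add_halves]
  have e2 : δ ^ t = δ ^ (t / 2) * δ ^ (t / 2) := by rw [← Real.rpow_add hδ, add_halves]
  rw [e1, e2]
  field_simp

lemma packingDim_squaresSet_le {s : ℝ} (hs : 0 < s) (hs2 : s ≤ 2) :
    packingDim (squaresSet (weight s)) ≤ ENNReal.ofReal (1 + 3 / 8 * s) := by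
  refine packingDim_le_ofReal (by positivity) fun t ht => ?_
  have hη0 : ∀ k, 0 ≤ weight s k := fun k => (weight_pos s k).le
  obtain ⟨A, hA, -, hcov⟩ := exists_covers_of_digitCount (γ := 3 / 8) (u := t - 1) hs
    (by linarith) (by linarith)
  refine ⟨80 * A * 2 ^ t, 1, one_pos, fun δ hδ hδ1 => ?_⟩
  have h1 := hcov _ 1 (weight s) one_pos (fun k => by rw [one_mul])
    (covers_sideSet hη0 (two_pow_mul_weight_le hs hs2)) (δ / 2) (by positivity) (by linarith)
  have h2 := (h1.crossSet (D := 20 * weight s 0) (by positivity)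
    (by rw [weight_zero]; linarith)).mono_radius (show 2 * (δ / 2) ≤ δ by linarith)
  refine Covers.mono_card (F := squaresSet (weight s)) h2 (le_of_eq ?_)
  rw [weight_zero, one_div_div, Real.div_rpow two_pos.le hδ.le, Real.rpow_neg hδ.le,
    Real.rpow_sub_one two_ne_zero, Real.rpow_sub_one hδ.ne']
  field_simp
  ring

/-! ### The degenerate case of a single centre -/

lemma squareBoundary_zero_one_subset :
    squareBoundary (0 : Plane) 1 ⊆ crossSet {-1, 1} 1 := by
  refine squareBoundary_subset_crossSet one_pos ?_ ?_ ?_ ?_ ?_ ?_ <;> simp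

lemma covers_crossSet_one {δ : ℝ} (hδ : 0 < δ) (hδ1 : δ < 1) :
    Covers (crossSet {-1, 1} 1) δ (16 * δ ^ (-1 : ℝ)) := by
  have h1 : Covers ({-1, 1} : Set ℝ) (δ / 2) 2 :=
    ⟨{-1, 1}, by exact_mod_cast Finset.card_le_two, fun x hx => ⟨x, by simpa using hx, by
      rw [dist_self]; positivity⟩⟩
  refine ((h1.crossSet (D := 1) (by positivity) (by linarith)).mono_radius
    (show 2 * (δ / 2) ≤ δ by linarith)).mono_card (le_of_eq ?_)
  rw [Real.rpow_neg_one]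
  field_simp
  norm_num

lemma covers_singleton {X : Type*} [PseudoMetricSpace X] (x : X) {δ : ℝ} (hδ : 0 < δ) :
    Covers ({x} : Set X) δ 1 :=
  covers_of_subset_closedBall (x := x) (by simpa using hδ.le)

lemma containsSquares_crossSet_one : ContainsSquares {0} (crossSet {-1, 1} 1) := by
  intro c hc
  rw [Set.mem_singleton_iff.1 hc]
  exact ⟨1, one_pos, squareBoundary_zero_one_subset⟩

lemma isCompact_crossSet_one : IsCompact (crossSet {-1, 1} 1) :=
  isCompact_crossSet (Set.toFinite _).isClosed 1

lemma packingDim_singleton_zero : packingDim ({0} : Set Plane) = 0 := by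
  have h := packingDim_le_ofReal (F := ({0} : Set Plane)) (d := 0) le_rfl fun t ht =>
    ⟨1, 1, one_pos, fun δ hδ hδ1 => (covers_singleton 0 hδ).mono_card (by
      rw [one_mul]
      exact Real.one_le_rpow_of_pos_of_le_one_of_nonpos hδ hδ1.le (by linarith))⟩
  rw [ENNReal.ofReal_zero] at h
  exact le_antisymm h bot_le

lemma packingDim_crossSet_one_le : packingDim (crossSet {-1, 1} 1) ≤ ENNReal.ofReal 1 := by
  refine packingDim_le_ofReal zero_le_one fun t ht => ⟨16, 1, one_pos, fun δ hδ hδ1 => ?_⟩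
  refine (covers_crossSet_one hδ hδ1).mono_card ?_
  gcongr 16 * ?_
  exact Real.rpow_le_rpow_of_exponent_ge hδ hδ1.le (by linarith)

lemma exists_packingDim_eq {s : ℝ} (hs : s ∈ Set.Icc (0 : ℝ) 2) :
    ∃ S B : Set Plane, S.Nonempty ∧ IsCompact S ∧ IsCompact B ∧ ContainsSquares S B ∧
      packingDim S = ENNReal.ofReal s ∧ packingDim B = ENNReal.ofReal (1 + 3 / 8 * s) := by
  have hlow : ∀ S B : Set Plane, S.Nonempty → ContainsSquares S B →
      packingDim S = ENNReal.ofReal s → ENNReal.ofReal (1 + 3 / 8 * s) ≤ packingDim B := by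
    intro S B hS h hdim
    have h1 := h.packingDim_le hS
    rw [hdim] at h1
    refine le_trans (le_of_eq ?_) h1
    rw [ENNReal.ofReal_add zero_le_one (by linarith [hs.1]), ENNReal.ofReal_one,
      ENNReal.ofReal_mul (by norm_num), ENNReal.ofReal_div_of_pos (by norm_num)]
    simp
  rcases hs.1.eq_or_lt with rfl | hpos
  · have h0 : packingDim ({0} : Set Plane) = ENNReal.ofReal 0 := by
      rw [packingDim_singleton_zero, ENNReal.ofReal_zero]
    refine ⟨{0}, crossSet {-1, 1} 1, Set.singleton_nonempty 0, isCompact_singleton,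
      isCompact_crossSet_one, containsSquares_crossSet_one, h0, le_antisymm ?_
      (hlow _ _ (Set.singleton_nonempty 0) containsSquares_crossSet_one h0)⟩
    simpa using packingDim_crossSet_one_le
  · have hη0 : ∀ k, 0 ≤ weight s k := fun k => (weight_pos s k).le
    have hη := two_pow_mul_weight_le hpos hs.2
    have hne : (centreSet (weight s)).Nonempty := ⟨0, zero_mem_centreSet⟩
    have hsq := containsSquares_squaresSet hη0 hη (weight_pos s 0)
    have hS := le_antisymm (packingDim_centreSet_le hpos hs.2) (le_packingDim_centreSet hpos hs.2)
    exact ⟨_, _, hne, isCompact_centreSet hη0 hη, isCompact_squaresSet hη0 hη, hsq, hS,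
      le_antisymm (packingDim_squaresSet_le hpos hs.2) (hlow _ _ hne hsq hS)⟩

/-! ### Sharpness for the box counting dimensions -/

lemma isCompact_insert_iUnion {F : ℕ → Set Plane} (hF : ∀ K, IsCompact (F K)) {A : ℝ}
    (hA : ∀ K, F K ⊆ Metric.closedBall 0 (A * (1 / 2) ^ K)) :
    IsCompact (insert 0 (⋃ K, F K)) := by
  have hlim : Tendsto (fun K : ℕ => A * (1 / 2 : ℝ) ^ K) atTop (𝓝 0) := by
    simpa using (tendsto_pow_atTop_nhds_zero_of_lt_one (by norm_num : (0 : ℝ) ≤ 1 / 2)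
      (by norm_num)).const_mul A
  refine isCompact_of_finite_subcover fun {ι} U hU hsub => ?_
  classical
  obtain ⟨i₀, hi₀⟩ := Set.mem_iUnion.1 (hsub (Set.mem_insert _ _))
  obtain ⟨ε, hε, hball⟩ := Metric.isOpen_iff.1 (hU i₀) 0 hi₀
  obtain ⟨K₀, hK₀⟩ := eventually_atTop.1 (hlim.eventually (gt_mem_nhds hε))
  have hcpt : IsCompact (⋃ K ∈ Finset.range K₀, F K) :=
    (Finset.range K₀).isCompact_biUnion fun K _ => hF K
  obtain ⟨t, ht⟩ := hcpt.elim_finite_subcover U hU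
    ((Set.iUnion₂_subset fun K _ => (Set.subset_iUnion F K).trans (Set.subset_insert _ _)).trans
      hsub)
  refine ⟨insert i₀ t, ?_⟩
  rintro x (rfl | hx)
  · exact Set.mem_biUnion (Finset.mem_insert_self _ _) hi₀
  · obtain ⟨K, hK⟩ := Set.mem_iUnion.1 hx
    rcases Nat.lt_or_ge K K₀ with h | h
    · obtain ⟨i, hi, hxi⟩ := Set.mem_iUnion₂.1
        (ht (Set.mem_biUnion (Finset.mem_coe.2 (Finset.mem_range.2 h)) hK))
      exact Set.mem_biUnion (Finset.mem_insert_of_mem hi) hxi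
    · refine Set.mem_biUnion (Finset.mem_insert_self _ _) (hball ?_)
      exact lt_of_le_of_lt (hA K hK) (hK₀ K h)

/-- A union of sets shrinking geometrically to a point: at scale `δ` only `O(log (1 / δ))` of the
sets matter. -/
lemma upperBoxDim_insert_iUnion_le {F : ℕ → Set Plane} {A d : ℝ} (hA1 : 1 ≤ A) (hd : 0 ≤ d)
    (hA : ∀ K, F K ⊆ Metric.closedBall 0 (A * (1 / 2) ^ K))
    (h : ∀ t > d, ∃ C, ∀ K δ, 0 < δ → δ < 1 → Covers (F K) δ (C * δ ^ (-t))) :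
    upperBoxDim (insert 0 (⋃ K, F K)) ≤ d := by
  refine upperBoxDim_le fun t' ht' => ?_
  obtain ⟨t, hdt, htt⟩ := exists_between ht'
  obtain ⟨C, hC⟩ := h t hdt
  have hC0 : 0 ≤ C := by
    have h1 := (hC 0 (1 / 2) (by norm_num) (by norm_num)).nonneg
    have h2 : (0 : ℝ) < (1 / 2) ^ (-t) := by positivity
    exact nonneg_of_mul_nonneg_left h1 h2
  obtain ⟨ε, hε, hlog⟩ := exists_log_mul_rpow_lt (a := t' - t) (C := -(C / Real.log 2))
    (sub_pos.2 htt) (1 + C * (Real.log A / Real.log 2 + 1)) one_pos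
  refine ⟨min ε 1, lt_min hε one_pos, fun δ hδ hδε => ?_⟩
  have hδ1 : δ < 1 := hδε.trans_le (min_le_right _ _)
  have hAδ : 1 ≤ A / δ := by rw [one_le_div hδ]; linarith
  have hlog0 : 0 ≤ Real.logb 2 (A / δ) := Real.logb_nonneg one_lt_two hAδ
  set K₀ := ⌈Real.logb 2 (A / δ)⌉₊ with hK₀
  have hK1 : (K₀ : ℝ) ≤ Real.logb 2 (A / δ) + 1 := (Nat.ceil_lt_add_one hlog0).le
  have hK2 : A * (1 / 2) ^ K₀ ≤ δ := by
    have h1 : A / δ ≤ 2 ^ (K₀ : ℝ) :=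
      (Real.logb_le_iff_le_rpow one_lt_two (by positivity)).1 (Nat.le_ceil _)
    rw [Real.rpow_natCast, div_le_iff₀ hδ] at h1
    rw [one_div, inv_pow, ← div_eq_mul_inv, div_le_iff₀ (by positivity)]
    linarith
  have hcov := (covers_of_subset_closedBall (F := Metric.closedBall (0 : Plane) δ) subset_rfl).union
    (Covers.biUnion (Finset.range K₀) fun K _ => hC K δ hδ hδ1)
  refine (hcov.mono_set ?_).mono_card ?_
  · rintro x (rfl | hx)
    · exact Or.inl (Metric.mem_closedBall_self hδ.le)
    · obtain ⟨K, hK⟩ := Set.mem_iUnion.1 hx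
      rcases Nat.lt_or_ge K K₀ with h | h
      · exact Or.inr (Set.mem_biUnion (Finset.mem_coe.2 (Finset.mem_range.2 h)) hK)
      · refine Or.inl (Metric.closedBall_subset_closedBall ?_ (hA K hK))
        refine le_trans ?_ hK2
        gcongr A * ?_
        exact pow_le_pow_of_le_one (by norm_num) (by norm_num) h
  · rw [Finset.sum_const, Finset.card_range, nsmul_eq_mul]
    have h1 := hlog δ hδ (hδε.trans_le (min_le_left _ _))
    have h2 : 0 < δ ^ (-t') := Real.rpow_pos_of_pos hδ _
    have h3 : δ ^ (-t) = δ ^ (t' - t) * δ ^ (-t') := by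
      rw [← Real.rpow_add hδ]
      ring_nf
    have h4 : 1 ≤ δ ^ (-t) :=
      Real.one_le_rpow_of_pos_of_le_one_of_nonpos hδ hδ1.le (by linarith)
    have h5 : Real.logb 2 (A / δ) = Real.log A / Real.log 2 - Real.log δ / Real.log 2 := by
      rw [Real.logb, Real.log_div (by positivity) hδ.ne', sub_div]
    rw [h5] at hK1
    calc 1 + (K₀ : ℝ) * (C * δ ^ (-t))
        ≤ δ ^ (-t) + (Real.log A / Real.log 2 - Real.log δ / Real.log 2 + 1) * (C * δ ^ (-t)) := by
          gcongr
      _ = (1 + C * (Real.log A / Real.log 2 + 1) + -(C / Real.log 2) * Real.log δ)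
          * δ ^ (t' - t) * δ ^ (-t') := by rw [h3]; ring
      _ ≤ 1 * δ ^ (-t') := by gcongr
      _ = δ ^ (-t') := one_mul _

/-- The size of the `K`-th piece, with `κ = 2 / s`. -/
noncomputable def pieceScale (κ : ℝ) (K : ℕ) : ℝ :=
  2 ^ ((1 - κ) * ((K : ℝ) * (K + 1) / 2) - K)

/-- The weights of the `K`-th piece, which vanish after position `K`. -/
noncomputable def pieceWeight (κ : ℝ) (K k : ℕ) : ℝ :=
  if k ≤ K then pieceScale κ K * weight 2 k else 0

section Piece

variable {κ : ℝ} (K : ℕ)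

lemma pieceScale_pos : 0 < pieceScale κ K := by unfold pieceScale; positivity

lemma pieceWeight_nonneg (k : ℕ) : 0 ≤ pieceWeight κ K k := by
  unfold pieceWeight
  split_ifs
  · exact mul_nonneg (pieceScale_pos K).le (weight_pos _ _).le
  · exact le_rfl

lemma pieceWeight_zero : pieceWeight κ K 0 = pieceScale κ K := by
  simp [pieceWeight, weight_zero]

lemma pieceWeight_le (k : ℕ) : pieceWeight κ K k ≤ pieceScale κ K * weight 2 k := by
  unfold pieceWeight
  split_ifs
  · exact le_rfl
  · exact mul_nonneg (pieceScale_pos K).le (weight_pos _ _).le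

lemma two_pow_mul_pieceWeight_le (k : ℕ) :
    2 ^ (k + 1) * pieceWeight κ K (k + 1) ≤ pieceWeight κ K k := by
  have h := two_pow_mul_weight_le two_pos le_rfl k
  by_cases hk : k + 1 ≤ K
  · rw [pieceWeight, pieceWeight, if_pos hk, if_pos (by omega)]
    calc _ = pieceScale κ K * (2 ^ (k + 1) * weight 2 (k + 1)) := by ring
      _ ≤ _ := mul_le_mul_of_nonneg_left h (pieceScale_pos K).le
  · rw [pieceWeight, if_neg hk, mul_zero]
    exact pieceWeight_nonneg K k

lemma pieceScale_le (hκ : 1 ≤ κ) : pieceScale κ K ≤ (1 / 2) ^ K := by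
  rw [pieceScale, one_div, inv_pow, ← Real.rpow_natCast, ← Real.rpow_neg two_pos.le]
  refine Real.rpow_le_rpow_of_exponent_le one_le_two ?_
  have : 0 ≤ (κ - 1) * ((K : ℝ) * (K + 1) / 2) :=
    mul_nonneg (by linarith) (by positivity)
  linarith

lemma pieceScale_le_rpow :
    pieceScale κ K ≤ ((2 : ℝ) ^ ((K : ℝ) * (K + 1) / 2)) ^ (1 - κ) := by
  rw [pieceScale, ← Real.rpow_mul two_pos.le]
  refine Real.rpow_le_rpow_of_exponent_le one_le_two ?_
  linarith [(Nat.cast_nonneg K : (0 : ℝ) ≤ K)]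

end Piece

/-- With `P` positions per coordinate in a piece of size `ρ`, the number of positions that are
visible at scale `δ` is `min P (max 1 (ρ / δ))`. -/
lemma visible_bounds {κ P ρ δ : ℝ} (hκ : 1 ≤ κ) (hP : 1 ≤ P) (hρP : ρ ≤ P ^ (1 - κ))
    (hδ : 0 < δ) (hδ1 : δ ≤ 1) :
    1 ≤ min P (max 1 (ρ / δ)) ∧ min P (max 1 (ρ / δ)) ≤ δ ^ (-(1 / κ)) ∧
      ∀ u, 0 ≤ u → max 1 (ρ / δ) * (min P (max 1 (ρ / δ))) ^ u
        ≤ δ ^ (-(max 1 ((1 + u) / κ))) := by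
  have hκ0 : 0 < κ := by linarith
  have hP0 : 0 < P := by linarith
  have hδinv : 1 ≤ δ⁻¹ := (one_le_inv₀ hδ).2 hδ1
  set x := max 1 (ρ / δ) with hx
  set m := min P x with hm
  have hx1 : 1 ≤ x := le_max_left _ _
  have hm1 : 1 ≤ m := le_min hP hx1
  have hm0 : 0 < m := by linarith
  have hxm : x * m ^ (κ - 1) ≤ δ⁻¹ := by
    rcases max_choice 1 (ρ / δ) with h | h
    · have hmx : m = 1 := le_antisymm ((min_le_right _ _).trans (by rw [hx, h])) hm1
      rw [hmx, Real.one_rpow, mul_one, hx, h]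
      exact hδinv
    · calc x * m ^ (κ - 1) ≤ (P ^ (1 - κ) / δ) * P ^ (κ - 1) := by
            refine mul_le_mul ?_ ?_ (by positivity) (by positivity)
            · rw [hx, h]
              gcongr
            · exact Real.rpow_le_rpow hm0.le (min_le_left _ _) (by linarith)
        _ = δ⁻¹ := by
            rw [div_mul_eq_mul_div, ← Real.rpow_add hP0]
            norm_num
  have hmκ : m ^ κ ≤ δ⁻¹ := by
    calc m ^ κ = m * m ^ (κ - 1) := by
          nth_rewrite 2 [← Real.rpow_one m]
          rw [← Real.rpow_add hm0]
          ring_nf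
      _ ≤ x * m ^ (κ - 1) := by gcongr; exact min_le_right _ _
      _ ≤ δ⁻¹ := hxm
  have hmδ : m ≤ δ ^ (-(1 / κ)) := by
    calc m = (m ^ κ) ^ (1 / κ) := by
          rw [← Real.rpow_mul hm0.le, mul_one_div_cancel hκ0.ne', Real.rpow_one]
      _ ≤ δ⁻¹ ^ (1 / κ) := by gcongr
      _ = δ ^ (-(1 / κ)) := by rw [Real.inv_rpow hδ.le, Real.rpow_neg hδ.le]
  refine ⟨hm1, hmδ, fun u hu => ?_⟩
  have hmono : ∀ y ≤ max 1 ((1 + u) / κ), δ ^ (-y) ≤ δ ^ (-(max 1 ((1 + u) / κ))) := fun y hy =>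
    Real.rpow_le_rpow_of_exponent_ge hδ hδ1 (by linarith)
  rcases le_total u (κ - 1) with h | h
  · calc x * m ^ u ≤ x * m ^ (κ - 1) := by
          gcongr
      _ ≤ δ ^ (-(1 : ℝ)) := by rw [Real.rpow_neg_one]; exact hxm
      _ ≤ _ := hmono _ (le_max_left _ _)
  · calc x * m ^ u = (x * m ^ (κ - 1)) * m ^ (u - (κ - 1)) := by
          rw [mul_assoc, ← Real.rpow_add hm0]
          ring_nf
      _ ≤ δ⁻¹ * (δ ^ (-(1 / κ))) ^ (u - (κ - 1)) := by gcongr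
      _ = δ ^ (-((1 + u) / κ)) := by
          rw [← Real.rpow_neg_one, ← Real.rpow_mul hδ.le, ← Real.rpow_add hδ]
          congr 1
          field_simp
          ring
      _ ≤ _ := hmono _ (le_max_right _ _)

/-- The cover of a digit set of the `K`-th piece that uses only the visible positions. -/
lemma exists_covers_piece {γ u : ℝ} (hu : γ * 2 < u) (hu0 : 0 < u) :
    ∃ A > 0, ∀ (κ : ℝ) (K : ℕ) (Z : Set ℝ),
      (∀ M, Covers Z (4 * pieceWeight κ K (M + 1)) (digitCount γ M)) → ∀ δ, 0 < δ →
        Covers Z (min δ (pieceScale κ K))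
          (A * (min (2 ^ ((K : ℝ) * (K + 1) / 2)) (max 1 (pieceScale κ K / δ))) ^ u) := by
  obtain ⟨A, hA, hcount, hcov⟩ := exists_covers_of_digitCount two_pos hu hu0
  refine ⟨A, hA, fun κ K Z hZ δ hδ => ?_⟩
  have hρ := pieceScale_pos (κ := κ) K
  rcases le_total (2 ^ ((K : ℝ) * (K + 1) / 2)) (max 1 (pieceScale κ K / δ)) with h | h
  · rw [min_eq_left h]
    refine ((hZ K).mono_radius ?_).mono_card ((hcount K).trans (le_of_eq ?_))
    · rw [pieceWeight, if_neg (by omega), mul_zero]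
      exact le_min hδ.le hρ.le
    · rw [← Real.rpow_mul two_pos.le]
      congr 2
      ring
  · rw [min_eq_right h]
    rcases le_total (pieceScale κ K) δ with h' | h'
    · rw [min_eq_right h', max_eq_left ((div_le_one hδ).2 h')]
      have h1 := hcov Z _ _ hρ (pieceWeight_le K) hZ _ hρ le_rfl
      rwa [div_self hρ.ne'] at h1
    · rw [min_eq_left h', max_eq_right ((one_le_div hδ).2 h')]
      exact hcov Z _ _ hρ (pieceWeight_le K) hZ δ hδ h'

lemma one_le_two_rpow_choose (K : ℕ) : (1 : ℝ) ≤ 2 ^ ((K : ℝ) * (K + 1) / 2) :=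
  Real.one_le_rpow one_le_two (by positivity)

lemma exists_covers_centreSet_piece {κ : ℝ} (hκ : 1 ≤ κ) {t : ℝ} (ht : 2 / κ < t) :
    ∃ C, ∀ K δ, 0 < δ → δ < 1 → Covers (centreSet (pieceWeight κ K)) δ (C * δ ^ (-t)) := by
  have hκ0 : 0 < κ := by linarith
  set u : ℝ := t * κ / 2 with hu
  have hu1 : 1 < u := by
    rw [div_lt_iff₀ hκ0] at ht
    linarith
  obtain ⟨A, hA, hcov⟩ := exists_covers_piece (γ := 1 / 2) (u := u) (by linarith) (by linarith)
  refine ⟨A * A * 2 ^ t, fun K δ hδ hδ1 => ?_⟩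
  have hδ2 : 0 < δ / 2 := by positivity
  obtain ⟨h1, h2, -⟩ := visible_bounds hκ (one_le_two_rpow_choose K) (pieceScale_le_rpow (κ := κ) K)
    hδ2 (by linarith)
  have h3 := (hcov κ K _ (covers_fullDigits (pieceWeight_nonneg K) (two_pow_mul_pieceWeight_le K))
    (δ / 2) hδ2).mono_radius (min_le_left _ _)
  have h4 : A * (min (2 ^ ((K : ℝ) * (K + 1) / 2)) (max 1 (pieceScale κ K / (δ / 2)))) ^ u
      ≤ A * (2 ^ (t / 2) * δ ^ (-(t / 2))) := by
    gcongr
    calc _ ≤ ((δ / 2) ^ (-(1 / κ))) ^ u := by gcongr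
      _ = (δ / 2) ^ (-(t / 2)) := by
        rw [← Real.rpow_mul hδ2.le, hu]
        congr 1
        field_simp
      _ = _ := by
        rw [Real.div_rpow hδ.le two_pos.le, Real.rpow_neg two_pos.le, div_inv_eq_mul, mul_comm]
  have h5 := h3.mono_card h4
  refine Covers.mono_card (F := centreSet (pieceWeight κ K))
    ((h5.prod h5).mono_radius (show 2 * (δ / 2) ≤ δ by linarith)) (le_of_eq ?_)
  have e1 : (2 : ℝ) ^ t = 2 ^ (t / 2) * 2 ^ (t / 2) := by
    rw [← Real.rpow_add two_pos, add_halves]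
  have e2 : δ ^ (-t) = δ ^ (-(t / 2)) * δ ^ (-(t / 2)) := by
    rw [← Real.rpow_add hδ]
    ring_nf
  rw [e1, e2]
  ring

lemma exists_covers_squaresSet_piece {κ : ℝ} (hκ : 1 ≤ κ) {t : ℝ} (ht : max 1 (7 / 4 / κ) < t) :
    ∃ C, ∀ K δ, 0 < δ → δ < 1 → Covers (squaresSet (pieceWeight κ K)) δ (C * δ ^ (-t)) := by
  have hκ0 : 0 < κ := by linarith
  obtain ⟨ht1, ht2⟩ := max_lt_iff.1 ht
  have hu : 3 / 4 < t * κ - 1 := by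
    rw [div_lt_iff₀ hκ0] at ht2
    linarith
  obtain ⟨A, hA, hcov⟩ := exists_covers_piece (γ := 3 / 8) (u := t * κ - 1) (by linarith)
    (by linarith)
  refine ⟨80 * A * 2 ^ t, fun K δ hδ hδ1 => ?_⟩
  have hδ2 : 0 < δ / 2 := by positivity
  have hρ := pieceScale_pos (κ := κ) K
  obtain ⟨-, -, h2⟩ := visible_bounds hκ (one_le_two_rpow_choose K) (pieceScale_le_rpow (κ := κ) K)
    hδ2 (by linarith)
  have h3 := h2 (t * κ - 1) (by linarith)
  rw [add_sub_cancel, mul_div_cancel_right₀ _ hκ0.ne', max_eq_right ht1.le] at h3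
  have h4 := hcov κ K _ (covers_sideSet (pieceWeight_nonneg K) (two_pow_mul_pieceWeight_le K))
    (δ / 2) hδ2
  have hmin : 0 < min (δ / 2) (pieceScale κ K) := lt_min hδ2 hρ
  have h5 := h4.crossSet (D := 20 * pieceWeight κ K 0) hmin (by
    rw [pieceWeight_zero]
    linarith [min_le_right (δ / 2) (pieceScale κ K)])
  have hx : pieceScale κ K / min (δ / 2) (pieceScale κ K)
      = max 1 (pieceScale κ K / (δ / 2)) := by
    rcases le_total (δ / 2) (pieceScale κ K) with h | h
    · rw [min_eq_left h, max_eq_right ((one_le_div hδ2).2 h)]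
    · rw [min_eq_right h, max_eq_left ((div_le_one hδ2).2 h), div_self hρ.ne']
  refine (h5.mono_radius (by linarith [min_le_left (δ / 2) (pieceScale κ K)])).mono_card ?_
  rw [pieceWeight_zero, mul_div_assoc, hx]
  calc _ = 80 * A * (max 1 (pieceScale κ K / (δ / 2)) *
        (min (2 ^ ((K : ℝ) * (K + 1) / 2)) (max 1 (pieceScale κ K / (δ / 2)))) ^ (t * κ - 1)) := by
        ring
    _ ≤ 80 * A * (δ / 2) ^ (-t) := by gcongr
    _ = 80 * A * 2 ^ t * δ ^ (-t) := by
        rw [Real.div_rpow hδ.le two_pos.le, Real.rpow_neg two_pos.le, div_inv_eq_mul]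
        ring

/-- At scales between the last weights of consecutive pieces, the earlier piece alone has enough
separated points. -/
lemma le_lowerBoxDim_of_pieces {κ : ℝ} (hκ : 1 ≤ κ) {S : Set Plane}
    (hS : ∀ K, centreSet (pieceWeight κ K) ⊆ S) : ((2 / κ : ℝ) : EReal) ≤ lowerBoxDim S := by
  have hκ0 : 0 < κ := by linarith
  refine le_lowerBoxDim fun t ht => ?_
  -- negative exponents are replaced by `0`
  set t' := max t 0 with ht'
  have ht'0 : 0 ≤ t' := le_max_right _ _
  have ht's : t' < 2 / κ := max_lt ht (by positivity)
  set θ : ℝ := κ * t' / 2 with hθ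
  have hθ1 : θ < 1 := by
    rw [lt_div_iff₀ hκ0] at ht's
    linarith
  have ht'2 : t' ≤ 2 := ht's.le.trans ((div_le_iff₀ hκ0).2 (by linarith))
  have hθ0 : 0 ≤ θ := by positivity
  obtain ⟨k₀, hk₀⟩ := exists_nat_gt (6 / (1 - θ))
  rw [div_lt_iff₀ (by linarith)] at hk₀
  set D : ℕ → ℝ := fun K => 2 ^ (-(κ * ((K : ℝ) * (K + 1) / 2)) - K) with hD
  have hD0 : ∀ K, 0 < D K := fun K => by positivity
  have hDw : ∀ K, pieceWeight κ K K = D K := by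
    intro K
    rw [pieceWeight, if_pos le_rfl, pieceScale, weight, ← Real.rpow_add two_pos]
    congr 1
    ring
  have hDle : ∀ K, D K ≤ (1 / 2) ^ K := by
    intro K
    rw [hD, one_div, inv_pow, ← Real.rpow_natCast, ← Real.rpow_neg two_pos.le]
    refine Real.rpow_le_rpow_of_exponent_le one_le_two ?_
    have : 0 ≤ κ * ((K : ℝ) * (K + 1) / 2) := by positivity
    linarith
  refine ⟨min (D k₀ / 2) 1, lt_min (by linarith [hD0 k₀]) one_pos, fun δ hδ hδε hcov => ?_⟩
  have hδ1 : δ < 1 := hδε.trans_le (min_le_right _ _)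
  have hδk : 2 * δ < D k₀ := by linarith [hδε.trans_le (min_le_left _ _)]
  have hex : ∃ j, D (k₀ + j) ≤ 2 * δ := by
    obtain ⟨j, hj⟩ := exists_pow_lt_of_lt_one (show 0 < 2 * δ by positivity)
      (by norm_num : (1 / 2 : ℝ) < 1)
    refine ⟨j, (hDle _).trans (le_trans ?_ hj.le)⟩
    exact pow_le_pow_of_le_one (by norm_num) (by norm_num) (by omega)
  classical
  have hfind := Nat.find_spec hex
  obtain ⟨j, hj⟩ : ∃ j, Nat.find hex = j + 1 := by
    refine Nat.exists_eq_succ_of_ne_zero fun h0 => ?_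
    rw [h0, add_zero] at hfind
    linarith
  have hlt : 2 * δ < D (k₀ + j) := not_le.1 (Nat.find_min hex (by omega))
  rw [hj, ← add_assoc] at hfind
  set K := k₀ + j with hK
  have hzero : ∀ k, (0 : ℤ) ∈ fullDigits k := fun k => Finset.mem_Ico.2 ⟨le_rfl, by positivity⟩
  have h1 := two_rpow_le_of_covers_cylinder (M := 0) (L := K) (a := fun _ => 0) (b := fun _ => 0)
    (pieceWeight_nonneg (κ := κ) K) (two_pow_mul_pieceWeight_le K) hzero hzero
    (fun d e hd he _ => hS K ⟨⟨d, fun k _ => hd k, rfl⟩, ⟨e, fun k _ => he k, rfl⟩⟩) hcov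
    (by rw [hDw]; exact hlt)
  have h2 : δ ^ (-t) ≤ (D (K + 1) / 2) ^ (-t') := by
    calc δ ^ (-t) ≤ δ ^ (-t') :=
          Real.rpow_le_rpow_of_exponent_ge hδ hδ1.le (neg_le_neg (le_max_left _ _))
      _ ≤ (D (K + 1) / 2) ^ (-t') :=
          Real.rpow_le_rpow_of_nonpos (by linarith [hD0 (K + 1)]) (by linarith) (by linarith)
  have h3 : (D (K + 1) / 2) ^ (-t')
      = 2 ^ (θ * ((K : ℝ) + 1) * (K + 2) + t' * (K + 2)) := by
    simp only [hD]
    rw [← Real.rpow_sub_one two_ne_zero, ← Real.rpow_mul two_pos.le, hθ]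
    congr 1
    push_cast
    ring
  rw [h3] at h2
  have h4 := (Real.rpow_le_rpow_left_iff one_lt_two).1 (h1.trans h2)
  have hKk : (k₀ : ℝ) ≤ K := by exact_mod_cast Nat.le_add_right k₀ j
  have hK0 : (0 : ℝ) ≤ K := Nat.cast_nonneg K
  have h5 : 6 < (1 - θ) * K := by nlinarith
  simp only [Nat.cast_zero, zero_mul, sub_zero] at h4
  have h6 : (1 - θ) * (K * ((K : ℝ) + 1)) ≤ 2 * θ * (K + 1) + t' * (K + 2) := by nlinarith
  have h7 : 2 * θ * ((K : ℝ) + 1) + t' * (K + 2) ≤ 6 * (K + 1) := by nlinarith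
  nlinarith

lemma subset_closedBall_of_abs_le {F : Set Plane} {D r : ℝ} (hr : 2 * D ≤ r)
    (h : ∀ p ∈ F, |p 0| ≤ D ∧ |p 1| ≤ D) : F ⊆ Metric.closedBall 0 r := by
  intro p hp
  rw [Metric.mem_closedBall]
  refine (dist_le_abs_add_abs p 0).trans ?_
  have := h p hp
  simp only [PiLp.zero_apply, sub_zero]
  linarith

lemma upperBoxDim_singleton_le (x : Plane) : upperBoxDim ({x} : Set Plane) ≤ ((0 : ℝ) : EReal) := by
  refine upperBoxDim_le fun t ht => ⟨1, one_pos, fun δ hδ hδ1 => ?_⟩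
  refine (covers_singleton x hδ).mono_card ?_
  exact Real.one_le_rpow_of_pos_of_le_one_of_nonpos hδ hδ1.le (by linarith)

lemma le_lowerBoxDim_singleton (x : Plane) : ((0 : ℝ) : EReal) ≤ lowerBoxDim ({x} : Set Plane) := by
  refine le_lowerBoxDim fun t ht => ⟨1, one_pos, fun δ hδ hδ1 hcov => ?_⟩
  have h1 := hcov.one_le (Set.singleton_nonempty x)
  have h2 := Real.rpow_lt_one hδ.le hδ1 (neg_pos.2 ht)
  linarith

lemma upperBoxDim_crossSet_one_le : upperBoxDim (crossSet {-1, 1} 1) ≤ ((1 : ℝ) : EReal) := by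
  refine upperBoxDim_le fun t ht => ?_
  obtain ⟨ε, hε, h⟩ := exists_mul_rpow_neg_lt ht 16
  exact ⟨min ε 1, lt_min hε one_pos, fun δ hδ hδε =>
    (covers_crossSet_one hδ (hδε.trans_le (min_le_right _ _))).mono_card
      (h δ hδ (hδε.trans_le (min_le_left _ _))).le⟩

lemma hasBoxDim_of_le {F : Set Plane} {d : ℝ} (h1 : (d : EReal) ≤ lowerBoxDim F)
    (h2 : upperBoxDim F ≤ d) : HasBoxDim F d :=
  ⟨le_antisymm (lowerBoxDim_le_upperBoxDim.trans h2) h1,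
    le_antisymm h2 (h1.trans lowerBoxDim_le_upperBoxDim)⟩

/-- The lower bound for the box counting dimension of `B` is the general one. -/
lemma ContainsSquares.hasBoxDim {S B : Set Plane} (h : ContainsSquares S B) (hS : S.Nonempty)
    (hB : IsCompact B) {s : ℝ} (hdim : HasBoxDim S s)
    (hup : upperBoxDim B ≤ ((max 1 (7 / 8 * s) : ℝ) : EReal)) :
    HasBoxDim B (max 1 (7 / 8 * s)) := by
  refine hasBoxDim_of_le ?_ hup
  have h1 := (h.mul_boxDim_le hB.isBounded).2
  rw [hdim.1, ← EReal.coe_mul] at h1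
  rcases max_choice 1 (7 / 8 * s) with h2 | h2
  · rw [h2]
    exact h.one_le_lowerBoxDim hS
  · rw [h2]
    exact h1

lemma exists_hasBoxDim {s : ℝ} (hs : s ∈ Set.Icc (0 : ℝ) 2) :
    ∃ S B : Set Plane, S.Nonempty ∧ IsCompact S ∧ IsCompact B ∧ ContainsSquares S B ∧
      HasBoxDim S s ∧ HasBoxDim B (max 1 (7 / 8 * s)) := by
  rcases hs.1.eq_or_lt with rfl | hpos
  · have hdim : HasBoxDim ({0} : Set Plane) 0 :=
      hasBoxDim_of_le (le_lowerBoxDim_singleton 0) (upperBoxDim_singleton_le 0)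
    refine ⟨{0}, crossSet {-1, 1} 1, Set.singleton_nonempty 0, isCompact_singleton,
      isCompact_crossSet_one, containsSquares_crossSet_one, hdim,
      containsSquares_crossSet_one.hasBoxDim (Set.singleton_nonempty 0) isCompact_crossSet_one
        hdim ?_⟩
    rw [mul_zero, max_eq_left zero_le_one]
    exact upperBoxDim_crossSet_one_le
  · set κ : ℝ := 2 / s with hκ
    have hκ1 : 1 ≤ κ := (one_le_div hpos).2 hs.2
    have hκs : 2 / κ = s := by rw [hκ]; field_simp
    set F : ℕ → Set Plane := fun K => centreSet (pieceWeight κ K) with hF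
    set G : ℕ → Set Plane := fun K => squaresSet (pieceWeight κ K) with hG
    have hη0 := fun K => pieceWeight_nonneg (κ := κ) K
    have hη := fun K => two_pow_mul_pieceWeight_le (κ := κ) K
    have hFball : ∀ K, F K ⊆ Metric.closedBall 0 (12 * (1 / 2) ^ K) := fun K =>
      subset_closedBall_of_abs_le (D := 6 * pieceWeight κ K 0)
        (by rw [pieceWeight_zero]; linarith [pieceScale_le K hκ1])
        fun p hp => ⟨abs_le_of_mem_digitSums (hη0 K) (hη K) hp.1,
          abs_le_of_mem_digitSums (hη0 K) (hη K) hp.2⟩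
    have hGball : ∀ K, G K ⊆ Metric.closedBall 0 (40 * (1 / 2) ^ K) := fun K =>
      subset_closedBall_of_abs_le (D := 20 * pieceWeight κ K 0)
        (by rw [pieceWeight_zero]; linarith [pieceScale_le K hκ1]) fun p hp => hp.2
    have hS : (insert 0 (⋃ K, F K)).Nonempty := Set.insert_nonempty _ _
    have hBc : IsCompact (insert 0 (⋃ K, G K)) :=
      isCompact_insert_iUnion (fun K => isCompact_squaresSet (hη0 K) (hη K)) hGball
    have hcontains : ContainsSquares (insert 0 (⋃ K, F K)) (insert 0 (⋃ K, G K)) := by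
      have key : ∀ K, ∀ c ∈ F K, ∃ r : ℝ, 0 < r ∧ squareBoundary c r ⊆ insert 0 (⋃ K, G K) := by
        intro K c hc
        obtain ⟨r, hr, hsub⟩ := containsSquares_squaresSet (hη0 K) (hη K)
          (by rw [pieceWeight_zero]; exact pieceScale_pos K) c hc
        exact ⟨r, hr, hsub.trans ((Set.subset_iUnion G K).trans (Set.subset_insert _ _))⟩
      rintro c (rfl | hc)
      · exact key 0 0 zero_mem_centreSet
      · obtain ⟨K, hK⟩ := Set.mem_iUnion.1 hc
        exact key K c hK
    have hdim : HasBoxDim (insert 0 (⋃ K, F K)) s := by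
      refine hasBoxDim_of_le ?_ ?_
      · rw [← hκs]
        exact le_lowerBoxDim_of_pieces hκ1 fun K =>
          (Set.subset_iUnion F K).trans (Set.subset_insert _ _)
      · refine upperBoxDim_insert_iUnion_le (by norm_num) hpos.le hFball fun t ht => ?_
        exact exists_covers_centreSet_piece hκ1 (by rwa [hκs])
    refine ⟨_, _, hS, isCompact_insert_iUnion (fun K => isCompact_centreSet (hη0 K) (hη K)) hFball,
      hBc, hcontains, hdim, hcontains.hasBoxDim hS hBc hdim ?_⟩
    refine upperBoxDim_insert_iUnion_le (by norm_num) (zero_le_one.trans (le_max_left _ _)) hGball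
      fun t ht => exists_covers_squaresSet_piece hκ1 ?_
    have : 7 / 4 / κ = 7 / 8 * s := by rw [hκ]; field_simp; norm_num
    rwa [this]

theorem theorem1p3 :
    (∀ S B : Set Plane, S.Nonempty → ContainsSquares S B →
      (Bornology.IsBounded S → Bornology.IsBounded B →
        max 1 (((7 / 8 : ℝ) : EReal) * upperBoxDim S) ≤ upperBoxDim B ∧
        max 1 (((7 / 8 : ℝ) : EReal) * lowerBoxDim S) ≤ lowerBoxDim B) ∧
      1 + 3 / 8 * packingDim S ≤ packingDim B) ∧
    (∀ s ∈ Set.Icc (0 : ℝ) 2,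
      (∃ S B : Set Plane, S.Nonempty ∧ IsCompact S ∧ IsCompact B ∧ ContainsSquares S B ∧
        HasBoxDim S s ∧ HasBoxDim B (max 1 (7 / 8 * s))) ∧
      (∃ S B : Set Plane, S.Nonempty ∧ IsCompact S ∧ IsCompact B ∧ ContainsSquares S B ∧
        packingDim S = ENNReal.ofReal s ∧ packingDim B = ENNReal.ofReal (1 + 3 / 8 * s))) := by
  refine ⟨fun S B hS h => ⟨fun _ hB => ?_, h.packingDim_le hS⟩,
    fun s hs => ⟨exists_hasBoxDim hs, exists_packingDim_eq hs⟩⟩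
  have h1 := h.one_le_lowerBoxDim hS
  obtain ⟨hup, hlow⟩ := h.mul_boxDim_le hB
  exact ⟨max_le (h1.trans lowerBoxDim_le_upperBoxDim) hup, max_le h1 hlow⟩
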